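/- Let $m,r\ge 2$ be integers, let $X_r$ be a set with $r$ elements, and let $\varphi\colon X_r^m\to X_r$ be a symmetric map such that $\#\varphi^{-1}(x)=r^{m-1}$ for every $x\in X_r$. The map $\varphi$ is called \emph{abundant} if the semigroup of self-maps of $X_r$ generated by the maps obtained from $\varphi$ by fixing all arguments but one contains a constant map. Let $\Omega=\Omega(m,r,\varphi)$ be the space of all functions $f$ from the vertices of the infinite rooted $m$-ary tree to $X_r$ such that $f(v)=\varphi(f(v_1),\dots,f(v_m))$ for every vertex $v$ with sons $v_1,\dots,v_m$. Equip it with the uniform measure $\mu$, i.e. the probability measure under which, for each $n$, the values at the $m^n$ vertices of level $n$ are independent and uniformly distributed on $X_r$. Let $K_m$ be the Cantor set of infinite paths from the root. For a cylinder set (that is, a clopen subset) $A\subset K_m$, with complement $A'$, let $\zeta(A)$ be the sigma-field generated by the values $f(v)$ at the vertices $v$ such that all paths through $v$ belong to $A$. Put $H_A=L^2(\Omega,\zeta(A),\mu)$ and let $$\xi(A)=\mathcal B(H_A)\otimes 1_{H_{A'}}\subset\mathcal B(L^2(\Omega,\mu)),\qquad L^2(\Omega,\mu)=H_A\otimes H_{A'},\quad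 f\otimes g\leftrightarrow fg.$$ The factorization $\xi$ is called \emph{continuous at a point} $x\in K_m$ if $\bigcap_n\xi(A_n)=\mathbb C\cdot\mathrm{Id}$ for every decreasing sequence $A_1\supset A_2\supset\cdots$ of cylinder sets with $\bigcap_n A_n=\{x\}$. A map $\xi$ from a Boolean algebra $\mathcal A$ to sets of bounded operators on a Hilbert space $H$ is called a \emph{Fock factorization} if there exist a standard Borel space $X$ with a $\sigma$-finite measure $\nu$, a measurable field of separable Hilbert spaces $K(x)$, $x\in X$, with direct integral $\mathcal K=\int^\oplus K(x)\,d\nu(x)$, a homomorphism $\sigma$ from $\mathcal A$ to the Boolean algebra of measurable subsets of $X$ modulo null sets, and a unitary operator $U\colon H\to\operatorname{EXP}\mathcal K$ onto the symmetric Fock space such that for all $A\in\mathcal A$ $$U\,\xi(A)\,U^{-1}=\mathcal B(\operatorname{EXP}\mathcal K(\sigma(A)))\otimes 1_{\operatorname{EXP}\mathcal K(X\setminus\sigma(A))},\qquad \mathcal K(B)=\int^\oplus_B K(x)\,d\nu(x).$$ Here $\operatorname{EXP}\mathcal K=\operatorname{EXP}\mathcal K(B)\otimes\operatorname{EXP}\mathcal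 K(X\setminus B)$ is the identification under which $\operatorname{EXP}(h+h')=\operatorname{EXP}h\otimes\operatorname{EXP}h'$, where $\operatorname{EXP}h=\bigoplus_{n}\frac1{\sqrt{n!}}h^{\otimes n}$. \textbf{Theorem.} For every point $x\in K_m$, the factorization $\xi$ of $L^2(\Omega(m,r,\varphi))$ over the algebra of cylinder sets of $K_m$ is continuous at $x$ if and only if $\varphi$ is abundant. If $\varphi$ is abundant, then $\xi$ is not a Fock factorization. -/

import Mathlib

open MeasureTheory TopologicalSpace
open scoped ENNReal InnerProductSpace TensorProduct

/-! ### Voting rules and abundance -/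

/-- A voting rule: a symmetric map `X_r ^ m → X_r` all of whose fibres have the same number
`r ^ (m - 1)` of points. -/
structure VotingRule (m r : ℕ) where
  /-- the map itself -/
  toFun : (Fin m → Fin r) → Fin r
  symmetric : ∀ (σ : Equiv.Perm (Fin m)) (a : Fin m → Fin r), toFun (a ∘ σ) = toFun a
  balanced : ∀ x : Fin r, Nat.card {a : Fin m → Fin r // toFun a = x} = r ^ (m - 1)

/-- The maps `X_r → X_r` obtained from `φ` by fixing all arguments but one. -/
def VotingRule.partialMaps {m r : ℕ} (φ : VotingRule m r) : Set (Function.End (Fin r)) :=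
  {g | ∃ (i : Fin m) (a : Fin m → Fin r), g = fun x => φ.toFun (Function.update a i x)}

/-- `φ` is abundant if the semigroup generated by the maps above contains a constant map. -/
def VotingRule.Abundant {m r : ℕ} (φ : VotingRule m r) : Prop :=
  ∃ g ∈ Subsemigroup.closure φ.partialMaps, ∃ c : Fin r, ∀ x : Fin r, g x = c

/-! ### The probability space of hierarchical voting

Vertices of the rooted `m`-ary tree are finite words `v : List (Fin m)`; the root is `[]` and the
sons of `v` are the words `v ++ [i]`. -/

/-- The space `Ω(m, r, φ)` of all functions `f` on the vertices of the tree such that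
`f v = φ (f v₁, …, f v_m)`, where `v₁, …, v_m` are the sons of `v`. -/
abbrev VotingSpace {m r : ℕ} (φ : VotingRule m r) : Type :=
  {f : List (Fin m) → Fin r // ∀ v, f v = φ.toFun fun i => f (v ++ [i])}

/-- The fibre of `φ` over `x`. -/
abbrev VotingRule.Fibre {m r : ℕ} (φ : VotingRule m r) (x : Fin r) : Type :=
  {a : Fin m → Fin r // φ.toFun a = x}

instance {m r : ℕ} (φ : VotingRule m r) (x : Fin r) : Nonempty (φ.Fibre x) := by
  have h := φ.balanced x
  have hr : 0 < r := x.pos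
  have h' : 0 < Nat.card (φ.Fibre x) := by rw [h]; positivity
  exact (Nat.card_pos_iff.1 h').1

/-- The seeds from which a random element of `Ω(m, r, φ)` is built: the value at the root, and
for each vertex `v` and each `x`, the values that the sons of `v` get if the value at `v` is `x`. -/
abbrev VotingRule.Seeds {m r : ℕ} (φ : VotingRule m r) : Type :=
  Fin r × ((p : List (Fin m) × Fin r) → φ.Fibre p.2)

/-- Independent uniformly distributed seeds. -/
noncomputable def VotingRule.seedMeasure {m r : ℕ} (φ : VotingRule m r) : Measure φ.Seeds :=
  (ProbabilityTheory.uniformOn (Set.univ : Set (Fin r))).prod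
    (Measure.infinitePi fun p : List (Fin m) × Fin r =>
      ProbabilityTheory.uniformOn (Set.univ : Set (φ.Fibre p.2)))

/-- Starting with the value `x` at the vertex `pre`, walk down the word `l`. -/
def VotingRule.descend {m r : ℕ} (φ : VotingRule m r)
    (s : (p : List (Fin m) × Fin r) → φ.Fibre p.2) :
    List (Fin m) → Fin r → List (Fin m) → Fin r
  | _, x, [] => x
  | pre, x, i :: l => VotingRule.descend φ s (pre ++ [i]) ((s (pre, x)).1 i) l

theorem VotingRule.descend_snoc {m r : ℕ} (φ : VotingRule m r)
    (s : (p : List (Fin m) × Fin r) → φ.Fibre p.2) (pre : List (Fin m)) (x : Fin r)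
    (l : List (Fin m)) (i : Fin m) :
    φ.descend s pre x (l ++ [i]) = (s (pre ++ l, φ.descend s pre x l)).1 i := by
  induction l generalizing pre x with
  | nil =>
    have h : pre ++ [] = pre := by simp
    rw [h, List.nil_append, VotingRule.descend, VotingRule.descend, VotingRule.descend]
  | cons j l ih =>
    have h : pre ++ j :: l = pre ++ [j] ++ l := by simp
    rw [h, List.cons_append, VotingRule.descend, ih, VotingRule.descend]

/-- The element of `Ω(m, r, φ)` built from the seeds. -/
def VotingRule.build {m r : ℕ} (φ : VotingRule m r) (s : φ.Seeds) : VotingSpace φ :=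
  ⟨φ.descend s.2 [] s.1, fun v => by
    simp only [VotingRule.descend_snoc]
    exact ((s.2 ([] ++ v, φ.descend s.2 [] s.1 v)).2).symm⟩

theorem VotingRule.measurable_build {m r : ℕ} (φ : VotingRule m r) : Measurable φ.build := by
  refine Measurable.subtype_mk (measurable_pi_lambda _ fun v => ?_)
  induction v using List.reverseRecOn with
  | nil => exact measurable_fst
  | append_singleton l i ih =>
    have h : Measurable fun q : Fin r × φ.Seeds => (q.2.2 (l, q.1)).1 i := by
      refine measurable_from_prod_countable_right fun x => ?_
      have h1 : Measurable fun y : φ.Seeds => y.2 (l, x) :=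
        (measurable_pi_apply (l, x)).comp measurable_snd
      exact (measurable_pi_apply i).comp (measurable_subtype_coe.comp h1)
    have h2 := h.comp (ih.prodMk measurable_id)
    have h3 : (fun s : φ.Seeds => φ.descend s.2 [] s.1 (l ++ [i])) =
        (fun q : Fin r × φ.Seeds => (q.2.2 (l, q.1)).1 i) ∘
          fun s : φ.Seeds => (φ.descend s.2 [] s.1 l, id s) := by
      funext s
      rw [VotingRule.descend_snoc]
      rfl
    rw [h3]
    exact h2

/-- The uniform measure on `Ω(m, r, φ)`. -/
noncomputable def votingMeasure {m r : ℕ} (φ : VotingRule m r) : Measure (VotingSpace φ) :=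
  φ.seedMeasure.map φ.build

instance {m r : ℕ} [NeZero r] (φ : VotingRule m r) : IsProbabilityMeasure (votingMeasure φ) := by
  have : IsProbabilityMeasure (ProbabilityTheory.uniformOn (Set.univ : Set (Fin r))) :=
    ProbabilityTheory.isProbabilityMeasure_uniformOn Set.finite_univ Set.univ_nonempty
  have h2 : ∀ p : List (Fin m) × Fin r, IsProbabilityMeasure
      (ProbabilityTheory.uniformOn (Set.univ : Set (φ.Fibre p.2))) := fun p =>
    ProbabilityTheory.isProbabilityMeasure_uniformOn Set.finite_univ Set.univ_nonempty
  have : IsProbabilityMeasure φ.seedMeasure := by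
    unfold VotingRule.seedMeasure; infer_instance
  exact Measure.isProbabilityMeasure_map φ.measurable_build.aemeasurable

/-- Values of a consistent function on the levels `≤ n` from those on level `n`. -/
def VotingRule.up {m r : ℕ} (φ : VotingRule m r) (a : List (Fin m) → Fin r) :
    ℕ → List (Fin m) → Fin r
  | 0, w => a w
  | k + 1, w => φ.toFun fun i => VotingRule.up φ a k (w ++ [i])

theorem VotingRule.build_level_iff {m r : ℕ} (φ : VotingRule m r) (a : List (Fin m) → Fin r)
    (n : ℕ) (s : φ.Seeds) :
    (∀ w : List (Fin m), w.length = n → (φ.build s).1 w = a w) ↔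
      s.1 = φ.up a n [] ∧ ∀ w : List (Fin m), w.length < n → ∀ i,
        (s.2 (w, φ.up a (n - w.length) w)).1 i = φ.up a (n - (w.length + 1)) (w ++ [i]) := by
  have snoc : ∀ w i, (φ.build s).1 (w ++ [i]) = (s.2 (w, (φ.build s).1 w)).1 i := fun w i => by
    simp [VotingRule.build, VotingRule.descend_snoc]
  constructor
  · intro h
    have key : ∀ k, ∀ w : List (Fin m), w.length + k = n → (φ.build s).1 w = φ.up a k w := by
      intro k
      induction k with
      | zero => intro w hw; exact h w (by simpa using hw)
      | succ k ih =>
        intro w hw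
        rw [(φ.build s).2 w, VotingRule.up]
        congr 1
        funext i
        exact ih _ (by simp; omega)
    refine ⟨?_, fun w hw i => ?_⟩
    · exact key n [] (by simp)
    · rw [← key (n - w.length) w (by omega), ← snoc]
      exact key _ _ (by simp; omega)
  · rintro ⟨h0, h1⟩
    have key : ∀ w : List (Fin m), w.length ≤ n →
        (φ.build s).1 w = φ.up a (n - w.length) w := by
      intro w
      induction w using List.reverseRecOn with
      | nil => intro _; exact h0
      | append_singleton l i ih =>
        intro hl
        simp only [List.length_append, List.length_singleton] at hl ⊢
        rw [snoc, ih (by omega), h1 l (by omega)]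
    intro w hw
    rw [key w hw.le, hw, Nat.sub_self, VotingRule.up]

/-- The values of a random element of `Ω(m, r, φ)` at the `m ^ n` vertices of level `n` are
independent and uniformly distributed on `X_r`. -/
theorem votingMeasure_level {m r : ℕ} (hm : 0 < m) (φ : VotingRule m r) (n : ℕ)
    (a : List (Fin m) → Fin r) :
    votingMeasure φ {f | ∀ w : List (Fin m), w.length = n → f.1 w = a w} =
      ((r : ℝ≥0∞)⁻¹) ^ (m ^ n) := by
  classical
  have hr : 0 < r := (a []).pos
  have h2 : ∀ p : List (Fin m) × Fin r, IsProbabilityMeasure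
      (ProbabilityTheory.uniformOn (Set.univ : Set (φ.Fibre p.2))) := fun p =>
    ProbabilityTheory.isProbabilityMeasure_uniformOn Set.finite_univ Set.univ_nonempty
  have hfin := List.finite_length_lt (Fin m) n
  have hmeas : MeasurableSet
      {f : VotingSpace φ | ∀ w : List (Fin m), w.length = n → f.1 w = a w} := by
    have : {f : VotingSpace φ | ∀ w : List (Fin m), w.length = n → f.1 w = a w} =
        ⋂ w : List (Fin m), ⋂ _ : w.length = n, {f : VotingSpace φ | f.1 w = a w} := by
      ext f; simp
    rw [this]
    refine MeasurableSet.iInter fun w => MeasurableSet.iInter fun _ => ?_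
    have hw : Measurable fun f : VotingSpace φ => f.1 w :=
      (measurable_pi_apply w).comp measurable_subtype_coe
    exact hw (measurableSet_singleton (a w))
  -- the index set and the box
  let ι : List (Fin m) → List (Fin m) × Fin r := fun w => (w, φ.up a (n - w.length) w)
  have hι : Function.Injective ι := fun v w h => (Prod.mk.inj h).1
  let S : Finset (List (Fin m) × Fin r) := hfin.toFinset.image ι
  let t : (p : List (Fin m) × Fin r) → Set (φ.Fibre p.2) := fun p =>
    {b | ∀ i, b.1 i = φ.up a (n - (p.1.length + 1)) (p.1 ++ [i])}
  have hpre : φ.build ⁻¹' {f | ∀ w : List (Fin m), w.length = n → f.1 w = a w} =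
      ({φ.up a n []} : Set (Fin r)) ×ˢ Set.pi (S : Set (List (Fin m) × Fin r)) t := by
    ext s
    rw [Set.mem_preimage, Set.mem_ofPred_eq, φ.build_level_iff]
    simp only [Set.mem_prod, Set.mem_singleton_iff, Set.mem_pi, S, Finset.coe_image,
      Set.Finite.coe_toFinset, Set.forall_mem_image, Set.mem_ofPred_eq, ι, t]
  have hroot : ProbabilityTheory.uniformOn (Set.univ : Set (Fin r)) {φ.up a n []} =
      (r : ℝ≥0∞)⁻¹ := by
    rw [ProbabilityTheory.uniformOn_univ]; simp
  have hbox : ∀ w : List (Fin m), w.length < n →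
      ProbabilityTheory.uniformOn (Set.univ : Set (φ.Fibre (ι w).2)) (t (ι w)) =
        ((r : ℝ≥0∞)⁻¹) ^ (m - 1) := by
    intro w hw
    have hup : φ.up a (n - w.length) w =
        φ.toFun fun i => φ.up a (n - (w.length + 1)) (w ++ [i]) := by
      have : n - w.length = (n - (w.length + 1)) + 1 := by omega
      rw [this, VotingRule.up]
    have ht : t (ι w) =
        {(⟨fun i => φ.up a (n - (w.length + 1)) (w ++ [i]), hup.symm⟩ : φ.Fibre (ι w).2)} := by
      ext b
      simp only [t, ι, Set.mem_ofPred_eq, Set.mem_singleton_iff, Subtype.ext_iff, funext_iff]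
    have hc : Fintype.card (φ.Fibre (ι w).2) = r ^ (m - 1) := by
      rw [← Nat.card_eq_fintype_card]; exact φ.balanced _
    rw [ht, ProbabilityTheory.uniformOn_univ, hc]
    simp [ENNReal.inv_pow]
  have hcard : ∀ k, (m - 1) * (List.finite_length_lt (Fin m) k).toFinset.card + 1 = m ^ k := by
    intro k
    induction k with
    | zero =>
      simp
    | succ k ih =>
      have hs : (List.finite_length_lt (Fin m) (k + 1)).toFinset =
          (List.finite_length_lt (Fin m) k).toFinset ∪
            (List.finite_length_eq (Fin m) k).toFinset := by
        ext w; simp; omega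
      have hd : Disjoint (List.finite_length_lt (Fin m) k).toFinset
          (List.finite_length_eq (Fin m) k).toFinset := by
        rw [Finset.disjoint_left]; intro w; simp; omega
      have he : (List.finite_length_eq (Fin m) k).toFinset.card = m ^ k := by
        rw [← Set.ncard_eq_toFinset_card _ (List.finite_length_eq (Fin m) k)]
        have : Nat.card (List.Vector (Fin m) k) = m ^ k := by
          rw [Nat.card_eq_fintype_card, card_vector]; simp
        exact this
      rw [hs, Finset.card_union_of_disjoint hd, he]
      obtain ⟨q, rfl⟩ : ∃ q, m = q + 1 := ⟨m - 1, by omega⟩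
      simp only [Nat.add_sub_cancel] at ih ⊢
      rw [pow_succ]
      nlinarith [ih]
  rw [votingMeasure, Measure.map_apply φ.measurable_build hmeas, hpre, VotingRule.seedMeasure,
    Measure.prod_prod, hroot, Measure.infinitePi_pi _ (fun p _ => (Set.toFinite _).measurableSet),
    Finset.prod_image (fun _ _ _ _ h => hι h),
    Finset.prod_congr rfl (fun w hw => hbox w (by simpa using hw)), Finset.prod_const,
    ← pow_mul, ← hcard n, pow_succ, mul_comm]

/-! ### The factorization of `L²(Ω)` over the cylinder algebra of the Cantor set -/

/-- The elementary cylinder `C_v`: all infinite paths through the vertex `v`. -/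
def elementaryCylinder {m : ℕ} (v : List (Fin m)) : Set (ℕ → Fin m) :=
  {x | ∀ i : Fin v.length, x i = v.get i}

/-- The sigma-field `ζ(A)` generated by the values on the elementary cylinders contained in `A`.
The Boolean algebra of cylinder sets is that of the clopen subsets of the path space. -/
abbrev votingSigma {m r : ℕ} (φ : VotingRule m r) (A : Clopens (ℕ → Fin m)) :
    MeasurableSpace (VotingSpace φ) :=
  ⨆ (v : List (Fin m)) (_ : elementaryCylinder v ⊆ (A : Set (ℕ → Fin m))),
    MeasurableSpace.comap (fun f : VotingSpace φ => f.1 v) inferInstance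

/-- The Hilbert space `L²(Ω(m, r, φ))`. -/
abbrev VotingL2 {m r : ℕ} (φ : VotingRule m r) : Type := Lp ℂ 2 (votingMeasure φ)

/-- The subspace `H_A = L²(Ω, ζ(A))` of `L²(Ω)`. -/
noncomputable abbrev votingSubspace {m r : ℕ} (φ : VotingRule m r) (A : Clopens (ℕ → Fin m)) :
    Submodule ℂ (VotingL2 φ) :=
  lpMeas ℂ ℂ (votingSigma φ A) 2 (votingMeasure φ)

/-- The operator algebra `ξ(A) = B(H_A) ⊗ 1` on `L²(Ω) = H_A ⊗ H_{A'}`, where `f ⊗ g` is the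
product `f g` of the independent functions `f ∈ H_A` and `g ∈ H_{A'}`, `A'` being the complement
of `A` (such a product is always square integrable; `p` below is its class in `L²(Ω)`). -/
def votingFactorization {m r : ℕ} (φ : VotingRule m r) (A : Clopens (ℕ → Fin m)) :
    Set (VotingL2 φ →L[ℂ] VotingL2 φ) :=
  {T | ∃ S : votingSubspace φ A →L[ℂ] votingSubspace φ A,
    ∀ (f : votingSubspace φ A) (g : votingSubspace φ Aᶜ) (p : VotingL2 φ),
      (∀ᵐ ω ∂votingMeasure φ, p ω = (f : VotingL2 φ) ω * (g : VotingL2 φ) ω) →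
        ∀ᵐ ω ∂votingMeasure φ, T p ω = (S f : VotingL2 φ) ω * (g : VotingL2 φ) ω}

/-- Continuity at the point `x` of a map `ξ` from the clopen sets of a space to sets of operators:
for each decreasing sequence of clopen sets with intersection `{x}`, the corresponding sequence of
operator algebras decreases to the algebra of scalar operators. -/
def ContinuousAtPoint {K H : Type*} [TopologicalSpace K] [NormedAddCommGroup H]
    [InnerProductSpace ℂ H] (ξ : Clopens K → Set (H →L[ℂ] H)) (x : K) : Prop :=
  ∀ A : ℕ → Clopens K, Antitone A → ⋂ n, (A n : Set K) = {x} →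
    ⋂ n, ξ (A n) = {T | ∃ c : ℂ, T = c • ContinuousLinearMap.id ℂ H}

/-! ### Fock spaces -/

/-- A bundled complex inner product space. -/
structure BundledInner : Type 1 where
  /-- the underlying type -/
  carrier : Type
  [group : NormedAddCommGroup carrier]
  [inner : InnerProductSpace ℂ carrier]

attribute [instance] BundledInner.group BundledInner.inner

/-- The algebraic tensor power `K ⊗ ⋯ ⊗ K` with its inner product. -/
noncomputable def tensorPowerBundle (K : Type) [NormedAddCommGroup K] [InnerProductSpace ℂ K] :
    ℕ → BundledInner
  | 0 => ⟨ℂ⟩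
  | n + 1 => ⟨(tensorPowerBundle K n).carrier ⊗[ℂ] K⟩

/-- The Hilbert space tensor power `K ⊗ ⋯ ⊗ K`. -/
abbrev HilbertTensorPower (K : Type) [NormedAddCommGroup K] [InnerProductSpace ℂ K] (n : ℕ) :
    Type :=
  UniformSpace.Completion (tensorPowerBundle K n).carrier

/-- The tensor `h ⊗ ⋯ ⊗ h` in the algebraic tensor power. -/
noncomputable def algPower {K : Type} [NormedAddCommGroup K] [InnerProductSpace ℂ K] (h : K) :
    (n : ℕ) → (tensorPowerBundle K n).carrier
  | 0 => (1 : ℂ)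
  | n + 1 => (algPower h n) ⊗ₜ[ℂ] h

/-- The tensor `h ⊗ ⋯ ⊗ h` in the Hilbert space tensor power. -/
noncomputable def tensorPower {K : Type} [NormedAddCommGroup K] [InnerProductSpace ℂ K] (h : K)
    (n : ℕ) : HilbertTensorPower K n :=
  ((algPower h n : (tensorPowerBundle K n).carrier) : HilbertTensorPower K n)

theorem inner_algPower {K : Type} [NormedAddCommGroup K] [InnerProductSpace ℂ K] (h k : K)
    (n : ℕ) : ⟪algPower h n, algPower k n⟫_ℂ = ⟪h, k⟫_ℂ ^ n := by
  induction n with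
  | zero =>
    change ⟪(1 : ℂ), (1 : ℂ)⟫_ℂ = _
    simp
  | succ n ih =>
    change ⟪(algPower h n) ⊗ₜ[ℂ] h, (algPower k n) ⊗ₜ[ℂ] k⟫_ℂ = _
    rw [TensorProduct.inner_tmul, ih, pow_succ]

theorem inner_tensorPower {K : Type} [NormedAddCommGroup K] [InnerProductSpace ℂ K] (h k : K)
    (n : ℕ) : ⟪tensorPower h n, tensorPower k n⟫_ℂ = ⟪h, k⟫_ℂ ^ n := by
  rw [tensorPower, tensorPower, UniformSpace.Completion.inner_coe, inner_algPower]

/-- The symmetric tensor power `SⁿK`, the closed subspace of the Hilbert space tensor power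
spanned by the tensors `h ⊗ ⋯ ⊗ h`. -/
noncomputable def symPower (K : Type) [NormedAddCommGroup K] [InnerProductSpace ℂ K] (n : ℕ) :
    Submodule ℂ (HilbertTensorPower K n) :=
  (Submodule.span ℂ (Set.range fun h : K => tensorPower h n)).topologicalClosure

theorem tensorPower_mem_symPower {K : Type} [NormedAddCommGroup K] [InnerProductSpace ℂ K] (h : K)
    (n : ℕ) : tensorPower h n ∈ symPower K n :=
  Submodule.le_topologicalClosure _ (Submodule.subset_span ⟨h, rfl⟩)

instance (K : Type) [NormedAddCommGroup K] [InnerProductSpace ℂ K] (n : ℕ) :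
    CompleteSpace (symPower K n) :=
  (Submodule.isClosed_topologicalClosure _).completeSpace_coe

/-- The Fock space `EXP K`, the Hilbert direct sum of the spaces `SⁿK`. -/
abbrev FockSpace (K : Type) [NormedAddCommGroup K] [InnerProductSpace ℂ K] : Type :=
  lp (fun n : ℕ => symPower K n) 2

/-- The `n`-th component `h ⊗ ⋯ ⊗ h / √n!` of `EXP h`. -/
noncomputable def expComponent {K : Type} [NormedAddCommGroup K] [InnerProductSpace ℂ K] (h : K)
    (n : ℕ) : symPower K n :=
  ((Real.sqrt (n.factorial : ℝ))⁻¹ : ℂ) •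
    ⟨tensorPower h n, tensorPower_mem_symPower h n⟩

theorem inner_expComponent {K : Type} [NormedAddCommGroup K] [InnerProductSpace ℂ K] (h k : K)
    (n : ℕ) : ⟪expComponent h n, expComponent k n⟫_ℂ = ⟪h, k⟫_ℂ ^ n / (n.factorial : ℂ) := by
  change ⟪((Real.sqrt (n.factorial : ℝ))⁻¹ : ℂ) • tensorPower h n,
    ((Real.sqrt (n.factorial : ℝ))⁻¹ : ℂ) • tensorPower k n⟫_ℂ = _
  rw [inner_smul_left, inner_smul_right, inner_tensorPower, ← Complex.ofReal_inv, Complex.conj_ofReal, ← mul_assoc,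
    ← Complex.ofReal_mul, ← mul_inv, Real.mul_self_sqrt (by positivity)]
  push_cast
  rw [div_eq_inv_mul]

theorem memlp_expComponent {K : Type} [NormedAddCommGroup K] [InnerProductSpace ℂ K] (h : K) :
    Memℓp (fun n : ℕ => expComponent h n) 2 := by
  refine memℓp_gen ?_
  have : ∀ n : ℕ, ‖expComponent h n‖ ^ (2 : ℝ≥0∞).toReal = (‖h‖ ^ 2) ^ n / (n.factorial : ℝ) := by
    intro n
    have h1 : ((‖expComponent h n‖ ^ 2 : ℝ) : ℂ) = (((‖h‖ ^ 2) ^ n / (n.factorial : ℝ) : ℝ) : ℂ) := by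
      have h0 := inner_expComponent h h n
      have h3 := inner_self_eq_norm_sq_to_K (𝕜 := ℂ) (expComponent h n)
      rw [inner_self_eq_norm_sq_to_K (𝕜 := ℂ) h] at h0
      rw [h0] at h3
      push_cast
      exact h3.symm
    have h2 := Complex.ofReal_injective h1
    simpa using h2
  simp_rw [this]
  exact Real.summable_pow_div_factorial _

/-- The exponential vector `EXP h = ⊕ₙ h ⊗ ⋯ ⊗ h / √n!`. -/
noncomputable def expVector {K : Type} [NormedAddCommGroup K] [InnerProductSpace ℂ K] (h : K) :
    FockSpace K :=
  ⟨fun n => expComponent h n, memlp_expComponent h⟩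

theorem inner_expVector {K : Type} [NormedAddCommGroup K] [InnerProductSpace ℂ K] (h k : K) :
    ⟪expVector h, expVector k⟫_ℂ = Complex.exp ⟪h, k⟫_ℂ := by
  rw [lp.inner_eq_tsum, Complex.exp_eq_exp_ℂ, NormedSpace.exp_eq_tsum_div]
  exact tsum_congr fun n => inner_expComponent h k n

/-- For an orthogonal decomposition `K = K₁ ⊕ K₂`, the operator algebra `B(EXP K₁) ⊗ 1` on
`EXP K = EXP K₁ ⊗ EXP K₂`, where `EXP (h + h') = EXP h ⊗ EXP h'` for `h ∈ K₁` and `h' ∈ K₂`: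
the operators `T` for which there is an operator `S` on `EXP K₁` such that `T` and `S ⊗ 1` have the
same matrix elements between exponential vectors (which are total). -/
def fockAlgebra {K : Type} [NormedAddCommGroup K] [InnerProductSpace ℂ K] (K₁ K₂ : Submodule ℂ K) :
    Set (FockSpace K →L[ℂ] FockSpace K) :=
  {T | ∃ S : FockSpace K₁ →L[ℂ] FockSpace K₁, ∀ (h k : K₁) (h' k' : K₂),
    ⟪expVector ((h : K) + (h' : K)), T (expVector ((k : K) + (k' : K)))⟫_ℂ =
      ⟪expVector h, S (expVector k)⟫_ℂ * ⟪expVector h', expVector k'⟫_ℂ}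

/-! ### Direct integrals and Fock factorizations -/

/-- The Hilbert space `ℓ²`. -/
abbrev Ell2 : Type := lp (fun _ : ℕ => ℂ) 2

/-- The space `K(x)` of the measurable field of Hilbert spaces with the fundamental sequence of
sections `s 0, s 1, …`: the closed span of the `s n x`. Up to isomorphism, every measurable field
of separable Hilbert spaces is realized by closed subspaces of `ℓ²` in this way. -/
noncomputable def fieldFibre {X : Type} (s : ℕ → X → Ell2) (x : X) : Submodule ℂ Ell2 :=
  (Submodule.span ℂ (Set.range fun n => s n x)).topologicalClosure

/-- The direct integral of the Hilbert spaces `K(x)` with respect to `ν`: all square integrable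
functions `F` with `F x ∈ K(x)` almost everywhere. -/
noncomputable def directIntegral {X : Type} [MeasurableSpace X] (ν : Measure X)
    (s : ℕ → X → Ell2) : Submodule ℂ (Lp Ell2 2 ν) where
  carrier := {F | ∀ᵐ x ∂ν, F x ∈ fieldFibre s x}
  zero_mem' := by
    filter_upwards [Lp.coeFn_zero Ell2 2 ν] with x hx
    rw [hx]; exact Submodule.zero_mem _
  add_mem' := by
    intro F G hF hG
    filter_upwards [hF, hG, Lp.coeFn_add F G] with x h1 h2 h3
    rw [h3]; exact Submodule.add_mem _ h1 h2
  smul_mem' := by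
    intro c F hF
    filter_upwards [hF, Lp.coeFn_smul c F] with x h1 h3
    rw [h3]; exact Submodule.smul_mem _ _ h1

/-- The part `K(A)` of the direct integral over `A`: the elements that vanish almost everywhere
outside `A`. -/
noncomputable def directIntegralPart {X : Type} [MeasurableSpace X] (ν : Measure X)
    (s : ℕ → X → Ell2) (A : Set X) : Submodule ℂ (directIntegral ν s) where
  carrier := {F | ∀ᵐ x ∂ν, x ∉ A → (F : Lp Ell2 2 ν) x = 0}
  zero_mem' := by
    filter_upwards [Lp.coeFn_zero Ell2 2 ν] with x hx _
    simpa using hx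
  add_mem' := by
    intro F G hF hG
    filter_upwards [hF, hG, Lp.coeFn_add (F : Lp Ell2 2 ν) (G : Lp Ell2 2 ν)] with x h1 h2 h3 hx
    rw [Submodule.coe_add, h3, Pi.add_apply, h1 hx, h2 hx, add_zero]
  smul_mem' := by
    intro c F hF
    filter_upwards [hF, Lp.coeFn_smul c (F : Lp Ell2 2 ν)] with x h1 h3 hx
    rw [Submodule.coe_smul, h3, Pi.smul_apply, h1 hx, smul_zero]

/-- The Fock factorization determined by the measure space `(X, ν)` and the measurable field of
Hilbert spaces with the fundamental sequence `s`: to a measurable set `A` it assigns the operator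
algebra `B(EXP K(A)) ⊗ 1`. -/
def fockFactorization {X : Type} [MeasurableSpace X] (ν : Measure X) (s : ℕ → X → Ell2)
    (A : Set X) : Set (FockSpace (directIntegral ν s) →L[ℂ] FockSpace (directIntegral ν s)) :=
  fockAlgebra (directIntegralPart ν s A) (directIntegralPart ν s Aᶜ)

/-- A factorization `ξ` of a Hilbert space over a Boolean algebra is a Fock factorization if there
are a Lebesgue space `(X, ν)` with a measurable field of Hilbert spaces, a homomorphism `σ` of the
base into the Boolean algebra of measurable subsets of `X` modulo `ν`-null sets, and a unitary
operator `U` that carries `ξ(A)` to the algebra that the Fock factorization assigns to `σ(A)`, for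
each `A` in the base. -/
def IsFockFactorization {B H : Type*} [BooleanAlgebra B] [NormedAddCommGroup H]
    [InnerProductSpace ℂ H] (ξ : B → Set (H →L[ℂ] H)) : Prop :=
  ∃ (X : Type) (_ : MeasurableSpace X) (_ : StandardBorelSpace X) (ν : Measure X)
    (_ : SigmaFinite ν) (s : ℕ → X → Ell2) (σ : B → Set X)
    (U : H ≃ₗᵢ[ℂ] FockSpace (directIntegral ν s)),
    (∀ n, StronglyMeasurable (s n)) ∧
    (∀ A, MeasurableSet (σ A)) ∧
    (∀ A A', σ (A ⊔ A') =ᵐ[ν] (σ A ∪ σ A' : Set X)) ∧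
    (∀ A, σ Aᶜ =ᵐ[ν] ((σ A)ᶜ : Set X)) ∧
    ∀ (A : B) (T : H →L[ℂ] H), T ∈ ξ A ↔
      (U.toContinuousLinearEquiv : H →L[ℂ] FockSpace (directIntegral ν s)).comp
        (T.comp (U.symm.toContinuousLinearEquiv : FockSpace (directIntegral ν s) →L[ℂ] H)) ∈
        fockFactorization ν s (σ A)

/-! Continuity at `x`. Along the path `x`, the value at the root is the image of the value at the
`n`-th vertex under a random map `pathMap`, a product of partial maps of `φ` determined by the votes
off the path. If `φ` is abundant, independent blocks of fixed length each produce a given constant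
map with probability bounded below, so almost surely the product becomes constant. The same holds
from every vertex of the path, so the off-path votes determine everything modulo null sets. An
operator `T` in all `ξ(A_n)` then sends 1 to a function independent of the off-path votes, hence to
a constant `c`. It multiplies the dense space of functions of off-path votes by `c`, so it is
scalar. If `φ` is not abundant, the conditional expectation given the off-path votes still lies in
every `ξ(A_n)`. It is not scalar: no finite product is constant, so the conditional probability of
any given root value never exceeds `1 - 1/r` (`condExp_vote_le`), and by Lévy's upward theorem the
root value is not off-path measurable.

Not Fock. In a Fock space each exponential vector is a product vector for every `A`: it is fixed by
a projection in the algebra of `A` that compresses this algebra to scalars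
(`exists_projection_fockAlgebra`). Its counterpart `ψ` in `L²(Ω)`, if its mean is nonzero and scaled
to 1, has integrals that factorize over disjoint regions (`setIntegral_mul_of_projection`). Hence
the squared norm of its average at level `n` is a product over the vertices, bounded by `exp
‖chaosProj φ n ψ‖²` (`norm_sq_levelAvg_le`).

The crux is that `chaosProj φ n` tends strongly to 0 (`tendsto_chaosProj`): no nonzero function is
additive over the vertices of every level. For functions of one vote, going down `k` levels
multiplies the squared norm of the additive part by a factor controlled by `m ^ k` and `transfer φ ^
k`. This factor is less than 1 once `m ^ k ≥ r`, because a nonconstant symmetric sum over `m ^ k`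
votes takes more than `r` values. Compactness makes the contraction uniform and iteration gives
decay; indicators of level sets reduce to this case and are total.

So `ψ = 1`: every exponential vector is orthogonal or proportional to the image of 1. By continuity
of `h ↦ EXP h` the Fock space is then one-dimensional, whereas `L²(Ω)` is not. -/

set_option linter.unusedSectionVars false

/-! ### Projections of `L²` onto sub-sigma-fields, and independence -/

section SubSigmaFields

variable {Ω : Type*} {m m₁ m₂ m0 : MeasurableSpace Ω} {μ : Measure Ω}

theorem lpMeas_mono (h : m₁ ≤ m₂) : lpMeas ℂ ℂ m₁ 2 μ ≤ lpMeas ℂ ℂ m₂ 2 μ :=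
  fun _ hx => (AEStronglyMeasurable.mono h hx : AEStronglyMeasurable[m₂] _ μ)

/-- The orthogonal projection of `L²` onto the functions measurable with respect to a smaller
sigma-field. -/
noncomputable def projL2 (μ : Measure Ω) (hm : m ≤ m0) : Lp ℂ 2 μ →L[ℂ] Lp ℂ 2 μ :=
  (lpMeas ℂ ℂ m 2 μ).subtypeL.comp (condExpL2 ℂ ℂ hm)

theorem projL2_mem (hm : m ≤ m0) (x : Lp ℂ 2 μ) : projL2 μ hm x ∈ lpMeas ℂ ℂ m 2 μ :=
  (condExpL2 ℂ ℂ hm x).2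

theorem projL2_eq_self (hm : m ≤ m0) {x : Lp ℂ 2 μ} (hx : x ∈ lpMeas ℂ ℂ m 2 μ) :
    projL2 μ hm x = x := by
  have : Fact (m ≤ m0) := ⟨hm⟩
  exact Submodule.starProjection_eq_self_iff.2 hx

theorem inner_projL2_left (hm : m ≤ m0) (x y : Lp ℂ 2 μ) :
    ⟪projL2 μ hm x, y⟫_ℂ = ⟪x, projL2 μ hm y⟫_ℂ :=
  inner_condExpL2_left_eq_right hm

/-- The sets on which the two integrals agree form a Dynkin class. The whole space need not belong
to `C`, so agreement there is a separate hypothesis, used for complements. -/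
theorem setIntegral_eq_of_isPiSystem {C : Set (Set Ω)} (hC : IsPiSystem C)
    (hle : MeasurableSpace.generateFrom C ≤ m0) {f g : Ω → ℂ} (hf : Integrable f μ)
    (hg : Integrable g μ) (huniv : ∫ ω, f ω ∂μ = ∫ ω, g ω ∂μ)
    (h : ∀ s ∈ C, ∫ ω in s, f ω ∂μ = ∫ ω in s, g ω ∂μ) {s : Set Ω}
    (hs : MeasurableSet[MeasurableSpace.generateFrom C] s) :
    ∫ ω in s, f ω ∂μ = ∫ ω in s, g ω ∂μ := by
  induction s, hs using MeasurableSpace.induction_on_inter rfl hC with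
  | empty => simp
  | basic t ht => exact h t ht
  | compl t ht ih =>
    have h1 := integral_add_compl (hle t ht) hf
    have h2 := integral_add_compl (hle t ht) hg
    rw [← ih] at h2
    exact add_left_cancel (h1.trans (huniv.trans h2.symm))
  | iUnion t hd ht ih =>
    rw [integral_iUnion (fun i => hle _ (ht i)) hd hf.integrableOn,
      integral_iUnion (fun i => hle _ (ht i)) hd hg.integrableOn]
    exact tsum_congr ih

theorem isPiSystem_of_monotone {ι : Type*} [LinearOrder ι] {F : ι → MeasurableSpace Ω}
    (hF : Monotone F) : IsPiSystem {s | ∃ i, MeasurableSet[F i] s} := by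
  rintro s ⟨i, hi⟩ t ⟨j, hj⟩ _
  exact ⟨max i j, (hF (le_max_left i j) s hi).inter (hF (le_max_right i j) t hj)⟩

theorem generateFrom_iSup {ι : Type*} (F : ι → MeasurableSpace Ω) :
    MeasurableSpace.generateFrom {s | ∃ i, MeasurableSet[F i] s} = ⨆ i, F i := by
  rw [MeasurableSpace.measurableSpace_iSup_eq]

variable [IsProbabilityMeasure μ]

/-- The indicator function of a measurable set as an element of `L²`. -/
noncomputable def indL2 (μ : Measure Ω) [IsProbabilityMeasure μ] {s : Set Ω}
    (hs : MeasurableSet s) : Lp ℂ 2 μ :=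
  indicatorConstLp 2 hs (measure_ne_top μ s) (1 : ℂ)

/-- The constant function `1` as an element of `L²`. -/
noncomputable def oneL2 (μ : Measure Ω) [IsProbabilityMeasure μ] : Lp ℂ 2 μ :=
  indL2 μ MeasurableSet.univ

theorem inner_indL2 {s : Set Ω} (hs : MeasurableSet s) (x : Lp ℂ 2 μ) :
    ⟪indL2 μ hs, x⟫_ℂ = ∫ ω in s, x ω ∂μ :=
  L2.inner_indicatorConstLp_one hs (measure_ne_top μ s) x

theorem inner_oneL2 (x : Lp ℂ 2 μ) : ⟪oneL2 μ, x⟫_ℂ = ∫ ω, x ω ∂μ := by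
  rw [oneL2, inner_indL2, setIntegral_univ]

theorem inner_indL2_indL2 {s t : Set Ω} (hs : MeasurableSet s) (ht : MeasurableSet t) :
    ⟪indL2 μ hs, indL2 μ ht⟫_ℂ = (μ.real (s ∩ t) : ℂ) :=
  L2.inner_indicatorConstLp_one_indicatorConstLp_one hs ht

theorem coeFn_indL2 {s : Set Ω} (hs : MeasurableSet s) :
    indL2 μ hs =ᵐ[μ] s.indicator fun _ => (1 : ℂ) :=
  indicatorConstLp_coeFn

theorem coeFn_oneL2 : oneL2 μ =ᵐ[μ] fun _ => (1 : ℂ) := by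
  filter_upwards [coeFn_indL2 (μ := μ) MeasurableSet.univ] with ω h
  rw [oneL2, h, Set.indicator_univ]

theorem norm_oneL2 : ‖oneL2 μ‖ = 1 := by
  have h' : ‖oneL2 μ‖ ^ 2 = 1 := by
    rw [← inner_self_eq_norm_sq (𝕜 := ℂ), oneL2, inner_indL2_indL2]; simp
  exact (pow_eq_one_iff_of_nonneg (norm_nonneg _) two_ne_zero).1 h'

theorem integrable_L2 (x : Lp ℂ 2 μ) : Integrable x μ :=
  (Lp.memLp x).integrable one_le_two

theorem indL2_mem (hm : m ≤ m0) {s : Set Ω} (hs : MeasurableSet[m] s) :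
    indL2 μ (hm s hs) ∈ lpMeas ℂ ℂ m 2 μ :=
  mem_lpMeas_indicatorConstLp hm hs (measure_ne_top μ s)

theorem oneL2_mem (hm : m ≤ m0) : oneL2 μ ∈ lpMeas ℂ ℂ m 2 μ :=
  indL2_mem hm (@MeasurableSet.univ Ω m)

theorem eq_of_forall_setIntegral (x y : Lp ℂ 2 μ)
    (h : ∀ s, MeasurableSet s → ∫ ω in s, x ω ∂μ = ∫ ω in s, y ω ∂μ) : x = y :=
  Lp.ext ((integrable_L2 x).ae_eq_of_forall_setIntegral_eq _ _ (integrable_L2 y)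
    fun s hs _ => h s hs)

theorem projL2_ae_eq_condExp (hm : m ≤ m0) (x : Lp ℂ 2 μ) :
    projL2 μ hm x =ᵐ[μ] μ[x | m] := by
  have h := (Lp.memLp x).condExpL2_ae_eq_condExp (𝕜 := ℂ) hm
  rw [Lp.toLp_coeFn] at h
  exact h

theorem setIntegral_projL2 (hm : m ≤ m0) (x : Lp ℂ 2 μ) {s : Set Ω} (hs : MeasurableSet[m] s) :
    ∫ ω in s, projL2 μ hm x ω ∂μ = ∫ ω in s, x ω ∂μ := by
  rw [← inner_indL2 (hm s hs), ← inner_projL2_left, projL2_eq_self hm (indL2_mem hm hs),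
    inner_indL2]

/-- Uniqueness of the conditional expectation; this is how concrete projections are identified
below. -/
theorem projL2_eq_of_setIntegral (hm : m ≤ m0) {x z : Lp ℂ 2 μ} (hz : z ∈ lpMeas ℂ ℂ m 2 μ)
    (h : ∀ s, MeasurableSet[m] s → ∫ ω in s, z ω ∂μ = ∫ ω in s, x ω ∂μ) :
    projL2 μ hm x = z := by
  refine Lp.ext ((projL2_ae_eq_condExp hm x).trans ?_)
  exact (ae_eq_condExp_of_forall_setIntegral_eq hm (integrable_L2 x)
    (fun s _ _ => (integrable_L2 z).integrableOn) (fun s hs _ => h s hs) hz).symm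

theorem setIntegral_of_indep (h₁ : m₁ ≤ m0) (h₂ : m₂ ≤ m0)
    (hi : ProbabilityTheory.Indep m₁ m₂ μ) {f : Ω → ℂ} (hf : AEStronglyMeasurable[m₁] f μ)
    (hfi : Integrable f μ) {t : Set Ω} (ht : MeasurableSet[m₂] t) :
    ∫ ω in t, f ω ∂μ = μ.real t * ∫ ω, f ω ∂μ := by
  have h := condExp_indep_eq h₁ h₂ hf.stronglyMeasurable_mk hi
  have h3 : Integrable (hf.mk f) μ := hfi.congr hf.ae_eq_mk
  have h4 : ∫ ω in t, f ω ∂μ = ∫ ω in t, hf.mk f ω ∂μ :=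
    integral_congr_ae (ae_restrict_of_ae hf.ae_eq_mk)
  rw [h4, ← setIntegral_condExp h₂ h3 ht, integral_congr_ae (ae_restrict_of_ae h),
    setIntegral_const, integral_congr_ae hf.ae_eq_mk, Complex.real_smul]

/-- The truncated function `1_s x` is still `m₁`-measurable, hence independent of `t`. -/
theorem setIntegral_inter_of_indep (h₁ : m₁ ≤ m0) (h₂ : m₂ ≤ m0)
    (hi : ProbabilityTheory.Indep m₁ m₂ μ) {x : Lp ℂ 2 μ} (hx : x ∈ lpMeas ℂ ℂ m₁ 2 μ)
    {s t : Set Ω} (hs : MeasurableSet[m₁] s) (ht : MeasurableSet[m₂] t) :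
    ∫ ω in s ∩ t, x ω ∂μ = μ.real t * ∫ ω in s, x ω ∂μ := by
  have h : AEStronglyMeasurable[m₁] (s.indicator x) μ :=
    ⟨s.indicator (AEStronglyMeasurable.mk (m := m₁) x hx),
      (AEStronglyMeasurable.stronglyMeasurable_mk (m := m₁) hx).indicator hs, by
      filter_upwards [AEStronglyMeasurable.ae_eq_mk (m := m₁) hx] with ω h
      simp only [Set.indicator, h]⟩
  have h2 := setIntegral_of_indep h₁ h₂ hi h ((integrable_L2 x).indicator (h₁ s hs)) ht
  rw [setIntegral_indicator (h₁ s hs), integral_indicator (h₁ s hs), Set.inter_comm] at h2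
  exact h2

theorem projL2_of_indep (h₁ : m₁ ≤ m0) (h₂ : m₂ ≤ m0)
    (hi : ProbabilityTheory.Indep m₁ m₂ μ) {x : Lp ℂ 2 μ} (hx : x ∈ lpMeas ℂ ℂ m₁ 2 μ) :
    projL2 μ h₂ x = (∫ ω, x ω ∂μ) • oneL2 μ := by
  refine projL2_eq_of_setIntegral h₂ (Submodule.smul_mem _ _ (oneL2_mem h₂)) fun s hs => ?_
  rw [setIntegral_of_indep h₁ h₂ hi hx (integrable_L2 x) hs, ← inner_indL2 (h₂ s hs), inner_smul_right, oneL2,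
    inner_indL2_indL2, Set.inter_univ, mul_comm]

/-- A factor that is measurable with respect to the sigma-field can be pulled out. -/
theorem projL2_mul (hm : m ≤ m0) {f g p : Lp ℂ 2 μ} (hg : g ∈ lpMeas ℂ ℂ m 2 μ)
    (hp : ∀ᵐ ω ∂μ, p ω = f ω * g ω) : ∀ᵐ ω ∂μ, projL2 μ hm p ω = projL2 μ hm f ω * g ω := by
  have hi : Integrable (fun ω => f ω * g ω) μ := (integrable_L2 p).congr hp
  have h := condExp_bilin_of_aestronglyMeasurable_right (m := m) (ContinuousLinearMap.mul ℝ ℂ)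
    (f := f) (g := g) hg hi (integrable_L2 f)
  filter_upwards [projL2_ae_eq_condExp hm p, projL2_ae_eq_condExp hm f, h,
    condExp_congr_ae (m := m) (μ := μ) hp] with ω h1 h2 h3 h4
  rw [h1, h2, h4]
  exact h3

/-- Two functions with the same integrals over all sets of an increasing sequence of sigma-fields
that generates everything modulo null sets are equal. -/
theorem eq_of_setIntegral_of_monotone {F : ℕ → MeasurableSpace Ω} (hF : Monotone F)
    (hle : ∀ n, F n ≤ m0) (hfull : m0 ≤ @eventuallyMeasurableSpace Ω (⨆ n, F n) (ae μ) _)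
    {x y : Lp ℂ 2 μ}
    (h : ∀ n s, MeasurableSet[F n] s → ∫ ω in s, x ω ∂μ = ∫ ω in s, y ω ∂μ) : x = y := by
  refine eq_of_forall_setIntegral x y fun s hs => ?_
  obtain ⟨t, ht, hst⟩ := hfull s hs
  rw [setIntegral_congr_set hst, setIntegral_congr_set hst]
  have hgen := generateFrom_iSup F
  refine setIntegral_eq_of_isPiSystem (isPiSystem_of_monotone hF)
    (hgen.le.trans (iSup_le hle)) (integrable_L2 x) (integrable_L2 y) ?_ ?_ (hgen.ge t ht)
  · simpa using h 0 Set.univ MeasurableSet.univ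
  · rintro s ⟨n, hn⟩; exact h n s hn

end SubSigmaFields

/-! ### Words, paths and elementary cylinders -/

section Words

variable {m : ℕ}

/-- The vertices of level `n`. -/
abbrev Level (m n : ℕ) : Type := {l : List (Fin m) // l.length = n}

instance (n : ℕ) : Fintype (Level m n) := inferInstanceAs (Fintype (List.Vector (Fin m) n))

theorem card_level (n : ℕ) : Fintype.card (Level m n) = m ^ n := by
  have := card_vector (α := Fin m) n
  rwa [Fintype.card_fin] at this

/-- The first `n` letters of an infinite path. -/
def pathWord (x : ℕ → Fin m) (n : ℕ) : List (Fin m) := (List.range n).map x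

@[simp] theorem length_pathWord (x : ℕ → Fin m) (n : ℕ) : (pathWord x n).length = n := by
  simp [pathWord]

theorem pathWord_succ (x : ℕ → Fin m) (n : ℕ) : pathWord x (n + 1) = pathWord x n ++ [x n] := by
  simp [pathWord, List.range_succ]

theorem mem_elementaryCylinder {x : ℕ → Fin m} {v : List (Fin m)} :
    x ∈ elementaryCylinder v ↔ pathWord x v.length = v := by
  constructor
  · intro h
    refine List.ext_getElem (by simp) fun i h1 h2 => ?_
    have := h ⟨i, h2⟩
    simpa [pathWord] using this
  · intro h i
    have : (pathWord x v.length)[i.1]'(by simp) = v[i.1] := by simp only [h]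
    simpa [pathWord] using this

theorem elementaryCylinder_append_subset (v w : List (Fin m)) :
    elementaryCylinder (v ++ w) ⊆ elementaryCylinder v := by
  intro x hx i
  have := hx ⟨i.1, by simp; omega⟩
  simpa using this

theorem elementaryCylinder_disjoint {v w : List (Fin m)} (hl : v.length = w.length) (h : v ≠ w) :
    Disjoint (elementaryCylinder v) (elementaryCylinder w) := by
  rw [Set.disjoint_left]
  intro x hv hw
  rw [mem_elementaryCylinder] at hv hw
  exact h (by rw [← hv, ← hw, hl])

theorem elementaryCylinder_nonempty [NeZero m] (v : List (Fin m)) :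
    (elementaryCylinder v).Nonempty :=
  -- The path continues the word by zeros.
  ⟨fun i => v.getD i 0, fun i => by simp⟩

theorem self_mem_elementaryCylinder_pathWord (x : ℕ → Fin m) (n : ℕ) :
    x ∈ elementaryCylinder (pathWord x n) := by
  rw [mem_elementaryCylinder, length_pathWord]

theorem isClopen_elementaryCylinder (v : List (Fin m)) : IsClopen (elementaryCylinder v) := by
  have : elementaryCylinder v = ⋂ i : Fin v.length, (fun x : ℕ → Fin m => x i) ⁻¹' {v.get i} := by
    ext x; simp [elementaryCylinder]
  rw [this]
  exact isClopen_iInter_of_finite fun i => (isClopen_discrete _).preimage (continuous_apply _)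

/-- The elementary cylinder as a clopen set. -/
def clopenCylinder (v : List (Fin m)) : Clopens (ℕ → Fin m) :=
  ⟨elementaryCylinder v, isClopen_elementaryCylinder v⟩

/-- Two elementary cylinders are nested or disjoint. -/
theorem elementaryCylinder_trichotomy (v w : List (Fin m)) :
    elementaryCylinder v ⊆ elementaryCylinder w ∨ elementaryCylinder w ⊆ elementaryCylinder v ∨
      Disjoint (elementaryCylinder v) (elementaryCylinder w) := by
  by_cases hd : Disjoint (elementaryCylinder v) (elementaryCylinder w)
  · exact Or.inr (Or.inr hd)
  · obtain ⟨x, hv, hw⟩ := Set.not_disjoint_iff.1 hd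
    rw [mem_elementaryCylinder] at hv hw
    have key : ∀ u u' : List (Fin m), pathWord x u.length = u → pathWord x u'.length = u' →
        u.length ≤ u'.length → elementaryCylinder u' ⊆ elementaryCylinder u := by
      intro u u' h h' hle
      have : u = u'.take u.length := by
        conv_rhs => rw [← h']
        conv_lhs => rw [← h]
        simp only [pathWord, ← List.map_take, List.take_range, min_eq_left hle]
      rw [this]
      conv_lhs => rw [← List.take_append_drop u.length u']
      exact elementaryCylinder_append_subset _ _
    rcases le_total v.length w.length with h | h
    · exact Or.inr (Or.inl (key v w hv hw h))
    · exact Or.inl (key w v hw hv h)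

end Words

/-! ### Independence of the sigma-fields of disjoint clopen sets -/

section Independence

variable {m r : ℕ} {φ : VotingRule m r}

theorem measurable_vote (v : List (Fin m)) : Measurable fun f : VotingSpace φ => f.1 v :=
  (measurable_pi_apply v).comp measurable_subtype_coe

theorem votingSigma_le (A : Clopens (ℕ → Fin m)) :
    votingSigma φ A ≤ (inferInstance : MeasurableSpace (VotingSpace φ)) :=
  iSup₂_le fun v _ => (measurable_vote v).comap_le

theorem votingSigma_mono {A B : Clopens (ℕ → Fin m)} (h : A ≤ B) :
    votingSigma φ A ≤ votingSigma φ B :=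
  iSup₂_le fun v hv => le_iSup₂_of_le v (hv.trans h) le_rfl

theorem measurable_vote_votingSigma {A : Clopens (ℕ → Fin m)} {v : List (Fin m)}
    (hv : elementaryCylinder v ⊆ (A : Set (ℕ → Fin m))) :
    Measurable[votingSigma φ A] fun f : VotingSpace φ => f.1 v :=
  Measurable.mono (comap_measurable _) (le_iSup₂_of_le v hv le_rfl) le_rfl

theorem measurableSet_vote_votingSigma {A : Clopens (ℕ → Fin m)} {v : List (Fin m)}
    (hv : elementaryCylinder v ⊆ (A : Set (ℕ → Fin m))) (b : Fin r) :
    MeasurableSet[votingSigma φ A] {f : VotingSpace φ | f.1 v = b} :=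
  measurable_vote_votingSigma hv (measurableSet_singleton b)

variable [NeZero m] [NeZero r]

/-- The set of voting functions with prescribed values at level `n`. -/
def levelSet (φ : VotingRule m r) (n : ℕ) (a : Level m n → Fin r) :
    Set (VotingSpace φ) := {f | ∀ w, f.1 w.1 = a w}

omit [NeZero m] [NeZero r] in
theorem measurableSet_levelSet (n : ℕ) (a : Level m n → Fin r) :
    MeasurableSet (levelSet φ n a) := by
  have : levelSet φ n a = ⋂ w, {f : VotingSpace φ | f.1 w.1 = a w} := by ext f; simp [levelSet]
  rw [this]
  exact MeasurableSet.iInter fun w => measurable_vote w.1 (measurableSet_singleton (a w))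

theorem votingMeasure_levelSet (n : ℕ) (a : Level m n → Fin r) :
    votingMeasure φ (levelSet φ n a) = ((r : ℝ≥0∞)⁻¹) ^ (m ^ n) := by
  -- Only words of length `n` are tested, so the default 0 at the other levels has no effect.
  rw [← votingMeasure_level (NeZero.pos m) φ n fun v => if h : v.length = n then a ⟨v, h⟩ else 0]
  congr 1
  ext f
  constructor
  · intro h w hw
    simp only [hw, dif_pos]
    exact h ⟨w, hw⟩
  · intro h w
    have := h w.1 w.2
    simpa only [w.2, dif_pos] using this

theorem map_level_votes (n : ℕ) :
    (votingMeasure φ).map (fun f (w : Level m n) => f.1 w.1) =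
      Measure.pi fun _ => ProbabilityTheory.uniformOn (Set.univ : Set (Fin r)) := by
  have : IsProbabilityMeasure (ProbabilityTheory.uniformOn (Set.univ : Set (Fin r))) :=
    ProbabilityTheory.isProbabilityMeasure_uniformOn Set.finite_univ Set.univ_nonempty
  refine Measure.ext_of_singleton fun a => ?_
  rw [Measure.map_apply (measurable_pi_lambda _ fun w => measurable_vote w.1)
    (measurableSet_singleton a), Measure.pi_singleton]
  have h1 : (fun (f : VotingSpace φ) (w : Level m n) => f.1 w.1) ⁻¹' {a} =
      levelSet φ n a := by
    ext f; simp [levelSet, funext_iff]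
  have h2 : ∀ b : Fin r, ProbabilityTheory.uniformOn (Set.univ : Set (Fin r)) {b} =
      (r : ℝ≥0∞)⁻¹ := by
    intro b; rw [ProbabilityTheory.uniformOn_univ]; simp
  rw [h1, votingMeasure_levelSet]
  simp [h2, card_level]

theorem map_vote (v : List (Fin m)) :
    (votingMeasure φ).map (fun f => f.1 v) =
      ProbabilityTheory.uniformOn (Set.univ : Set (Fin r)) := by
  have : IsProbabilityMeasure (ProbabilityTheory.uniformOn (Set.univ : Set (Fin r))) :=
    ProbabilityTheory.isProbabilityMeasure_uniformOn Set.finite_univ Set.univ_nonempty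
  have h := congrArg (Measure.map (Function.eval (⟨v, rfl⟩ : Level m v.length)))
    (map_level_votes (φ := φ) v.length)
  rw [Measure.map_map (measurable_pi_apply _)
    (measurable_pi_lambda _ fun w : Level m v.length => measurable_vote w.1),
    (measurePreserving_eval (fun _ => ProbabilityTheory.uniformOn (Set.univ : Set (Fin r))) _).map_eq]
    at h
  exact h

theorem votingMeasure_vote (v : List (Fin m)) (b : Fin r) :
    (votingMeasure φ).real {f | f.1 v = b} = (r : ℝ)⁻¹ := by
  have h : votingMeasure φ {f | f.1 v = b} = (r : ℝ≥0∞)⁻¹ := by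
    change votingMeasure φ ((fun f => f.1 v) ⁻¹' {b}) = _
    rw [← Measure.map_apply (measurable_vote v) (measurableSet_singleton b), map_vote,
      ProbabilityTheory.uniformOn_univ]
    simp
  rw [measureReal_def, h]
  simp

theorem iIndep_level (n : ℕ) :
    ProbabilityTheory.iIndep (fun w : Level m n =>
      MeasurableSpace.comap (fun f : VotingSpace φ => f.1 w.1) inferInstance)
      (votingMeasure φ) := by
  have h : ProbabilityTheory.iIndepFun (fun (w : Level m n) (f : VotingSpace φ) =>
      f.1 w.1) (votingMeasure φ) := by
    rw [ProbabilityTheory.iIndepFun_iff_map_fun_eq_pi_map fun w : Level m n =>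
      (measurable_vote w.1).aemeasurable, map_level_votes]
    simp only [map_vote]
  exact h

/-- The sigma-field generated by the values at the vertices of level `n` that lie in `A`. -/
abbrev levelSigma (φ : VotingRule m r) (n : ℕ) (A : Clopens (ℕ → Fin m)) :
    MeasurableSpace (VotingSpace φ) :=
  ⨆ w ∈ {w : Level m n | elementaryCylinder w.1 ⊆ (A : Set (ℕ → Fin m))},
    MeasurableSpace.comap (fun f : VotingSpace φ => f.1 w.1) inferInstance

omit [NeZero m] [NeZero r] in
theorem levelSigma_le (n : ℕ) (A : Clopens (ℕ → Fin m)) :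
    levelSigma φ n A ≤ (inferInstance : MeasurableSpace (VotingSpace φ)) :=
  iSup₂_le fun w _ => (measurable_vote w.1).comap_le

omit [NeZero m] [NeZero r] in
theorem votingSigma_eq_iSup_level (A : Clopens (ℕ → Fin m)) :
    votingSigma φ A = ⨆ n, levelSigma φ n A := by
  apply le_antisymm
  · refine iSup₂_le fun v hv => le_iSup_of_le v.length ?_
    exact le_iSup₂_of_le (⟨v, rfl⟩ : Level m v.length) hv le_rfl
  · exact iSup_le fun n => iSup₂_le fun w hw => le_iSup₂_of_le w.1 hw le_rfl

-- The value at a vertex is `φ` of the values at its sons, whose cylinders lie in the same clopen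
-- set.
omit [NeZero m] [NeZero r] in
theorem monotone_levelSigma (A : Clopens (ℕ → Fin m)) : Monotone fun n => levelSigma φ n A := by
  refine monotone_nat_of_le_succ fun n => iSup₂_le fun w hw => ?_
  rw [← measurable_iff_comap_le]
  have h : (fun f : VotingSpace φ => f.1 w.1) = fun f => φ.toFun fun i => f.1 (w.1 ++ [i]) :=
    funext fun f => f.2 w.1
  rw [h]
  refine (measurable_of_finite φ.toFun).comp ?_
  refine @measurable_pi_lambda _ _ _ (_) _ _ fun i => ?_
  rw [measurable_iff_comap_le]
  exact le_iSup₂_of_le (⟨w.1 ++ [i], by simp [w.2]⟩ : Level m (n + 1))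
    ((elementaryCylinder_append_subset _ _).trans hw) le_rfl

theorem indep_levelSigma {A B : Clopens (ℕ → Fin m)} (h : Disjoint (A : Set (ℕ → Fin m)) B)
    (n : ℕ) : ProbabilityTheory.Indep (levelSigma φ n A) (levelSigma φ n B) (votingMeasure φ) := by
  refine ProbabilityTheory.indep_iSup_of_disjoint (m := fun w : Level m n =>
    MeasurableSpace.comap (fun f : VotingSpace φ => f.1 w.1) inferInstance)
    (fun w => (measurable_vote w.1).comap_le) (iIndep_level n) ?_
  rw [Set.disjoint_left]
  intro w hA hB
  -- A cylinder contained in both sets would have to be empty.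
  obtain ⟨x, hx⟩ := elementaryCylinder_nonempty w.1
  exact Set.disjoint_left.1 h (hA hx) (hB hx)

/-- The sigma-fields of disjoint clopen sets are independent. -/
theorem indep_votingSigma {A B : Clopens (ℕ → Fin m)} (h : Disjoint (A : Set (ℕ → Fin m)) B) :
    ProbabilityTheory.Indep (votingSigma φ A) (votingSigma φ B) (votingMeasure φ) := by
  rw [votingSigma_eq_iSup_level A, votingSigma_eq_iSup_level B]
  refine ProbabilityTheory.indep_iSup_of_monotone (fun k => ?_) (fun k => levelSigma_le k A)
    (iSup_le fun n => levelSigma_le n B) (monotone_levelSigma A)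
  refine (ProbabilityTheory.indep_iSup_of_monotone (fun n => ?_) (fun k => levelSigma_le k B)
    (levelSigma_le k A) (monotone_levelSigma B)).symm
  refine ProbabilityTheory.indep_of_indep_of_le_left (ProbabilityTheory.indep_of_indep_of_le_right
    (indep_levelSigma h (max k n)).symm (monotone_levelSigma A (le_max_left k n)))
    (monotone_levelSigma B (le_max_right k n))

end Independence

/-! ### Random maps along a path; abundance implies continuity -/

section Paths

variable {m r : ℕ} {φ : VotingRule m r}

/-- The dependence of the value at the `j`-th vertex of a path on the value at the next vertex of
the path, the values at the other sons being fixed. -/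
def stepMap (φ : VotingRule m r) (x : ℕ → Fin m) (j : ℕ) (f : VotingSpace φ) : Fin r → Fin r :=
  fun z => φ.toFun (Function.update (fun i => f.1 (pathWord x j ++ [i])) (x j) z)

/-- The dependence of the value at the `n`-th vertex of a path on the value `k` steps further. -/
def pathMap (φ : VotingRule m r) (x : ℕ → Fin m) (n : ℕ) : ℕ → VotingSpace φ → Fin r → Fin r
  | 0, _ => id
  | k + 1, f => pathMap φ x n k f ∘ stepMap φ x (n + k) f

theorem stepMap_apply (x : ℕ → Fin m) (j : ℕ) (f : VotingSpace φ) :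
    stepMap φ x j f (f.1 (pathWord x (j + 1))) = f.1 (pathWord x j) := by
  rw [stepMap, pathWord_succ, Function.update_eq_self (x j) fun i => f.1 (pathWord x j ++ [i]),
    ← f.2]

theorem pathMap_apply (x : ℕ → Fin m) (n k : ℕ) (f : VotingSpace φ) :
    pathMap φ x n k f (f.1 (pathWord x (n + k))) = f.1 (pathWord x n) := by
  induction k with
  | zero => rfl
  | succ k ih => rw [pathMap, Function.comp_apply, ← add_assoc, stepMap_apply, ih]

theorem pathMap_add (x : ℕ → Fin m) (n k l : ℕ) (f : VotingSpace φ) :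
    pathMap φ x n (k + l) f = pathMap φ x n k f ∘ pathMap φ x (n + k) l f := by
  induction l with
  | zero => rfl
  | succ l ih => rw [← add_assoc, pathMap, ih, pathMap, Function.comp_assoc, add_assoc]

theorem measurable_stepMap (x : ℕ → Fin m) (j : ℕ) {A : Clopens (ℕ → Fin m)}
    (h : ∀ i, i ≠ x j → elementaryCylinder (pathWord x j ++ [i]) ⊆ (A : Set (ℕ → Fin m))) :
    Measurable[votingSigma φ A] (stepMap φ x j) := by
  refine @measurable_pi_lambda _ _ _ (_) _ _ fun z => ?_
  refine (measurable_of_finite φ.toFun).comp ?_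
  refine @measurable_pi_lambda _ _ _ (_) _ _ fun i => ?_
  by_cases hi : i = x j
  · subst hi
    simp only [Function.update_self]
    exact measurable_const
  · simp only [Function.update_of_ne hi]
    exact measurable_vote_votingSigma (h i hi)

theorem measurable_pathMap (x : ℕ → Fin m) (n k : ℕ) {A : Clopens (ℕ → Fin m)}
    (h : ∀ j, n ≤ j → j < n + k → ∀ i, i ≠ x j →
      elementaryCylinder (pathWord x j ++ [i]) ⊆ (A : Set (ℕ → Fin m))) :
    Measurable[votingSigma φ A] (pathMap φ x n k) := by
  induction k with
  | zero => exact measurable_const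
  | succ k ih =>
    have h1 := ih fun j hj hj' => h j hj (by omega)
    have h2 := measurable_stepMap (φ := φ) x (n + k) (h (n + k) (by omega) (by omega))
    have hc : Measurable fun q : (Fin r → Fin r) × (Fin r → Fin r) => q.1 ∘ q.2 :=
      measurable_of_finite _
    exact hc.comp (h1.prodMk h2)

theorem elementaryCylinder_pathWord_anti (x : ℕ → Fin m) :
    Antitone fun n => elementaryCylinder (pathWord x n) :=
  antitone_nat_of_succ_le fun n => by
    rw [pathWord_succ]; exact elementaryCylinder_append_subset _ _

/-- The clopen sets shrinking to the point `x`. -/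
abbrev pathCylinder (x : ℕ → Fin m) (n : ℕ) : Clopens (ℕ → Fin m) :=
  clopenCylinder (pathWord x n)

theorem pathCylinder_anti (x : ℕ → Fin m) : Antitone (pathCylinder x) :=
  elementaryCylinder_pathWord_anti x

theorem subset_compl_pathCylinder {x : ℕ → Fin m} {n : ℕ} {v : List (Fin m)} :
    elementaryCylinder v ⊆ (((pathCylinder x n)ᶜ : Clopens _) : Set (ℕ → Fin m)) ↔
      Disjoint (elementaryCylinder v) (elementaryCylinder (pathWord x n)) :=
  Set.subset_compl_iff_disjoint_right

/-- Only the side sons of the path vertices of levels `n, …, n + k - 1` enter the map. They lie off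
the `n + k`-th vertex and, by `measurable_pathMap_pathCylinder`, below the `n`-th one; hence
consecutive blocks are independent. -/
theorem measurable_pathMap_compl (x : ℕ → Fin m) (n k : ℕ) :
    Measurable[votingSigma φ (pathCylinder x (n + k))ᶜ] (pathMap φ x n k) := by
  refine measurable_pathMap x n k fun j _ hj i hi => ?_
  rw [subset_compl_pathCylinder]
  refine Disjoint.mono_right (elementaryCylinder_pathWord_anti x (show j + 1 ≤ n + k by omega))
    (elementaryCylinder_disjoint (by simp) ?_)
  rw [pathWord_succ]
  simpa using hi

theorem measurable_pathMap_pathCylinder (x : ℕ → Fin m) (n k : ℕ) :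
    Measurable[votingSigma φ (pathCylinder x n)] (pathMap φ x n k) :=
  measurable_pathMap x n k fun _ hj _ _ _ =>
    (elementaryCylinder_append_subset _ _).trans (elementaryCylinder_pathWord_anti x hj)

theorem measurableSet_pathMap_compl (x : ℕ → Fin m) (n k : ℕ) (p : (Fin r → Fin r) → Prop) :
    MeasurableSet[votingSigma φ (pathCylinder x (n + k))ᶜ] {f | p (pathMap φ x n k f)} :=
  measurable_pathMap_compl x n k (Set.toFinite {g | p g}).measurableSet

theorem measurableSet_pathMap_pathCylinder (x : ℕ → Fin m) (n k : ℕ)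
    (p : (Fin r → Fin r) → Prop) :
    MeasurableSet[votingSigma φ (pathCylinder x n)] {f | p (pathMap φ x n k f)} :=
  measurable_pathMap_pathCylinder x n k (Set.toFinite {g | p g}).measurableSet

theorem disjoint_pathCylinder_compl (x : ℕ → Fin m) (n : ℕ) :
    Disjoint (pathCylinder x n : Set (ℕ → Fin m))
      (((pathCylinder x n)ᶜ : Clopens _) : Set (ℕ → Fin m)) :=
  disjoint_compl_right

theorem le_of_measurableSet_vote {M : MeasurableSpace (VotingSpace φ)}
    (h : ∀ v b, MeasurableSet[M] {f : VotingSpace φ | f.1 v = b}) :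
    (Subtype.instMeasurableSpace : MeasurableSpace (VotingSpace φ)) ≤ M := by
  have h1 : @Measurable _ _ M Subtype.instMeasurableSpace (id : VotingSpace φ → VotingSpace φ) := by
    have h2 : @Measurable _ _ M _ fun f : VotingSpace φ => f.1 :=
      @measurable_pi_lambda _ _ _ M _ _ fun v =>
        @measurable_to_countable' _ _ _ _ M _ fun b => h v b
    exact h2.subtype_mk
  intro s hs
  exact h1 hs

/-- At least one step is taken because the empty product is the identity, which need not lie in the
semigroup. -/
theorem pathMap_mem_closure (x : ℕ → Fin m) (n k : ℕ) (f : VotingSpace φ) :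
    (pathMap φ x n (k + 1) f : Function.End (Fin r)) ∈ Subsemigroup.closure φ.partialMaps := by
  have hs : ∀ j, (stepMap φ x j f : Function.End (Fin r)) ∈
      Subsemigroup.closure φ.partialMaps := fun j =>
    Subsemigroup.subset_closure ⟨x j, _, rfl⟩
  induction k with
  | zero => exact hs _
  | succ k ih => exact mul_mem (S := Subsemigroup (Function.End (Fin r))) ih (hs _)

variable [NeZero m] [NeZero r]

theorem votingMeasure_sons (v : List (Fin m)) (S : Finset (Fin m)) (a : Fin m → Fin r) :
    (votingMeasure φ).real {f | ∀ i ∈ S, f.1 (v ++ [i]) = a i} = ((r : ℝ)⁻¹) ^ S.card := by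
  classical
  let e : Fin m → Level m (v.length + 1) := fun i => ⟨v ++ [i], by simp⟩
  have he : Function.Injective e := fun i j h => by simpa [e] using h
  have h := (iIndep_level (φ := φ) (v.length + 1)).precomp he
  have h2 := h.meas_biInter (S := S) (s := fun i => {f : VotingSpace φ | f.1 (v ++ [i]) = a i})
    fun i _ => ⟨{a i}, measurableSet_singleton _, rfl⟩
  have h3 : {f : VotingSpace φ | ∀ i ∈ S, f.1 (v ++ [i]) = a i} =
      ⋂ i ∈ S, {f : VotingSpace φ | f.1 (v ++ [i]) = a i} := by ext f; simp
  rw [h3, measureReal_def, h2, ENNReal.toReal_prod]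
  simp_rw [← measureReal_def, votingMeasure_vote, Finset.prod_const]

theorem measureReal_inter_of_disjoint {A B : Clopens (ℕ → Fin m)}
    (h : Disjoint (A : Set (ℕ → Fin m)) B) {s t : Set (VotingSpace φ)}
    (hs : MeasurableSet[votingSigma φ A] s) (ht : MeasurableSet[votingSigma φ B] t) :
    (votingMeasure φ).real (s ∩ t) = (votingMeasure φ).real s * (votingMeasure φ).real t := by
  rw [measureReal_def, (ProbabilityTheory.Indep_iff _ _ _).1 (indep_votingSigma h) _ _ hs ht,
    ENNReal.toReal_mul]
  rfl

/-- Each element of the semigroup occurs along any path with a probability that is bounded from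
below. -/
theorem exists_le_measure_pathMap_eq (x : ℕ → Fin m) {h : Function.End (Fin r)}
    (hh : h ∈ Subsemigroup.closure φ.partialMaps) :
    ∃ p : ℝ, 0 < p ∧ ∃ L, ∀ n, p ≤ (votingMeasure φ).real {f | ∀ z, pathMap φ x n L f z = h z} := by
  induction hh using Subsemigroup.closure_induction with
  | mem h hmem =>
    obtain ⟨i, a, rfl⟩ := hmem
    have hr : (0 : ℝ) < r := by exact_mod_cast NeZero.pos r
    -- The bound is the probability that all `m` sons have prescribed values. Prescribing the son on
    -- the path as well is harmless, since its value is overwritten. The swap moves the free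
    -- argument `i` to the direction `x n` of the path, which symmetry of `φ` allows.
    refine ⟨((r : ℝ)⁻¹) ^ m, by positivity, 1, fun n => ?_⟩
    have h1 := votingMeasure_sons (φ := φ) (pathWord x n) Finset.univ (a ∘ Equiv.swap i (x n))
    rw [Finset.card_univ, Fintype.card_fin] at h1
    rw [← h1]
    refine measureReal_mono fun f hf => ?_
    intro z
    change φ.toFun (Function.update (fun i => f.1 (pathWord x n ++ [i])) (x n) z) = _
    have h2 : (fun i => f.1 (pathWord x n ++ [i])) = a ∘ Equiv.swap i (x n) :=
      funext fun j => hf j (Finset.mem_univ j)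
    have h3 := Function.update_comp_equiv a (Equiv.swap i (x n)) i z
    rw [Equiv.symm_swap, Equiv.swap_apply_left] at h3
    rw [h2, ← h3, φ.symmetric]
  | mul g h _ _ ihg ihh =>
    obtain ⟨p, hp, K, hK⟩ := ihg
    obtain ⟨q, hq, L, hL⟩ := ihh
    refine ⟨p * q, by positivity, K + L, fun n => ?_⟩
    have h1 := measureReal_inter_of_disjoint (φ := φ) (disjoint_pathCylinder_compl x (n + K)).symm
      (measurableSet_pathMap_compl x n K fun γ => ∀ z, γ z = g z)
      (measurableSet_pathMap_pathCylinder x (n + K) L fun γ => ∀ z, γ z = h z)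
    calc p * q ≤ _ := mul_le_mul (hK n) (hL (n + K)) hq.le measureReal_nonneg
      _ = _ := h1.symm
      _ ≤ _ := by
        refine measureReal_mono fun f hf z => ?_
        rw [pathMap_add, Function.comp_apply, hf.2 z, hf.1]
        rfl

/-- Each block of length `L` equals a constant semigroup element with probability at least `p`,
independently of the preceding ones. A product with a constant factor is constant, so after `j`
blocks it is nonconstant with probability at most `(1 - p) ^ j`. -/
theorem ae_exists_pathMap_const (h : φ.Abundant) (x : ℕ → Fin m) (n : ℕ) :
    ∀ᵐ f ∂votingMeasure φ, ∃ k c, ∀ z, pathMap φ x n k f z = c := by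
  obtain ⟨g, hg, c, hc⟩ := h
  obtain ⟨p, hp, L, hL⟩ := exists_le_measure_pathMap_eq x hg
  let N : ℕ → Set (VotingSpace φ) := fun k => {f | ¬ ∃ c, ∀ z, pathMap φ x n k f z = c}
  have hNm : ∀ k, MeasurableSet[votingSigma φ (pathCylinder x (n + k))ᶜ] (N k) := fun k =>
    measurableSet_pathMap_compl x n k fun g => ¬ ∃ c, ∀ z, g z = c
  have hstep : ∀ k, (votingMeasure φ).real (N (k + L)) ≤
      (votingMeasure φ).real (N k) * (1 - p) := by
    intro k
    have hE := measurableSet_pathMap_pathCylinder (φ := φ) x (n + k) L fun γ => ∀ z, γ z = g z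
    have h1 := measureReal_inter_of_disjoint (disjoint_pathCylinder_compl x (n + k)).symm
      (hNm k) (MeasurableSet.compl hE)
    calc _ ≤ (votingMeasure φ).real (N k ∩ {f | ∀ z, pathMap φ x (n + k) L f z = g z}ᶜ) := by
          refine measureReal_mono fun f hf => ⟨fun ⟨c', hc'⟩ => hf ⟨c', fun z => ?_⟩, fun hg' => ?_⟩
          · rw [pathMap_add]; exact hc' _
          · refine hf ⟨pathMap φ x n k f c, fun z => ?_⟩
            rw [pathMap_add, Function.comp_apply, hg' z, hc]
      _ ≤ _ := by
          rw [h1, probReal_compl_eq_one_sub (votingSigma_le _ _ hE)]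
          exact mul_le_mul_of_nonneg_left (by linarith [hL (n + k)]) measureReal_nonneg
  have hp1 : p ≤ 1 := (hL 0).trans measureReal_le_one
  have hpow : ∀ j, (votingMeasure φ).real (N (j * L)) ≤ (1 - p) ^ j := by
    intro j
    induction j with
    | zero => simp
    | succ j ih =>
      rw [Nat.succ_mul, pow_succ]
      exact (hstep _).trans (mul_le_mul_of_nonneg_right ih (by linarith))
  have h0 : (votingMeasure φ).real {f | ¬ ∃ k c, ∀ z, pathMap φ x n k f z = c} = 0 := by
    refine le_antisymm (ge_of_tendsto' (tendsto_pow_atTop_nhds_zero_of_lt_one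
      (by linarith : 0 ≤ 1 - p) (by linarith)) fun j => ?_) measureReal_nonneg
    refine le_trans (measureReal_mono fun f hf hk => hf ⟨_, hk⟩) (hpow j)
  exact (measureReal_eq_zero_iff).1 h0

/-- For an abundant rule the values off a path determine all values almost surely. -/
theorem le_eventuallyMeasurableSpace_of_abundant (h : φ.Abundant) (x : ℕ → Fin m) :
    (Subtype.instMeasurableSpace : MeasurableSpace (VotingSpace φ)) ≤
      @eventuallyMeasurableSpace _ (⨆ n, votingSigma φ (pathCylinder x n)ᶜ)
        (ae (votingMeasure φ)) _ := by
  refine le_of_measurableSet_vote fun v b => ?_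
  by_cases hv : x ∈ elementaryCylinder v
  · rw [mem_elementaryCylinder] at hv
    set n := v.length
    -- The off-path set replacing `{f v = b}`: some map down the path is constant with value `b`.
    -- The two sets agree wherever some `pathMap` is constant.
    refine ⟨⋃ k, {f | ∀ z, pathMap φ x n k f z = b}, ?_, ?_⟩
    · refine MeasurableSet.iUnion fun k => ?_
      refine le_iSup (fun n => votingSigma φ (pathCylinder x n)ᶜ) (n + k) _ ?_
      exact measurableSet_pathMap_compl x n k fun g => ∀ z, g z = b
    · filter_upwards [ae_exists_pathMap_const h x n] with f hf
      obtain ⟨k, c, hc⟩ := hf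
      refine propext ⟨fun hb => ?_, fun hb => ?_⟩
      · have hb' : f.1 v = b := hb
        refine Set.mem_iUnion.2 ⟨k, fun z => ?_⟩
        rw [hc, ← hb', ← hv, ← pathMap_apply x n k f, hc]
      · obtain ⟨l, hl⟩ := Set.mem_iUnion.1 hb
        change f.1 v = b
        rw [← hv, ← pathMap_apply x n l f, hl]
  · refine le_eventuallyMeasurableSpace _ ?_
    refine le_iSup (fun n => votingSigma φ (pathCylinder x n)ᶜ) v.length _
      (measurableSet_vote_votingSigma ?_ b)
    rw [subset_compl_pathCylinder]
    refine elementaryCylinder_disjoint (by simp) fun h => hv ?_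
    rw [mem_elementaryCylinder, ← h]

/-- By compactness, every decreasing sequence with intersection `{x}` eventually enters each
cylinder around `x`, so the cylinders can take over from the given `A n`. -/
theorem continuousAtPoint_of_abundant (h : φ.Abundant) (x : ℕ → Fin m) :
    ContinuousAtPoint (votingFactorization φ) x := by
  intro A hA hx
  have hsub : ∀ k, ∃ n, A n ≤ pathCylinder x k := by
    intro k
    obtain ⟨n, hn⟩ := exists_subset_nhds_of_isCompact' (V := fun n => (A n : Set (ℕ → Fin m)))
      (directed_of_isDirected_le fun i j hij => hA hij) (fun n => (A n).isClopen.isClosed.isCompact)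
      (fun n => (A n).isClopen.isClosed)
      (U := (pathCylinder x k : Set (ℕ → Fin m))) fun y hy => by
        rw [hx, Set.mem_singleton_iff] at hy
        subst hy
        exact (pathCylinder y k).isClopen.isOpen.mem_nhds
          (self_mem_elementaryCylinder_pathWord y k)
    exact ⟨n, hn⟩
  have hmono : Monotone fun n => votingSigma φ (pathCylinder x n)ᶜ := fun i j hij =>
    votingSigma_mono (compl_le_compl (pathCylinder_anti x hij))
  have hext : ∀ y z : VotingL2 φ, (∀ n s, MeasurableSet[votingSigma φ (pathCylinder x n)ᶜ] s →
      ∫ ω in s, y ω ∂votingMeasure φ = ∫ ω in s, z ω ∂votingMeasure φ) → y = z := fun y z =>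
    eq_of_setIntegral_of_monotone hmono (fun n => votingSigma_le _)
      (le_eventuallyMeasurableSpace_of_abundant h x)
  ext T
  simp only [Set.mem_iInter, Set.mem_ofPred_eq]
  constructor
  · intro hT
    set t : VotingL2 φ := T (oneL2 _) with ht
    -- Writing `g = 1 · g` shows that `T` multiplies functions on the complement by `t = T 1`, the
    -- same `t` for every `n`.
    have hTg : ∀ n, t ∈ votingSubspace φ (A n) ∧ ∀ g ∈ votingSubspace φ (A n)ᶜ,
        ∀ᵐ ω ∂votingMeasure φ, T g ω = t ω * g ω := by
      intro n
      obtain ⟨S, hS⟩ := hT n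
      let e : votingSubspace φ (A n) := ⟨oneL2 _, oneL2_mem (votingSigma_le _)⟩
      have h1 : ∀ g ∈ votingSubspace φ (A n)ᶜ, ∀ᵐ ω ∂votingMeasure φ,
          T g ω = (S e : VotingL2 φ) ω * g ω := fun g hg =>
        hS e ⟨g, hg⟩ g (by
          filter_upwards [coeFn_oneL2 (μ := votingMeasure φ)] with ω hω
          change g ω = (oneL2 _ : VotingL2 φ) ω * g ω
          rw [hω, one_mul])
      have h2 : t = S e := by
        refine Lp.ext ?_
        filter_upwards [h1 _ (oneL2_mem (votingSigma_le _)),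
          coeFn_oneL2 (μ := votingMeasure φ)] with ω h3 h4
        rw [ht, h3, h4, mul_one]
      exact ⟨h2 ▸ (S e).2, by rw [h2]; exact h1⟩
    have htk : ∀ k, t ∈ votingSubspace φ (pathCylinder x k) := fun k => by
      obtain ⟨n, hn⟩ := hsub k
      exact lpMeas_mono (votingSigma_mono hn) (hTg n).1
    -- The function `t` is independent of each off-path sigma-field, and these generate everything
    -- modulo null sets.
    have htc : t = (∫ ω, t ω ∂votingMeasure φ) • oneL2 _ := by
      refine hext _ _ fun k s hs => ?_
      rw [setIntegral_of_indep (votingSigma_le _) (votingSigma_le _)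
        (indep_votingSigma (disjoint_pathCylinder_compl x k)) (htk k) (integrable_L2 t) hs,
        ← inner_indL2 (votingSigma_le _ s hs) (_ • _), inner_smul_right, oneL2, inner_indL2_indL2,
        Set.inter_univ, mul_comm]
    set c := ∫ ω, t ω ∂votingMeasure φ
    refine ⟨c, ?_⟩
    let K : Submodule ℂ (VotingL2 φ) := (T - c • ContinuousLinearMap.id ℂ _).ker
    have hKc : IsClosed (K : Set (VotingL2 φ)) :=
      (T - c • ContinuousLinearMap.id ℂ _).isClosed_ker
    have : CompleteSpace K := hKc.completeSpace_coe
    have hK : ∀ k, votingSubspace φ (pathCylinder x k)ᶜ ≤ K := by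
      intro k g hg
      obtain ⟨n, hn⟩ := hsub k
      have h1 := (hTg n).2 g (lpMeas_mono (votingSigma_mono (compl_le_compl hn)) hg)
      rw [LinearMap.mem_ker]
      change T g - c • g = 0
      rw [sub_eq_zero]
      refine Lp.ext ?_
      have htc' : t =ᵐ[votingMeasure φ] (c • oneL2 (votingMeasure φ) : VotingL2 φ) := by
        rw [← htc]
      filter_upwards [h1, Lp.coeFn_smul c g, htc', Lp.coeFn_smul c (oneL2 (votingMeasure φ)),
        coeFn_oneL2 (μ := votingMeasure φ)] with ω h2 h3 h4 h5 h6
      rw [h2, h3, h4, h5, Pi.smul_apply, Pi.smul_apply, h6, smul_eq_mul, smul_eq_mul, mul_one]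
    have hKt : K = ⊤ := by
      rw [← Submodule.orthogonal_eq_bot_iff, Submodule.eq_bot_iff]
      intro y hy
      refine hext _ _ fun k s hs => ?_
      rw [← inner_indL2 (votingSigma_le _ s hs), ← inner_indL2 (votingSigma_le _ s hs),
        inner_zero_right]
      exact hy _ (hK k (indL2_mem (votingSigma_le _) hs))
    ext1 y
    have hy : y ∈ K := hKt ▸ Submodule.mem_top
    rw [LinearMap.mem_ker] at hy
    exact sub_eq_zero.1 hy
  · rintro ⟨c, rfl⟩ n
    refine ⟨c • ContinuousLinearMap.id ℂ _, fun f g p hp => ?_⟩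
    filter_upwards [hp, Lp.coeFn_smul c p, Lp.coeFn_smul c (f : VotingL2 φ)] with ω h1 h2 h3
    change (c • p : VotingL2 φ) ω = (c • (f : VotingL2 φ) : VotingL2 φ) ω * _
    rw [h2, h3, Pi.smul_apply, Pi.smul_apply, h1, smul_mul_assoc]

end Paths

/-! ### A nonscalar operator in all algebras when the rule is not abundant -/

section NonAbundant

variable {m r : ℕ} {φ : VotingRule m r}

/-- The sigma-field generated by the values at all vertices off the path `x`. -/
abbrev offPathSigma (φ : VotingRule m r) (x : ℕ → Fin m) : MeasurableSpace (VotingSpace φ) :=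
  ⨆ n, votingSigma φ (pathCylinder x n)ᶜ

/-- The sigma-field generated by the values at the vertices off the path `x` that lie below the
`n`-th vertex of the path. -/
abbrev offPathSigmaBelow (φ : VotingRule m r) (x : ℕ → Fin m) (n : ℕ) :
    MeasurableSpace (VotingSpace φ) :=
  ⨆ (v : List (Fin m)) (_ : x ∉ elementaryCylinder v ∧
      elementaryCylinder v ⊆ elementaryCylinder (pathWord x n)),
    MeasurableSpace.comap (fun f : VotingSpace φ => f.1 v) inferInstance

theorem offPathSigma_le (x : ℕ → Fin m) :
    offPathSigma φ x ≤ (Subtype.instMeasurableSpace : MeasurableSpace (VotingSpace φ)) :=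
  iSup_le fun _ => votingSigma_le _

theorem offPathSigmaBelow_le_votingSigma (x : ℕ → Fin m) (n : ℕ) :
    offPathSigmaBelow φ x n ≤ votingSigma φ (pathCylinder x n) :=
  iSup₂_le fun v hv => le_iSup₂_of_le v hv.2 le_rfl

theorem offPathSigmaBelow_le_offPathSigma (x : ℕ → Fin m) (n : ℕ) :
    offPathSigmaBelow φ x n ≤ offPathSigma φ x := by
  refine iSup₂_le fun v hv => le_iSup_of_le v.length (le_iSup₂_of_le v ?_ le_rfl)
  rw [subset_compl_pathCylinder]
  refine elementaryCylinder_disjoint (by simp) fun h => hv.1 ?_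
  rw [mem_elementaryCylinder, ← h]

/-- A vertex off the path cannot be an ancestor of a path vertex, so it is below the `n`-th path
vertex or disjoint from it. -/
theorem offPathSigma_le_sup [NeZero m] (x : ℕ → Fin m) (n : ℕ) :
    offPathSigma φ x ≤ votingSigma φ (pathCylinder x n)ᶜ ⊔ offPathSigmaBelow φ x n := by
  refine iSup_le fun k => iSup₂_le fun v hv => ?_
  rw [subset_compl_pathCylinder] at hv
  have hx : x ∉ elementaryCylinder v := fun h =>
    Set.disjoint_left.1 hv h (self_mem_elementaryCylinder_pathWord x k)
  rcases elementaryCylinder_trichotomy v (pathWord x n) with h | h | h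
  · exact le_sup_of_le_right (le_iSup₂_of_le v ⟨hx, h⟩ le_rfl)
  · exact absurd (h (self_mem_elementaryCylinder_pathWord x n)) hx
  · exact le_sup_of_le_left (le_iSup₂_of_le v (subset_compl_pathCylinder.2 h) le_rfl)

variable [NeZero m] [NeZero r]

/-- The remaining off-path votes are independent of everything below the `n`-th path vertex, so
conditioning a function living there on them too changes nothing. It suffices to test on
intersections of a set below that vertex with a set outside it. -/
theorem projL2_offPathSigma (x : ℕ → Fin m) (n : ℕ) {f : VotingL2 φ}
    (hf : f ∈ votingSubspace φ (pathCylinder x n)) :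
    projL2 (votingMeasure φ) (offPathSigma_le x) f = projL2 (votingMeasure φ)
      ((offPathSigmaBelow_le_offPathSigma x n).trans (offPathSigma_le x)) f := by
  have hbelow := (offPathSigmaBelow_le_offPathSigma (φ := φ) x n).trans (offPathSigma_le x)
  set z := projL2 (votingMeasure φ) hbelow f with hz
  have hzm : z ∈ lpMeas ℂ ℂ (offPathSigmaBelow φ x n) 2 (votingMeasure φ) := projL2_mem hbelow f
  have hz' : z ∈ votingSubspace φ (pathCylinder x n) :=
    lpMeas_mono (offPathSigmaBelow_le_votingSigma x n) hzm
  refine projL2_eq_of_setIntegral _ (lpMeas_mono (offPathSigmaBelow_le_offPathSigma x n) hzm)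
    fun s hs => ?_
  let C : Set (Set (VotingSpace φ)) := {s | ∃ a b,
    MeasurableSet[votingSigma φ (pathCylinder x n)ᶜ] a ∧
      MeasurableSet[offPathSigmaBelow φ x n] b ∧ s = b ∩ a}
  have hC : IsPiSystem C := by
    rintro _ ⟨a, b, ha, hb, rfl⟩ _ ⟨a', b', ha', hb', rfl⟩ _
    exact ⟨a ∩ a', b ∩ b', ha.inter ha', hb.inter hb', Set.inter_inter_inter_comm _ _ _ _⟩
  have hCle : MeasurableSpace.generateFrom C ≤ Subtype.instMeasurableSpace := by
    refine MeasurableSpace.generateFrom_le ?_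
    rintro _ ⟨a, b, ha, hb, rfl⟩
    exact (hbelow b hb).inter (votingSigma_le _ a ha)
  have hle : offPathSigma φ x ≤ MeasurableSpace.generateFrom C := by
    refine (offPathSigma_le_sup x n).trans (sup_le (fun a ha => ?_) fun b hb => ?_)
    · exact MeasurableSpace.measurableSet_generateFrom
        ⟨a, Set.univ, ha, MeasurableSet.univ, (Set.univ_inter a).symm⟩
    · exact MeasurableSpace.measurableSet_generateFrom
        ⟨Set.univ, b, MeasurableSet.univ, hb, (Set.inter_univ b).symm⟩
  refine setIntegral_eq_of_isPiSystem hC hCle (integrable_L2 z) (integrable_L2 f) ?_ ?_ (hle s hs)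
  · have := setIntegral_projL2 hbelow f (@MeasurableSet.univ _ (offPathSigmaBelow φ x n))
    simpa using this
  · rintro _ ⟨a, b, ha, hb, rfl⟩
    have hi := indep_votingSigma (φ := φ) (disjoint_pathCylinder_compl x n)
    have hb' := offPathSigmaBelow_le_votingSigma x n b hb
    rw [setIntegral_inter_of_indep (votingSigma_le _) (votingSigma_le _) hi hz' hb' ha,
      setIntegral_inter_of_indep (votingSigma_le _) (votingSigma_le _) hi hf hb' ha,
      setIntegral_projL2 hbelow f hb]

/-- The conditional expectation with respect to the values off a path belongs to the algebras of
all neighbourhoods of the end of the path. -/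
theorem projL2_offPathSigma_mem (x : ℕ → Fin m) (n : ℕ) :
    projL2 (votingMeasure φ) (offPathSigma_le x) ∈
      votingFactorization φ (pathCylinder x n) := by
  have hmem : ∀ f : votingSubspace φ (pathCylinder x n),
      projL2 (votingMeasure φ) (offPathSigma_le x) (f : VotingL2 φ) ∈
        votingSubspace φ (pathCylinder x n) := fun f => by
    rw [projL2_offPathSigma x n f.2]
    exact lpMeas_mono (offPathSigmaBelow_le_votingSigma x n) (projL2_mem _ _)
  refine ⟨((projL2 (votingMeasure φ) (offPathSigma_le x)).comp
    (votingSubspace φ (pathCylinder x n)).subtypeL).codRestrict _ hmem, fun f g p hp => ?_⟩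
  exact projL2_mul (offPathSigma_le x)
    (lpMeas_mono (le_iSup (fun n => votingSigma φ (pathCylinder x n)ᶜ) n) g.2) hp

/-- Since `pathMap φ x 0 n f` is never constantly `b`, some argument `d` is sent elsewhere, and `d`
depends only on votes outside the `n`-th cylinder. The vote at the `n`-th vertex is independent of
those and equals `d` with probability `1/r`; the root value is then not `b`. -/
theorem condExp_vote_le (hr : 1 < r) (h : ¬ φ.Abundant) (x : ℕ → Fin m) (n : ℕ) (b : Fin r) :
    (votingMeasure φ)[{f : VotingSpace φ | f.1 [] = b}.indicator fun _ => (1 : ℝ) |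
      votingSigma φ (pathCylinder x n)ᶜ] ≤ᵐ[votingMeasure φ] fun _ => 1 - (r : ℝ)⁻¹ := by
  classical
  have hex : ∀ f : VotingSpace φ, ∃ z, pathMap φ x 0 n f z ≠ b := by
    intro f
    by_contra! hcon
    cases n with
    | zero =>
      have : Nontrivial (Fin r) := Fin.nontrivial_iff_two_le.2 hr
      obtain ⟨z, hz⟩ := exists_ne b
      exact hz (hcon z)
    | succ k => exact h ⟨_, pathMap_mem_closure x 0 k f, b, hcon⟩
  -- The default `b` is never reached on actual path maps, by `hex`.
  let d : (Fin r → Fin r) → Fin r := fun γ => if hγ : ∃ z, γ z ≠ b then hγ.choose else b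
  have hd : ∀ f : VotingSpace φ, pathMap φ x 0 n f (d (pathMap φ x 0 n f)) ≠ b := fun f => by
    have := (hex f).choose_spec
    simpa only [d, dif_pos (hex f)] using this
  let D : Set (VotingSpace φ) := {f | f.1 (pathWord x n) = d (pathMap φ x 0 n f)}
  have hpm := measurable_pathMap_compl (φ := φ) x 0 n
  rw [zero_add] at hpm
  have hlev : ∀ γ, MeasurableSet[votingSigma φ (pathCylinder x n)ᶜ]
      {f | pathMap φ x 0 n f = γ} := fun γ => hpm (measurableSet_singleton γ)
  have hDeq : ∀ t : Set (VotingSpace φ), t ∩ D = ⋃ γ ∈ (Finset.univ : Finset (Fin r → Fin r)),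
      (t ∩ {f | pathMap φ x 0 n f = γ}) ∩ {f | f.1 (pathWord x n) = d γ} := by
    intro t
    ext f
    simp only [D, Set.mem_inter_iff, Set.mem_ofPred_eq, Finset.mem_univ, Set.iUnion_true,
      Set.mem_iUnion]
    constructor
    · rintro ⟨h1, h2⟩; exact ⟨_, ⟨h1, rfl⟩, h2⟩
    · rintro ⟨γ, ⟨h1, rfl⟩, h2⟩; exact ⟨h1, h2⟩
  have hvm : ∀ c, MeasurableSet {f : VotingSpace φ | f.1 (pathWord x n) = c} := fun c =>
    measurable_vote _ (measurableSet_singleton c)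
  have hDm : MeasurableSet D := by
    rw [← Set.univ_inter D, hDeq]
    exact Finset.measurableSet_biUnion _ fun γ _ =>
      (MeasurableSet.univ.inter (votingSigma_le _ _ (hlev γ))).inter (hvm _)
  have hDt : ∀ t, MeasurableSet[votingSigma φ (pathCylinder x n)ᶜ] t →
      (votingMeasure φ).real (t ∩ D) = (votingMeasure φ).real t * (r : ℝ)⁻¹ := by
    intro t ht
    have hdisj : ∀ u : (Fin r → Fin r) → Set (VotingSpace φ),
        (↑(Finset.univ : Finset (Fin r → Fin r)) : Set _).PairwiseDisjoint
        fun γ => (t ∩ {f | pathMap φ x 0 n f = γ}) ∩ u γ := by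
      intro u γ _ γ' _ hne
      refine Set.disjoint_left.2 fun f hf hf' => hne ?_
      exact hf.1.2.symm.trans hf'.1.2
    have ht2 : t = ⋃ γ ∈ (Finset.univ : Finset (Fin r → Fin r)),
        (t ∩ {f | pathMap φ x 0 n f = γ}) ∩ Set.univ := by
      ext f; simp
    rw [hDeq, measureReal_biUnion_finset (hdisj _) fun γ _ =>
      ((votingSigma_le _ _ ht).inter (votingSigma_le _ _ (hlev γ))).inter (hvm _)]
    conv_rhs => rw [ht2]
    rw [measureReal_biUnion_finset (hdisj _) fun γ _ =>
      ((votingSigma_le _ _ ht).inter (votingSigma_le _ _ (hlev γ))).inter MeasurableSet.univ,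
      Finset.sum_mul]
    refine Finset.sum_congr rfl fun γ _ => ?_
    rw [Set.inter_univ, measureReal_inter_of_disjoint (disjoint_pathCylinder_compl x n).symm
      (ht.inter (hlev γ)) (measurableSet_vote_votingSigma (subset_refl _) _), votingMeasure_vote]
  have hone : ∀ s : Set (VotingSpace φ), MeasurableSet s →
      Integrable (s.indicator fun _ => (1 : ℝ)) (votingMeasure φ) := fun s hs =>
    (integrable_const _).indicator hs
  have hsm : MeasurableSet {f : VotingSpace φ | f.1 [] = b} :=
    measurable_vote _ (measurableSet_singleton b)
  have hcD : (fun _ => (r : ℝ)⁻¹) =ᵐ[votingMeasure φ]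
      (votingMeasure φ)[D.indicator fun _ => (1 : ℝ) | votingSigma φ (pathCylinder x n)ᶜ] := by
    refine ae_eq_condExp_of_forall_setIntegral_eq (votingSigma_le _) (hone D hDm)
      (fun s _ _ => (integrable_const _).integrableOn) (fun t ht _ => ?_)
      aestronglyMeasurable_const
    rw [setIntegral_const, setIntegral_indicator hDm, setIntegral_const, smul_eq_mul, smul_eq_mul,
      mul_one, hDt t ht]
  have hle : ({f : VotingSpace φ | f.1 [] = b}.indicator fun _ => (1 : ℝ)) ≤ᵐ[votingMeasure φ]
      (fun _ => (1 : ℝ)) - D.indicator fun _ => (1 : ℝ) := by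
    refine Filter.Eventually.of_forall fun f => ?_
    have hnot : f ∈ D → f.1 [] ≠ b := by
      intro hf
      have h1 := pathMap_apply x 0 n f
      rw [zero_add, show f.1 (pathWord x n) = _ from hf] at h1
      have h2 : f.1 [] = _ := h1.symm
      rw [h2]
      exact hd f
    by_cases hf : f ∈ D
    · simp [Set.indicator, hf, hnot hf]
    · by_cases hf' : f.1 [] = b <;> simp [Set.indicator, hf, hf']
  have h1 := condExp_mono (m := votingSigma φ (pathCylinder x n)ᶜ) (hone _ hsm)
    ((integrable_const (1 : ℝ)).sub (hone D hDm)) hle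
  have h2 := condExp_sub (integrable_const (μ := votingMeasure φ) (1 : ℝ)) (hone D hDm)
    (votingSigma φ (pathCylinder x n)ᶜ)
  filter_upwards [h1, h2, hcD] with f h3 h4 h5
  rw [h4, Pi.sub_apply, ← h5, condExp_const (votingSigma_le _)] at h3
  exact h3

theorem not_continuousAtPoint_of_not_abundant (hr : 1 < r) (h : ¬ φ.Abundant) (x : ℕ → Fin m) :
    ¬ ContinuousAtPoint (votingFactorization φ) x := by
  intro hc
  have hint : ⋂ n, (pathCylinder x n : Set (ℕ → Fin m)) = {x} := by
    ext y
    simp only [Set.mem_iInter, Set.mem_singleton_iff]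
    constructor
    · intro hy
      funext n
      have h1 : pathWord y (n + 1) = pathWord x (n + 1) := by
        have := mem_elementaryCylinder.1 (hy (n + 1))
        rwa [length_pathWord] at this
      rw [pathWord_succ, pathWord_succ] at h1
      simpa using (List.append_inj h1 (by simp)).2
    · rintro rfl n
      exact self_mem_elementaryCylinder_pathWord y n
  have hT : projL2 (votingMeasure φ) (offPathSigma_le x) ∈
      ⋂ n, votingFactorization φ (pathCylinder x n) :=
    Set.mem_iInter.2 fun n => projL2_offPathSigma_mem x n
  rw [hc _ (pathCylinder_anti x) hint] at hT
  obtain ⟨c, hc⟩ := hT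
  -- A scalar that fixes the constants is 1, so the projection would be the identity and the root
  -- vote would be off-path measurable.
  have h1 : c • oneL2 (votingMeasure φ) = oneL2 (votingMeasure φ) := by
    have := projL2_eq_self (offPathSigma_le (φ := φ) x)
      (oneL2_mem (μ := votingMeasure φ) (offPathSigma_le x))
    rw [hc] at this
    exact this
  have hc1 : c = 1 := by
    have h2 : (c - 1) • oneL2 (votingMeasure φ) = 0 := by rw [sub_smul, h1, one_smul, sub_self]
    rcases smul_eq_zero.1 h2 with h3 | h3
    · exact sub_eq_zero.1 h3
    · have := norm_oneL2 (μ := votingMeasure φ)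
      rw [h3, norm_zero] at this
      exact absurd this zero_ne_one
  let s : Set (VotingSpace φ) := {f | f.1 [] = 0}
  have hs : MeasurableSet s := measurable_vote _ (measurableSet_singleton 0)
  have hmem : indL2 (votingMeasure φ) hs ∈ lpMeas ℂ ℂ (offPathSigma φ x) 2 (votingMeasure φ) := by
    have h2 := projL2_mem (offPathSigma_le x) (indL2 (votingMeasure φ) hs)
    rw [hc, hc1] at h2
    simpa using h2
  have hsm : AEStronglyMeasurable[offPathSigma φ x] (s.indicator fun _ => (1 : ℝ))
      (votingMeasure φ) := by
    have h2 : AEStronglyMeasurable[offPathSigma φ x] (indL2 (votingMeasure φ) hs)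
      (votingMeasure φ) := hmem
    refine (Complex.continuous_re.comp_aestronglyMeasurable h2).congr ?_
    filter_upwards [coeFn_indL2 (μ := votingMeasure φ) hs] with f hf
    rw [hf]
    by_cases hfs : f ∈ s <;> simp [hfs]
  let ℱ : Filtration ℕ (Subtype.instMeasurableSpace : MeasurableSpace (VotingSpace φ)) :=
    { seq := fun n => votingSigma φ (pathCylinder x n)ᶜ
      mono' := fun i j hij => votingSigma_mono (compl_le_compl (pathCylinder_anti x hij))
      le' := fun n => votingSigma_le _ }
  -- The conditional probabilities stay below `1 - 1/r` but converge to the indicator of `s`, which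
  -- forces `s` to be null.
  have hlevy := tendsto_ae_condExp (μ := votingMeasure φ) (ℱ := ℱ) (s.indicator fun _ => (1 : ℝ))
  have hself : (votingMeasure φ)[s.indicator fun _ => (1 : ℝ) | ⨆ n, ℱ n] =ᵐ[votingMeasure φ]
      s.indicator fun _ => (1 : ℝ) :=
    condExp_of_aestronglyMeasurable' (offPathSigma_le x) hsm ((integrable_const _).indicator hs)
  have hbound := ae_all_iff.2 fun n => condExp_vote_le hr h x n (0 : Fin r)
  have hnot : ∀ᵐ f ∂votingMeasure φ, f ∉ s := by
    filter_upwards [hlevy, hself, hbound] with f h2 h3 h4 hfs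
    have h5 := le_of_tendsto' h2 h4
    rw [h3, Set.indicator_of_mem hfs] at h5
    have : (0 : ℝ) < (r : ℝ)⁻¹ := by
      have : (0 : ℝ) < r := by exact_mod_cast NeZero.pos r
      positivity
    linarith
  have h0 : (votingMeasure φ).real s = 0 := by
    rw [measureReal_eq_zero_iff]
    simpa [ae_iff] using hnot
  have h1' := votingMeasure_vote (φ := φ) [] 0
  rw [h0] at h1'
  have : (r : ℝ) ≠ 0 := by exact_mod_cast NeZero.ne r
  exact inv_ne_zero this h1'.symm

end NonAbundant

/-! ### Projections onto the functions additive over the vertices of a level -/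

section Chaos

variable {m r : ℕ} [NeZero m] [NeZero r] {φ : VotingRule m r}

/-- The orthogonal projection onto the functions of the values below the vertex `w`. -/
noncomputable abbrev vertexProj (φ : VotingRule m r) (w : List (Fin m)) :
    VotingL2 φ →L[ℂ] VotingL2 φ :=
  projL2 (votingMeasure φ) (votingSigma_le (φ := φ) (clopenCylinder w))

/-- The orthogonal projection onto the functions of mean zero of the values below the vertex
`w`. -/
noncomputable def centredProj (φ : VotingRule m r) (w : List (Fin m)) :
    VotingL2 φ →L[ℂ] VotingL2 φ :=
  vertexProj φ w - (innerSL ℂ (oneL2 (votingMeasure φ))).smulRight (oneL2 (votingMeasure φ))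

theorem centredProj_apply (w : List (Fin m)) (x : VotingL2 φ) :
    centredProj φ w x = vertexProj φ w x - ⟪oneL2 (votingMeasure φ), x⟫_ℂ • oneL2 _ := rfl

theorem vertexProj_oneL2 (w : List (Fin m)) :
    vertexProj φ w (oneL2 (votingMeasure φ)) = oneL2 _ :=
  projL2_eq_self _ (oneL2_mem (votingSigma_le _))

theorem inner_oneL2_self : ⟪oneL2 (votingMeasure φ), oneL2 (votingMeasure φ)⟫_ℂ = 1 := by
  rw [inner_self_eq_norm_sq_to_K, norm_oneL2]; simp

theorem inner_oneL2_vertexProj (w : List (Fin m)) (x : VotingL2 φ) :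
    ⟪oneL2 (votingMeasure φ), vertexProj φ w x⟫_ℂ = ⟪oneL2 (votingMeasure φ), x⟫_ℂ := by
  rw [← inner_projL2_left, vertexProj_oneL2]

theorem inner_oneL2_centredProj (w : List (Fin m)) (x : VotingL2 φ) :
    ⟪oneL2 (votingMeasure φ), centredProj φ w x⟫_ℂ = 0 := by
  rw [centredProj_apply, inner_sub_right, inner_oneL2_vertexProj, inner_smul_right,
    inner_oneL2_self, mul_one, sub_self]

theorem inner_centredProj_left (w : List (Fin m)) (x y : VotingL2 φ) :
    ⟪centredProj φ w x, y⟫_ℂ = ⟪x, centredProj φ w y⟫_ℂ := by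
  rw [centredProj_apply, centredProj_apply, inner_sub_left, inner_sub_right, inner_projL2_left,
    inner_smul_left, inner_smul_right, inner_conj_symm, mul_comm]

theorem vertexProj_vertexProj_of_disjoint {v w : List (Fin m)}
    (h : Disjoint (elementaryCylinder v) (elementaryCylinder w)) (x : VotingL2 φ) :
    vertexProj φ w (vertexProj φ v x) = ⟪oneL2 (votingMeasure φ), x⟫_ℂ • oneL2 _ := by
  rw [projL2_of_indep (votingSigma_le _) (votingSigma_le _)
    (indep_votingSigma (A := clopenCylinder v) (B := clopenCylinder w) h) (projL2_mem _ x),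
    ← inner_oneL2, inner_oneL2_vertexProj]

theorem vertexProj_vertexProj_of_subset {v w : List (Fin m)}
    (h : elementaryCylinder v ⊆ elementaryCylinder w) (x : VotingL2 φ) :
    vertexProj φ w (vertexProj φ v x) = vertexProj φ v x :=
  projL2_eq_self _ (lpMeas_mono
    (votingSigma_mono (A := clopenCylinder v) (B := clopenCylinder w) h) (projL2_mem _ x))

theorem centredProj_of_disjoint {v w : List (Fin m)}
    (h : Disjoint (elementaryCylinder v) (elementaryCylinder w)) (x : VotingL2 φ) :
    centredProj φ w (centredProj φ v x) = 0 := by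
  rw [centredProj_apply w, inner_oneL2_centredProj, zero_smul, sub_zero, centredProj_apply,
    map_sub, map_smul, vertexProj_vertexProj_of_disjoint h, vertexProj_oneL2, sub_self]

theorem centredProj_of_subset {v w : List (Fin m)}
    (h : elementaryCylinder v ⊆ elementaryCylinder w) (x : VotingL2 φ) :
    centredProj φ w (centredProj φ v x) = centredProj φ v x := by
  rw [centredProj_apply w, inner_oneL2_centredProj, zero_smul, sub_zero, centredProj_apply,
    map_sub, map_smul, vertexProj_vertexProj_of_subset h, vertexProj_oneL2]

theorem centredProj_of_subset' {v w : List (Fin m)}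
    (h : elementaryCylinder v ⊆ elementaryCylinder w) (x : VotingL2 φ) :
    centredProj φ v (centredProj φ w x) = centredProj φ v x := by
  refine ext_inner_left ℂ fun y => ?_
  rw [← inner_centredProj_left, ← inner_centredProj_left, centredProj_of_subset h,
    inner_centredProj_left]

/-- The orthogonal projection onto the sums of functions of mean zero each of which depends on the
values below a single vertex of level `n`. -/
noncomputable def chaosProj (φ : VotingRule m r) (n : ℕ) : VotingL2 φ →L[ℂ] VotingL2 φ :=
  ∑ w : Level m n, centredProj φ w.1

theorem chaosProj_apply (n : ℕ) (x : VotingL2 φ) :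
    chaosProj φ n x = ∑ w : Level m n, centredProj φ w.1 x := by
  simp [chaosProj]

omit [NeZero m] in
theorem elementaryCylinder_subset_take (v : List (Fin m)) (n : ℕ) :
    elementaryCylinder v ⊆ elementaryCylinder (v.take n) := by
  conv_lhs => rw [← List.take_append_drop n v]
  exact elementaryCylinder_append_subset _ _

/-- Only the ancestor of `v` at level `n` contributes; centred functions below the other vertices
are independent of what lies below `v`. -/
theorem centredProj_chaosProj {n : ℕ} {v : List (Fin m)} (hv : n ≤ v.length) (x : VotingL2 φ) :
    centredProj φ v (chaosProj φ n x) = centredProj φ v x := by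
  rw [chaosProj_apply, map_sum, Finset.sum_eq_single (⟨v.take n, by simp [hv]⟩ : Level m n)]
  · exact centredProj_of_subset' (elementaryCylinder_subset_take v n) x
  · intro w _ hw
    refine centredProj_of_disjoint ?_ x
    refine Disjoint.mono_right (elementaryCylinder_subset_take v n)
      (elementaryCylinder_disjoint (by simp [hv, w.2]) fun h => hw (Subtype.ext h))
  · simp

/-- The ranges decrease with the level: additivity over a finer level implies additivity over a
coarser one. With `n = k` this is idempotence. -/
theorem chaosProj_chaosProj {n k : ℕ} (h : n ≤ k) (x : VotingL2 φ) :
    chaosProj φ k (chaosProj φ n x) = chaosProj φ k x := by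
  rw [chaosProj_apply k, chaosProj_apply k]
  exact Finset.sum_congr rfl fun w _ => centredProj_chaosProj (by rw [w.2]; exact h) x

theorem inner_chaosProj_left (n : ℕ) (x y : VotingL2 φ) :
    ⟪chaosProj φ n x, y⟫_ℂ = ⟪x, chaosProj φ n y⟫_ℂ := by
  rw [chaosProj_apply, chaosProj_apply, sum_inner, inner_sum]
  exact Finset.sum_congr rfl fun w _ => inner_centredProj_left _ _ _

theorem inner_chaosProj_chaosProj (n : ℕ) (x : VotingL2 φ) :
    ⟪chaosProj φ n x, chaosProj φ n x⟫_ℂ = ⟪x, chaosProj φ n x⟫_ℂ := by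
  rw [inner_chaosProj_left, chaosProj_chaosProj le_rfl]

theorem norm_chaosProj_le (n : ℕ) (x : VotingL2 φ) : ‖chaosProj φ n x‖ ≤ ‖x‖ := by
  have h1 : ‖chaosProj φ n x‖ * ‖chaosProj φ n x‖ ≤ ‖x‖ * ‖chaosProj φ n x‖ := by
    rw [← inner_self_eq_norm_mul_norm (𝕜 := ℂ), inner_chaosProj_chaosProj]
    exact re_inner_le_norm _ _
  by_cases h0 : ‖chaosProj φ n x‖ = 0
  · rw [h0]; exact norm_nonneg _
  · exact le_of_mul_le_mul_right h1 (lt_of_le_of_ne (norm_nonneg _) (Ne.symm h0))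

theorem norm_chaosProj_anti {n k : ℕ} (h : n ≤ k) (x : VotingL2 φ) :
    ‖chaosProj φ k x‖ ≤ ‖chaosProj φ n x‖ := by
  rw [← chaosProj_chaosProj h]; exact norm_chaosProj_le _ _

theorem norm_sq_chaosProj (n : ℕ) (x : VotingL2 φ) :
    ‖chaosProj φ n x‖ ^ 2 = ∑ w : Level m n, ‖centredProj φ w.1 x‖ ^ 2 := by
  have h : ∀ w : Level m n, ⟪x, centredProj φ w.1 x⟫_ℂ =
      ⟪centredProj φ w.1 x, centredProj φ w.1 x⟫_ℂ := fun w => by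
    rw [inner_centredProj_left, centredProj_of_subset subset_rfl]
  simp only [← inner_self_eq_norm_sq (𝕜 := ℂ)]
  rw [inner_chaosProj_chaosProj, chaosProj_apply, inner_sum, map_sum]
  simp only [h]

theorem norm_sq_sub_chaosProj (n : ℕ) (x : VotingL2 φ) :
    ‖x - chaosProj φ n x‖ ^ 2 = ‖x‖ ^ 2 - ‖chaosProj φ n x‖ ^ 2 := by
  rw [@norm_sub_sq ℂ, ← inner_chaosProj_chaosProj, inner_self_eq_norm_sq]
  ring

theorem norm_sq_vertexProj (w : List (Fin m)) {x : VotingL2 φ}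
    (hx : ⟪oneL2 (votingMeasure φ), x⟫_ℂ = 1) :
    ‖vertexProj φ w x‖ ^ 2 = 1 + ‖centredProj φ w x‖ ^ 2 := by
  have h : vertexProj φ w x = oneL2 (votingMeasure φ) + centredProj φ w x := by
    rw [centredProj_apply, hx, one_smul, add_sub_cancel]
  rw [h, @norm_add_sq ℂ, norm_oneL2, inner_oneL2_centredProj]
  simp

end Chaos

/-! ### Level sets determine a square integrable function -/

section LevelSets

variable {m r : ℕ} [NeZero m] [NeZero r] {φ : VotingRule m r}

omit [NeZero m] [NeZero r] in
theorem vote_eq_of_level {f g : VotingSpace φ} {n : ℕ}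
    (h : ∀ w : Level m n, f.1 w.1 = g.1 w.1) {v : List (Fin m)} (hv : v.length ≤ n) :
    f.1 v = g.1 v := by
  obtain ⟨k, hk⟩ := Nat.exists_eq_add_of_le hv
  induction k generalizing v with
  | zero => exact h ⟨v, by omega⟩
  | succ k ih =>
    rw [f.2, g.2]
    congr 1
    funext i
    exact ih (by simp; omega) (by simp; omega)

omit [NeZero m] [NeZero r] in
theorem levelSet_subset {f : VotingSpace φ} {n k : ℕ} (hnk : n ≤ k)
    {a : Level m n → Fin r} {b : Level m k → Fin r} (ha : f ∈ levelSet φ n a)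
    (hb : f ∈ levelSet φ k b) : levelSet φ k b ⊆ levelSet φ n a := by
  intro g hg w
  rw [← ha w]
  exact vote_eq_of_level (n := k) (fun w => (hg w).trans (hb w).symm) (by rw [w.2]; exact hnk)

omit [NeZero m] [NeZero r] in
theorem disjoint_levelSet {n : ℕ} {a b : Level m n → Fin r} (h : a ≠ b) :
    Disjoint (levelSet φ n a) (levelSet φ n b) :=
  Set.disjoint_left.2 fun _ hf hg => h (funext fun w => (hf w).symm.trans (hg w))

open Classical in
omit [NeZero m] [NeZero r] in
/-- A set that is determined by the values at level `n` is a union of level sets. -/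
theorem setIntegral_eq_sum_levelSet {n : ℕ} {s : Set (VotingSpace φ)} {f : VotingSpace φ → ℂ}
    (hs : ∀ a, (∃ f ∈ s, f ∈ levelSet φ n a) → levelSet φ n a ⊆ s)
    (hf : Integrable f (votingMeasure φ)) :
    ∫ ω in s, f ω ∂votingMeasure φ = ∑ a with (∃ f ∈ s, f ∈ levelSet φ n a),
      ∫ ω in levelSet φ n a, f ω ∂votingMeasure φ := by
  have h : s = ⋃ a ∈ Finset.univ.filter fun a => ∃ f ∈ s, f ∈ levelSet φ n a,
      levelSet φ n a := by
    ext f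
    simp only [Set.mem_iUnion, Finset.mem_filter, Finset.mem_univ, true_and, exists_prop]
    constructor
    · intro hfs; exact ⟨fun w => f.1 w.1, ⟨f, hfs, fun w => rfl⟩, fun w => rfl⟩
    · rintro ⟨a, ha, hfa⟩; exact hs a ha hfa
  conv_lhs => rw [h]
  exact integral_biUnion_finset _ (fun a _ => measurableSet_levelSet n a)
    (fun a _ b _ hab => disjoint_levelSet hab) fun a _ => hf.integrableOn

/-- Level sets that meet are nested, so they form a π-system; it generates the sigma-field. -/
theorem eq_of_forall_levelSet {x y : VotingL2 φ}
    (h : ∀ n a, ∫ ω in levelSet φ n a, x ω ∂votingMeasure φ =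
      ∫ ω in levelSet φ n a, y ω ∂votingMeasure φ) : x = y := by
  classical
  let C : Set (Set (VotingSpace φ)) := {s | ∃ n a, s = levelSet φ n a}
  have hC : IsPiSystem C := by
    rintro _ ⟨n, a, rfl⟩ _ ⟨k, b, rfl⟩ ⟨f, hfa, hfb⟩
    rcases le_total n k with hnk | hnk
    · exact ⟨k, b, Set.inter_eq_right.2 (levelSet_subset hnk hfa hfb)⟩
    · exact ⟨n, a, Set.inter_eq_left.2 (levelSet_subset hnk hfb hfa)⟩
  have hCle : MeasurableSpace.generateFrom C ≤ Subtype.instMeasurableSpace := by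
    refine MeasurableSpace.generateFrom_le ?_
    rintro _ ⟨n, a, rfl⟩
    exact measurableSet_levelSet n a
  have hle : (Subtype.instMeasurableSpace : MeasurableSpace (VotingSpace φ)) ≤
      MeasurableSpace.generateFrom C := by
    refine le_of_measurableSet_vote fun v b => ?_
    have : {f : VotingSpace φ | f.1 v = b} =
        ⋃ a ∈ {a : Level m v.length → Fin r | a ⟨v, rfl⟩ = b}, levelSet φ v.length a := by
      ext f
      simp only [Set.mem_iUnion, exists_prop, Set.mem_ofPred_eq]
      constructor
      · intro hf; exact ⟨fun w => f.1 w.1, hf, fun w => rfl⟩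
      · rintro ⟨a, ha, hfa⟩; rw [← ha]; exact hfa ⟨v, rfl⟩
    rw [this]
    exact MeasurableSet.biUnion (Set.to_countable _) fun a _ =>
      MeasurableSpace.measurableSet_generateFrom ⟨_, a, rfl⟩
  refine eq_of_forall_setIntegral x y fun s hs => ?_
  refine setIntegral_eq_of_isPiSystem hC hCle (integrable_L2 x) (integrable_L2 y) ?_ ?_ (hle s hs)
  · rw [← setIntegral_univ, ← setIntegral_univ (f := y),
      setIntegral_eq_sum_levelSet (n := 0) (fun a _ => Set.subset_univ _) (integrable_L2 x),
      setIntegral_eq_sum_levelSet (n := 0) (fun a _ => Set.subset_univ _) (integrable_L2 y)]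
    exact Finset.sum_congr rfl fun a _ => h 0 a
  · rintro _ ⟨n, a, rfl⟩
    exact h n a

end LevelSets

/-! ### Functions of a single vote and the transfer operator -/

section VertexFunctions

variable {m r : ℕ} [NeZero m] [NeZero r] {φ : VotingRule m r}

theorem coeFn_sum_L2 {Ω : Type*} {m0 : MeasurableSpace Ω} {μ : Measure Ω} {ι : Type*}
    (s : Finset ι) (F : ι → Lp ℂ 2 μ) :
    (∑ i ∈ s, F i : Lp ℂ 2 μ) =ᵐ[μ] fun ω => ∑ i ∈ s, F i ω := by
  classical
  induction s using Finset.induction_on with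
  | empty => simpa using! Lp.coeFn_zero ℂ 2 μ
  | insert i s hi ih =>
    rw [Finset.sum_insert hi]
    filter_upwards [ih, Lp.coeFn_add (F i) (∑ i ∈ s, F i)] with ω h1 h2
    rw [h2, Pi.add_apply, h1, Finset.sum_insert hi]

theorem measurableSet_vote (v : List (Fin m)) (c : Fin r) :
    MeasurableSet {f : VotingSpace φ | f.1 v = c} :=
  measurable_vote v (measurableSet_singleton c)

/-- The function `b (f v)` of the value at the vertex `v`, as an element of `L²`. -/
noncomputable def vertexFun (φ : VotingRule m r) (v : List (Fin m)) :
    (Fin r → ℂ) →ₗ[ℂ] VotingL2 φ :=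
  ∑ c, (LinearMap.proj c).smulRight (indL2 (votingMeasure φ) (measurableSet_vote v c))

theorem vertexFun_apply (v : List (Fin m)) (b : Fin r → ℂ) :
    vertexFun φ v b = ∑ c, b c • indL2 (votingMeasure φ) (measurableSet_vote v c) := by
  simp [vertexFun]

theorem coeFn_vertexFun (v : List (Fin m)) (b : Fin r → ℂ) :
    vertexFun φ v b =ᵐ[votingMeasure φ] fun f => b (f.1 v) := by
  rw [vertexFun_apply]
  have h1 := ae_all_iff.2 fun c => coeFn_indL2 (μ := votingMeasure φ) (measurableSet_vote v c)
  have h2 := ae_all_iff.2 fun c => Lp.coeFn_smul (b c)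
    (indL2 (votingMeasure φ) (measurableSet_vote v c))
  filter_upwards [coeFn_sum_L2 Finset.univ fun c => b c •
    indL2 (votingMeasure φ) (measurableSet_vote v c), h1, h2] with f h3 h4 h5
  rw [h3, Finset.sum_eq_single (f.1 v)]
  · rw [h5, Pi.smul_apply, h4,
      Set.indicator_of_mem (show f ∈ {g : VotingSpace φ | g.1 v = f.1 v} from rfl)]
    simp
  · intro c _ hc
    rw [h5, Pi.smul_apply, h4, Set.indicator_of_notMem fun h => hc h.symm, smul_zero]
  · simp

theorem vertexFun_mem (v : List (Fin m)) (b : Fin r → ℂ) :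
    vertexFun φ v b ∈ votingSubspace φ (clopenCylinder v) := by
  rw [vertexFun_apply]
  exact Submodule.sum_mem _ fun c _ => Submodule.smul_mem _ _
    (indL2_mem (votingSigma_le _) (measurableSet_vote_votingSigma (subset_refl _) c))

theorem vertexFun_const (v : List (Fin m)) (z : ℂ) :
    vertexFun φ v (fun _ => z) = z • oneL2 (votingMeasure φ) := by
  refine Lp.ext ?_
  filter_upwards [coeFn_vertexFun (φ := φ) v fun _ => z, coeFn_oneL2 (μ := votingMeasure φ),
    Lp.coeFn_smul z (oneL2 (votingMeasure φ))] with f h1 h2 h3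
  rw [h1, h3, Pi.smul_apply, h2, smul_eq_mul, mul_one]

theorem inner_vertexFun (v : List (Fin m)) (b : Fin r → ℂ) (x : VotingL2 φ) :
    ⟪vertexFun φ v b, x⟫_ℂ =
      ∑ c, starRingEnd ℂ (b c) * ∫ ω in {f | f.1 v = c}, x ω ∂votingMeasure φ := by
  rw [vertexFun_apply, sum_inner]
  exact Finset.sum_congr rfl fun c _ => by rw [inner_smul_left, inner_indL2]

theorem setIntegral_vertexFun {s : Set (VotingSpace φ)} (hs : MeasurableSet s)
    {v : List (Fin m)} {c : Fin r} (h : ∀ f ∈ s, f.1 v = c) (b : Fin r → ℂ) :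
    ∫ ω in s, vertexFun φ v b ω ∂votingMeasure φ = (votingMeasure φ).real s * b c := by
  have h1 : ∫ ω in s, vertexFun φ v b ω ∂votingMeasure φ =
      ∫ _ in s, b c ∂votingMeasure φ := by
    refine setIntegral_congr_ae hs ?_
    filter_upwards [coeFn_vertexFun v b] with f hf hfs
    rw [hf, h f hfs]
  rw [h1, setIntegral_const, Complex.real_smul]

theorem inner_vertexFun_vertexFun (v : List (Fin m)) (b b' : Fin r → ℂ) :
    ⟪vertexFun φ v b, vertexFun φ v b'⟫_ℂ = (r : ℂ)⁻¹ * ∑ c, starRingEnd ℂ (b c) * b' c := by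
  rw [inner_vertexFun, Finset.mul_sum]
  refine Finset.sum_congr rfl fun c _ => ?_
  rw [setIntegral_vertexFun (measurableSet_vote v c) (fun f hf => hf), votingMeasure_vote]
  push_cast
  ring

theorem norm_sq_vertexFun (v : List (Fin m)) (b : Fin r → ℂ) :
    ‖vertexFun φ v b‖ ^ 2 = (r : ℝ)⁻¹ * ∑ c, ‖b c‖ ^ 2 := by
  have h : ((‖vertexFun φ v b‖ ^ 2 : ℝ) : ℂ) = (((r : ℝ)⁻¹ * ∑ c, ‖b c‖ ^ 2 : ℝ) : ℂ) := by
    have := inner_self_eq_norm_sq_to_K (𝕜 := ℂ) (vertexFun φ v b)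
    rw [inner_vertexFun_vertexFun] at this
    push_cast
    refine this.symm.trans ?_
    simp only [Complex.conj_mul']
  exact_mod_cast h

theorem inner_oneL2_vertexFun (v : List (Fin m)) (b : Fin r → ℂ) :
    ⟪oneL2 (votingMeasure φ), vertexFun φ v b⟫_ℂ = (r : ℂ)⁻¹ * ∑ c, b c := by
  have h := vertexFun_const (φ := φ) v 1
  rw [one_smul] at h
  rw [← h, inner_vertexFun_vertexFun]
  simp

/-- The conditional expectation of `b (f v)`, given the value at a son of `v`. -/
noncomputable def transfer (φ : VotingRule m r) : (Fin r → ℂ) →ₗ[ℂ] (Fin r → ℂ) where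
  toFun b d := ((r : ℂ)⁻¹) ^ (m - 1) * ∑ a : Fin m → Fin r, if a 0 = d then b (φ.toFun a) else 0
  map_add' b b' := by
    funext d
    simp only [Pi.add_apply, ← mul_add, ← Finset.sum_add_distrib]
    congr 1
    exact Finset.sum_congr rfl fun a _ => by split_ifs <;> simp
  map_smul' z b := by
    funext d
    simp only [Pi.smul_apply, smul_eq_mul, RingHom.id_apply, Finset.mul_sum]
    exact Finset.sum_congr rfl fun a _ => by split_ifs <;> ring

theorem transfer_apply (b : Fin r → ℂ) (d : Fin r) : transfer φ b d =
    ((r : ℂ)⁻¹) ^ (m - 1) * ∑ a : Fin m → Fin r, if a 0 = d then b (φ.toFun a) else 0 := rfl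

/-- The other `m - 1` sons are independent of everything below `v ++ [i]`. -/
theorem setIntegral_sons (v : List (Fin m)) (i : Fin m) (a : Fin m → Fin r) {x : VotingL2 φ}
    (hx : x ∈ votingSubspace φ (clopenCylinder (v ++ [i]))) :
    ∫ ω in {f | ∀ j, f.1 (v ++ [j]) = a j}, x ω ∂votingMeasure φ =
      ((r : ℂ)⁻¹) ^ (m - 1) * ∫ ω in {f | f.1 (v ++ [i]) = a i}, x ω ∂votingMeasure φ := by
  classical
  let t : Set (VotingSpace φ) := {f | ∀ j ∈ Finset.univ.erase i, f.1 (v ++ [j]) = a j}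
  have ht : MeasurableSet[votingSigma φ (clopenCylinder (v ++ [i]))ᶜ] t := by
    have : t = ⋂ j ∈ Finset.univ.erase i, {f : VotingSpace φ | f.1 (v ++ [j]) = a j} := by
      ext f; simp [t]
    rw [this]
    refine Finset.measurableSet_biInter _ fun j hj => measurableSet_vote_votingSigma ?_ _
    refine Set.subset_compl_iff_disjoint_right.2 (elementaryCylinder_disjoint (by simp) ?_)
    simpa using Finset.ne_of_mem_erase hj
  have hset : {f : VotingSpace φ | ∀ j, f.1 (v ++ [j]) = a j} =
      {f | f.1 (v ++ [i]) = a i} ∩ t := by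
    ext f
    simp only [Set.mem_ofPred_eq, Set.mem_inter_iff, t, Finset.mem_erase, Finset.mem_univ, and_true]
    constructor
    · exact fun h => ⟨h i, fun j _ => h j⟩
    · rintro ⟨h1, h2⟩ j
      by_cases hj : j = i
      · rw [hj, h1]
      · exact h2 j hj
  rw [hset, setIntegral_inter_of_indep (votingSigma_le _) (votingSigma_le _)
    (indep_votingSigma (A := clopenCylinder (v ++ [i])) disjoint_compl_right) hx
    (measurableSet_vote_votingSigma (subset_refl _) _) ht, votingMeasure_sons,
    Finset.card_erase_of_mem (Finset.mem_univ i), Finset.card_univ, Fintype.card_fin]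
  push_cast
  rfl

/-- Split `{f v = c}` by the votes of the sons. Symmetry of `φ` makes the result the same for every
son `i`, so the son 0 used in `transfer` serves for all. -/
theorem inner_vertexFun_son (v : List (Fin m)) (i : Fin m) (b : Fin r → ℂ) {x : VotingL2 φ}
    (hx : x ∈ votingSubspace φ (clopenCylinder (v ++ [i]))) :
    ⟪vertexFun φ v b, x⟫_ℂ = ⟪vertexFun φ (v ++ [i]) (transfer φ b), x⟫_ℂ := by
  classical
  have hl : ⟪vertexFun φ v b, x⟫_ℂ = ∑ a : Fin m → Fin r, starRingEnd ℂ (b (φ.toFun a)) *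
      (((r : ℂ)⁻¹) ^ (m - 1) *
        ∫ ω in {f | f.1 (v ++ [i]) = a i}, x ω ∂votingMeasure φ) := by
    rw [inner_vertexFun, ← Finset.sum_fiberwise (s := Finset.univ) (g := φ.toFun)]
    refine Finset.sum_congr rfl fun c _ => ?_
    have hset : {f : VotingSpace φ | f.1 v = c} =
        ⋃ a ∈ Finset.univ.filter fun a : Fin m → Fin r => φ.toFun a = c,
          {f : VotingSpace φ | ∀ j, f.1 (v ++ [j]) = a j} := by
      ext f
      simp only [Set.mem_iUnion, Finset.mem_filter, Finset.mem_univ, true_and, exists_prop,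
        Set.mem_ofPred_eq]
      constructor
      · intro h; exact ⟨fun j => f.1 (v ++ [j]), by rw [← h, f.2 v], fun j => rfl⟩
      · rintro ⟨a, ha, hf⟩
        rw [f.2 v, ← ha]
        exact congrArg _ (funext hf)
    rw [hset, integral_biUnion_finset _ (fun a _ => ?_) (fun a _ a' _ haa => ?_)
      (fun a _ => (integrable_L2 x).integrableOn), Finset.mul_sum]
    · refine Finset.sum_congr rfl fun a ha => ?_
      rw [setIntegral_sons v i a hx, (Finset.mem_filter.1 ha).2]
    · have : {f : VotingSpace φ | ∀ j, f.1 (v ++ [j]) = a j} =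
          ⋂ j, {f : VotingSpace φ | f.1 (v ++ [j]) = a j} := by ext f; simp
      rw [this]
      exact MeasurableSet.iInter fun j => measurableSet_vote _ _
    · exact Set.disjoint_left.2 fun f hf hf' => haa (funext fun j => (hf j).symm.trans (hf' j))
  rw [hl, inner_vertexFun]
  -- Permuting the votes exchanges the sons 0 and `i`.
  have hreindex := Equiv.sum_comp (Equiv.arrowCongr (Equiv.swap 0 i) (Equiv.refl (Fin r)))
    fun a : Fin m → Fin r => starRingEnd ℂ (b (φ.toFun a)) * (((r : ℂ)⁻¹) ^ (m - 1) *
        ∫ ω in {f | f.1 (v ++ [i]) = a i}, x ω ∂votingMeasure φ)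
  rw [← hreindex]
  simp only [transfer_apply, map_mul, map_sum, map_pow, map_inv₀, Complex.conj_natCast,
    Finset.mul_sum, Finset.sum_mul]
  rw [Finset.sum_comm]
  refine Finset.sum_congr rfl fun a _ => ?_
  have h1 : (Equiv.arrowCongr (Equiv.swap 0 i) (Equiv.refl (Fin r))) a = a ∘ Equiv.swap 0 i := by
    funext j; simp [Equiv.arrowCongr]
  rw [h1, φ.symmetric, Finset.sum_eq_single (a 0)]
  · simp only [if_true, Function.comp_apply, Equiv.swap_apply_right]
    ring
  · intro d _ hd
    rw [if_neg (Ne.symm hd)]; simp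
  · simp

theorem inner_vertexFun_append (v l : List (Fin m)) (b : Fin r → ℂ) {x : VotingL2 φ}
    (hx : x ∈ votingSubspace φ (clopenCylinder (v ++ l))) :
    ⟪vertexFun φ v b, x⟫_ℂ = ⟪vertexFun φ (v ++ l) ((transfer φ ^ l.length) b), x⟫_ℂ := by
  induction l using List.reverseRecOn with
  | nil => simp
  | append_singleton l i ih =>
    rw [← List.append_assoc] at hx ⊢
    have hx' : x ∈ votingSubspace φ (clopenCylinder (v ++ l)) :=
      lpMeas_mono (votingSigma_mono (A := clopenCylinder (v ++ l ++ [i]))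
        (elementaryCylinder_append_subset _ _)) hx
    rw [ih hx', inner_vertexFun_son _ i _ hx, List.length_append, List.length_singleton,
      pow_succ', Module.End.mul_apply]

theorem vertexProj_vertexFun (v l : List (Fin m)) (b : Fin r → ℂ) :
    vertexProj φ (v ++ l) (vertexFun φ v b) =
      vertexFun φ (v ++ l) ((transfer φ ^ l.length) b) := by
  refine projL2_eq_of_setIntegral _ (vertexFun_mem _ _) fun s hs => ?_
  have h := inner_vertexFun_append v l b (indL2_mem (votingSigma_le _) hs)
  rw [← inner_indL2 (votingSigma_le _ s hs), ← inner_indL2 (votingSigma_le _ s hs),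
    ← inner_conj_symm, ← h, inner_conj_symm]

/-- Conditioning preserves the mean; this is read off at the word of `k` zeros. -/
theorem sum_transfer_pow (b : Fin r → ℂ) (hb : ∑ c, b c = 0) (k : ℕ) :
    ∑ c, (transfer φ ^ k) b c = 0 := by
  have hr : (r : ℂ)⁻¹ ≠ 0 := inv_ne_zero (by exact_mod_cast NeZero.ne r)
  let l : List (Fin m) := List.replicate k 0
  have hl : l.length = k := by simp [l]
  have h := inner_oneL2_vertexProj (φ := φ) ([] ++ l) (vertexFun φ [] b)
  rw [vertexProj_vertexFun, inner_oneL2_vertexFun, inner_oneL2_vertexFun, hb, mul_zero, hl] at h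
  exact (mul_eq_zero.1 h).resolve_left hr

theorem centredProj_vertexFun (v l : List (Fin m)) {b : Fin r → ℂ} (hb : ∑ c, b c = 0) :
    centredProj φ (v ++ l) (vertexFun φ v b) =
      vertexFun φ (v ++ l) ((transfer φ ^ l.length) b) := by
  rw [centredProj_apply, vertexProj_vertexFun, inner_oneL2_vertexFun, hb, mul_zero, zero_smul,
    sub_zero]

/-- Only the `m ^ k` descendants of `v` contribute, and all contribute equally. -/
theorem norm_sq_chaosProj_vertexFun (v : List (Fin m)) (k : ℕ) {b : Fin r → ℂ}
    (hb : ∑ c, b c = 0) : ‖chaosProj φ (v.length + k) (vertexFun φ v b)‖ ^ 2 =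
      (m : ℝ) ^ k * ((r : ℝ)⁻¹ * ∑ c, ‖(transfer φ ^ k) b c‖ ^ 2) := by
  rw [norm_sq_chaosProj]
  let e : Level m k → Level m (v.length + k) := fun l => ⟨v ++ l.1, by simp [l.2]⟩
  have he : Function.Injective e := fun l l' h => Subtype.ext (by simpa [e] using h)
  have h1 : ∑ l : Level m k, ‖centredProj φ (e l).1 (vertexFun φ v b)‖ ^ 2 =
      ∑ w : Level m (v.length + k), ‖centredProj φ w.1 (vertexFun φ v b)‖ ^ 2 := by
    refine Finset.sum_of_injOn e he.injOn (by simp) (fun w _ hw => ?_) fun _ _ => rfl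
    have hself : centredProj φ v (vertexFun φ v b) = vertexFun φ v b := by
      have := centredProj_vertexFun (φ := φ) v [] hb
      simpa using this
    rw [← hself, centredProj_of_disjoint, norm_zero, zero_pow two_ne_zero]
    refine Disjoint.mono_right (elementaryCylinder_subset_take w.1 v.length)
      (elementaryCylinder_disjoint (by simp [w.2]) fun h => hw ?_)
    refine ⟨⟨w.1.drop v.length, by simp [w.2]⟩, by simp, Subtype.ext ?_⟩
    change v ++ w.1.drop v.length = w.1
    exact (congrArg (· ++ w.1.drop v.length) h).trans (List.take_append_drop _ _)
  rw [← h1, Finset.sum_congr rfl fun l _ => by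
    rw [show (e l).1 = v ++ l.1 from rfl, centredProj_vertexFun v l.1 hb, norm_sq_vertexFun, l.2],
    Finset.sum_const, Finset.card_univ, card_level, nsmul_eq_mul]
  push_cast
  rfl

end VertexFunctions

/-! ### The additive projections tend strongly to zero -/

section Decay

variable {m r : ℕ} [NeZero m] [NeZero r] {φ : VotingRule m r}

theorem measureReal_levelSet (n : ℕ) (a : Level m n → Fin r) :
    (votingMeasure φ).real (levelSet φ n a) = ((r : ℝ)⁻¹) ^ (m ^ n) := by
  rw [measureReal_def, votingMeasure_levelSet]
  simp

theorem levelSet_nonempty (n : ℕ) (a : Level m n → Fin r) : (levelSet φ n a).Nonempty := by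
  have hr : (0 : ℝ) < r := by exact_mod_cast NeZero.pos r
  rw [Set.nonempty_iff_ne_empty]
  intro h
  have h1 := measureReal_levelSet (φ := φ) n a
  rw [h, measureReal_empty] at h1
  have : (0 : ℝ) < ((r : ℝ)⁻¹) ^ (m ^ n) := by positivity
  linarith

/-- A nonzero function of the value at the root is not a sum of functions of the values at the
vertices of a level with many vertices, since such sums take too many values. -/
theorem sum_norm_sq_transfer_pow_lt {k : ℕ} (hk : r ≤ m ^ k) {b : Fin r → ℂ}
    (hb : ∑ c, b c = 0) (hb0 : b ≠ 0) :
    (m : ℝ) ^ k * ∑ c, ‖(transfer φ ^ k) b c‖ ^ 2 < ∑ c, ‖b c‖ ^ 2 := by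
  classical
  have hr : (0 : ℝ) < r := by exact_mod_cast NeZero.pos r
  by_contra! hcon
  set y := vertexFun φ [] b with hy
  set q := (transfer φ ^ k) b with hq
  have h1 := norm_sq_chaosProj_vertexFun (φ := φ) [] k hb
  rw [List.length_nil, zero_add] at h1
  -- A projection that does not shrink the norm of `y` fixes `y`.
  have h2 : chaosProj φ k y = y := by
    have h3 := norm_sq_sub_chaosProj k y
    rw [h1, norm_sq_vertexFun] at h3
    have h4 : ‖y - chaosProj φ k y‖ ^ 2 ≤ 0 := by
      rw [h3]
      have : (r : ℝ)⁻¹ * ∑ c, ‖b c‖ ^ 2 ≤ (r : ℝ)⁻¹ * ((m : ℝ) ^ k * ∑ c, ‖q c‖ ^ 2) := by gcongr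
      linarith
    have h5 : ‖y - chaosProj φ k y‖ = 0 := by nlinarith [norm_nonneg (y - chaosProj φ k y)]
    exact (sub_eq_zero.1 (norm_eq_zero.1 h5)).symm
  have h3 : y = ∑ w : Level m k, vertexFun φ w.1 q := by
    rw [← h2, chaosProj_apply]
    refine Finset.sum_congr rfl fun w _ => ?_
    have := centredProj_vertexFun (φ := φ) [] w.1 hb
    rw [w.2] at this
    exact this
  -- Every assignment of votes at level `k` has positive probability, so the almost sure identity
  -- between `y` and the sum holds for each assignment.
  have hval : ∀ a : Level m k → Fin r, ∃ c, b c = ∑ w, q (a w) := by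
    intro a
    obtain ⟨f, hf⟩ := levelSet_nonempty (φ := φ) k a
    refine ⟨f.1 [], ?_⟩
    have hm := measurableSet_levelSet (φ := φ) k a
    have h4 : ∫ ω in levelSet φ k a, y ω ∂votingMeasure φ =
        (votingMeasure φ).real (levelSet φ k a) * b (f.1 []) :=
      setIntegral_vertexFun hm (fun g hg => vote_eq_of_level (n := k)
        (fun w => (hg w).trans (hf w).symm) (by simp)) b
    have h5 : ∫ ω in levelSet φ k a, y ω ∂votingMeasure φ =
        (votingMeasure φ).real (levelSet φ k a) * ∑ w, q (a w) := by
      rw [h3, ← inner_indL2 hm, inner_sum, Finset.mul_sum]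
      refine Finset.sum_congr rfl fun w _ => ?_
      rw [inner_indL2, setIntegral_vertexFun hm fun g hg => hg w]
    rw [h4, measureReal_levelSet] at h5
    refine mul_left_cancel₀ ?_ h5
    have : ((r : ℝ)⁻¹) ^ (m ^ k) ≠ 0 := by positivity
    exact_mod_cast this
  by_cases hconst : ∀ c d, q c = q d
  · have hq0 : q = 0 := by
      funext c
      have h4 := sum_transfer_pow (φ := φ) b hb k
      have h5 : ∑ d, (transfer φ ^ k) b d = r * q c := by
        rw [Finset.sum_congr rfl fun d _ => hconst d c]; simp
      rw [h5] at h4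
      have hr' : (r : ℂ) ≠ 0 := by exact_mod_cast NeZero.ne r
      exact (mul_eq_zero.1 h4).resolve_left hr'
    have h4 : y = 0 := by rw [h3, hq0]; simp
    have h5 := norm_sq_vertexFun (φ := φ) [] b
    rw [← hy, h4, norm_zero, zero_pow two_ne_zero] at h5
    have h6 : ∑ c, ‖b c‖ ^ 2 = 0 := by
      rcases mul_eq_zero.1 h5.symm with h | h
      · exact absurd h (by positivity)
      · exact h
    refine hb0 (funext fun c => ?_)
    have := (Finset.sum_eq_zero_iff_of_nonneg fun c _ => by positivity).1 h6 c (Finset.mem_univ c)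
    simpa using this
  · push Not at hconst
    obtain ⟨c, d, hcd⟩ := hconst
    -- Let `j` vertices vote `c` and the others `d`. As `j` runs from 0 to `m ^ k` this gives `m ^ k
    -- + 1 > r` distinct values, but `b` has at most `r`.
    have hex : ∀ j : Fin (m ^ k + 1), ∃ e, b e = (m ^ k : ℕ) * q d + j.1 * (q c - q d) := by
      intro j
      obtain ⟨S, -, hS⟩ := Finset.exists_subset_card_eq
        (s := (Finset.univ : Finset (Level m k))) (n := j.1)
        (by rw [Finset.card_univ, card_level]; omega)
      obtain ⟨e, he⟩ := hval fun w => if w ∈ S then c else d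
      refine ⟨e, ?_⟩
      have h4 : ∀ w : Level m k, q (if w ∈ S then c else d) =
          q d + if w ∈ S then q c - q d else 0 := fun w => by split_ifs <;> ring
      rw [he, Finset.sum_congr rfl fun w _ => h4 w, Finset.sum_add_distrib, Finset.sum_const,
        Finset.card_univ, card_level, Finset.sum_ite_mem, Finset.univ_inter, Finset.sum_const, hS,
        nsmul_eq_mul, nsmul_eq_mul]
    choose g hg using hex
    have hinj : Function.Injective g := by
      intro i j hij
      have h4 := hg i
      rw [hij, hg j] at h4
      have h5 := mul_right_cancel₀ (sub_ne_zero.2 hcd) (add_left_cancel h4)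
      exact Fin.ext (by exact_mod_cast h5.symm)
    have := Fintype.card_le_of_injective g hinj
    simp only [Fintype.card_fin] at this
    omega

/-- The strict inequality is uniform on the compact unit sphere of mean-zero functions, and extends
by homogeneity. -/
theorem exists_transfer_pow_le (hm : 1 < m) (φ : VotingRule m r) :
    ∃ (k : ℕ) (q : ℝ), 0 ≤ q ∧ q < 1 ∧ ∀ b : Fin r → ℂ, ∑ c, b c = 0 →
      (m : ℝ) ^ k * ∑ c, ‖(transfer φ ^ k) b c‖ ^ 2 ≤ q * ∑ c, ‖b c‖ ^ 2 := by
  -- The level `k = r` already has enough vertices.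
  have hk : r ≤ m ^ r := (Nat.lt_pow_self hm).le
  let N : (Fin r → ℂ) → ℝ := fun b => ∑ c, ‖b c‖ ^ 2
  let F : (Fin r → ℂ) → ℝ := fun b => (m : ℝ) ^ r * N ((transfer φ ^ r) b)
  have hNc : Continuous N := by fun_prop
  have hFc : Continuous F := continuous_const.mul
    (hNc.comp (LinearMap.continuous_of_finiteDimensional (transfer φ ^ r)))
  let S : Set (Fin r → ℂ) := {b | ∑ c, b c = 0 ∧ N b = 1}
  have hS : IsCompact S := by
    refine Metric.isCompact_of_isClosed_isBounded ?_ ?_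
    · exact (isClosed_eq (by fun_prop) continuous_const).inter (isClosed_eq hNc continuous_const)
    · refine (Metric.isBounded_closedBall (x := (0 : Fin r → ℂ)) (r := 1)).subset fun b hb => ?_
      rw [mem_closedBall_zero_iff, pi_norm_le_iff_of_nonneg zero_le_one]
      intro c
      have h1 : ‖b c‖ ^ 2 ≤ N b := Finset.single_le_sum (f := fun c => ‖b c‖ ^ 2)
        (fun c _ => by positivity) (Finset.mem_univ c)
      rw [hb.2] at h1
      nlinarith [norm_nonneg (b c)]
  have hF0 : ∀ b, 0 ≤ F b := fun b => by positivity
  have key : ∃ q : ℝ, 0 ≤ q ∧ q < 1 ∧ ∀ b ∈ S, F b ≤ q := by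
    rcases S.eq_empty_or_nonempty with h | h
    · exact ⟨0, le_rfl, one_pos, by simp [h]⟩
    · obtain ⟨b, hb, hmax⟩ := hS.exists_isMaxOn h hFc.continuousOn
      refine ⟨F b, hF0 b, ?_, hmax⟩
      rw [← hb.2]
      refine sum_norm_sq_transfer_pow_lt hk hb.1 fun h0 => ?_
      have := hb.2
      simp [N, h0] at this
  obtain ⟨q, hq0, hq1, hq⟩ := key
  refine ⟨r, q, hq0, hq1, fun b hb => ?_⟩
  change F b ≤ q * N b
  have hN0 : 0 ≤ N b := by positivity
  have hNs : ∀ (t : ℝ) b, N ((t : ℂ) • b) = t ^ 2 * N b := fun t b => by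
    simp only [N, Pi.smul_apply, smul_eq_mul, norm_mul, mul_pow, Finset.mul_sum, Complex.norm_real,
      Real.norm_eq_abs, sq_abs]
  have hFs : ∀ (t : ℝ) b, F ((t : ℂ) • b) = t ^ 2 * F b := fun t b => by
    simp only [F, map_smul, hNs]; ring
  rcases hN0.eq_or_lt with h0 | h0
  · have : b = 0 := by
      funext c
      have := (Finset.sum_eq_zero_iff_of_nonneg fun c _ => by positivity).1 h0.symm c
        (Finset.mem_univ c)
      simpa using this
    rw [this]
    simp [F, N]
  · have h1 : ((Real.sqrt (N b))⁻¹) ^ 2 = (N b)⁻¹ := by rw [inv_pow, Real.sq_sqrt hN0]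
    have h2 := hq ((((Real.sqrt (N b))⁻¹ : ℝ) : ℂ) • b) ⟨by
      simp only [Pi.smul_apply, smul_eq_mul, ← Finset.mul_sum, hb, mul_zero], by
      rw [hNs, h1, inv_mul_cancel₀ h0.ne']⟩
    rw [hFs, h1, inv_mul_le_iff₀ h0] at h2
    linarith

theorem tendsto_chaosProj_of_small {x : VotingL2 φ}
    (h : ∀ ε > 0, ∃ n, ‖chaosProj φ n x‖ < ε) :
    Filter.Tendsto (fun n => chaosProj φ n x) Filter.atTop (nhds 0) := by
  rw [Metric.tendsto_atTop]
  intro ε hε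
  obtain ⟨n, hn⟩ := h ε hε
  refine ⟨n, fun k hk => ?_⟩
  rw [dist_zero_right]
  exact (norm_chaosProj_anti hk x).trans_lt hn

theorem tendsto_chaosProj_vertexFun (hm : 1 < m) (v : List (Fin m)) {b : Fin r → ℂ}
    (hb : ∑ c, b c = 0) :
    Filter.Tendsto (fun n => chaosProj φ n (vertexFun φ v b)) Filter.atTop (nhds 0) := by
  have hr : (0 : ℝ) < r := by exact_mod_cast NeZero.pos r
  obtain ⟨k, q, hq0, hq1, hq⟩ := exists_transfer_pow_le hm φ
  have hpow : ∀ j, (m : ℝ) ^ (k * j) * ∑ c, ‖(transfer φ ^ (k * j)) b c‖ ^ 2 ≤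
      q ^ j * ∑ c, ‖b c‖ ^ 2 := by
    intro j
    induction j with
    | zero => simp
    | succ j ih =>
      have h1 := hq _ (sum_transfer_pow (φ := φ) b hb (k * j))
      rw [← Module.End.mul_apply, ← pow_add] at h1
      rw [Nat.mul_succ, pow_add, mul_assoc, add_comm (k * j) k]
      calc _ ≤ (m : ℝ) ^ (k * j) * (q * ∑ c, ‖(transfer φ ^ (k * j)) b c‖ ^ 2) := by gcongr
        _ = q * ((m : ℝ) ^ (k * j) * ∑ c, ‖(transfer φ ^ (k * j)) b c‖ ^ 2) := by ring
        _ ≤ q * (q ^ j * ∑ c, ‖b c‖ ^ 2) := by gcongr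
        _ = _ := by ring
  refine tendsto_chaosProj_of_small fun ε hε => ?_
  have ht : Filter.Tendsto (fun j => (r : ℝ)⁻¹ * (q ^ j * ∑ c, ‖b c‖ ^ 2)) Filter.atTop
      (nhds ((r : ℝ)⁻¹ * (0 * ∑ c, ‖b c‖ ^ 2))) :=
    ((tendsto_pow_atTop_nhds_zero_of_lt_one hq0 hq1).mul_const _).const_mul _
  rw [zero_mul, mul_zero] at ht
  obtain ⟨j, hj⟩ := (ht.eventually (gt_mem_nhds (by positivity : (0 : ℝ) < ε ^ 2))).exists
  refine ⟨v.length + k * j, ?_⟩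
  refine lt_of_pow_lt_pow_left₀ 2 hε.le ?_
  rw [norm_sq_chaosProj_vertexFun v _ hb]
  refine lt_of_le_of_lt ?_ hj
  rw [mul_left_comm]
  exact mul_le_mul_of_nonneg_left (hpow j) (by positivity)

theorem tendsto_chaosProj_centredProj_vertexFun (hm : 1 < m) (v : List (Fin m))
    (b : Fin r → ℂ) : Filter.Tendsto (fun n => chaosProj φ n (centredProj φ v (vertexFun φ v b)))
      Filter.atTop (nhds 0) := by
  have hr' : (r : ℂ) ≠ 0 := by exact_mod_cast NeZero.ne r
  set z := (r : ℂ)⁻¹ * ∑ c, b c with hz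
  have h : centredProj φ v (vertexFun φ v b) = vertexFun φ v (b - fun _ => z) := by
    rw [centredProj_apply, map_sub, vertexFun_const, inner_oneL2_vertexFun,
      projL2_eq_self _ (vertexFun_mem v b)]
  rw [h]
  refine tendsto_chaosProj_vertexFun hm v ?_
  simp only [Pi.sub_apply, Finset.sum_sub_distrib, Finset.sum_const, Finset.card_univ,
    Fintype.card_fin, nsmul_eq_mul, hz]
  rw [mul_inv_cancel_left₀ hr', sub_self]

theorem indL2_vote (v : List (Fin m)) (c : Fin r) :
    indL2 (votingMeasure φ) (measurableSet_vote v c) = vertexFun φ v (Pi.single c 1) := by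
  rw [vertexFun_apply, Finset.sum_eq_single c]
  · simp
  · intro d _ hd; simp [hd]
  · simp

theorem measurableSet_votes (n : ℕ) (w : Level m n) (W : Finset (Level m n)) (hw : w ∉ W)
    (a : Level m n → Fin r) : MeasurableSet[votingSigma φ (clopenCylinder w.1)ᶜ]
      {f : VotingSpace φ | ∀ v ∈ W, f.1 v.1 = a v} := by
  have : {f : VotingSpace φ | ∀ v ∈ W, f.1 v.1 = a v} =
      ⋂ v ∈ W, {f : VotingSpace φ | f.1 v.1 = a v} := by ext f; simp
  rw [this]
  refine Finset.measurableSet_biInter _ fun v hv => measurableSet_vote_votingSigma ?_ _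
  refine Set.subset_compl_iff_disjoint_right.2
    (elementaryCylinder_disjoint (by rw [v.2, w.2]) fun h => hw ?_)
  rwa [← Subtype.ext h]

/-- The votes of the other vertices of level `n` are independent of everything below `w`, so
conditioning replaces them by their probability `t`. -/
theorem vertexProj_indL2_levelSet (n : ℕ) (a : Level m n → Fin r) (w : Level m n) :
    ∃ t : ℂ, vertexProj φ w.1 (indL2 (votingMeasure φ) (measurableSet_levelSet n a)) =
      t • vertexFun φ w.1 (Pi.single (a w) 1) := by
  classical
  let s : Set (VotingSpace φ) := {f | ∀ v ∈ Finset.univ.erase w, f.1 v.1 = a v}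
  have hs := measurableSet_votes (φ := φ) n w (Finset.univ.erase w) (by simp) a
  have hset : levelSet φ n a = {f : VotingSpace φ | f.1 w.1 = a w} ∩ s := by
    ext f
    simp only [levelSet, Set.mem_ofPred_eq, Set.mem_inter_iff, s, Finset.mem_erase, Finset.mem_univ,
      and_true]
    constructor
    · exact fun h => ⟨h w, fun v _ => h v⟩
    · rintro ⟨h1, h2⟩ v
      by_cases hv : v = w
      · rw [hv, h1]
      · exact h2 v hv
  refine ⟨(votingMeasure φ).real s, ?_⟩
  rw [← indL2_vote]
  have hwm := measurableSet_vote_votingSigma (φ := φ)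
    (A := clopenCylinder w.1) (v := w.1) (subset_refl _) (a w)
  refine projL2_eq_of_setIntegral _ (Submodule.smul_mem _ _
    (indL2_mem (votingSigma_le _) hwm)) fun u hu => ?_
  have hu' := votingSigma_le _ u hu
  rw [← inner_indL2 hu', ← inner_indL2 hu', inner_smul_right, inner_indL2_indL2,
    inner_indL2_indL2, hset, ← Set.inter_assoc, measureReal_inter_of_disjoint
      (A := clopenCylinder w.1) disjoint_compl_right (hu.inter hwm) hs]
  push_cast
  ring

/-- For `k ≥ n` only the additive part at level `n` matters, and for a level set that part is a
finite sum of centred one-vote functions. -/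
theorem tendsto_chaosProj_levelSet (hm : 1 < m) (n : ℕ) (a : Level m n → Fin r) :
    Filter.Tendsto (fun k => chaosProj φ k
      (indL2 (votingMeasure φ) (measurableSet_levelSet n a))) Filter.atTop (nhds 0) := by
  set x := indL2 (votingMeasure φ) (measurableSet_levelSet n a)
  have h1 : ∀ w : Level m n, Filter.Tendsto (fun k => chaosProj φ k (centredProj φ w.1 x))
      Filter.atTop (nhds 0) := by
    intro w
    obtain ⟨t, ht⟩ := vertexProj_indL2_levelSet n a w
    have h2 : centredProj φ w.1 x =
        t • centredProj φ w.1 (vertexFun φ w.1 (Pi.single (a w) 1)) := by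
      rw [centredProj_apply, ← inner_oneL2_vertexProj w.1 x, ht, centredProj_apply,
        projL2_eq_self _ (vertexFun_mem _ _), inner_smul_right, smul_sub, smul_smul]
    simp only [h2, map_smul]
    simpa using (tendsto_chaosProj_centredProj_vertexFun hm w.1 _).const_smul t
  have h2 := tendsto_finsetSum (Finset.univ : Finset (Level m n)) fun w _ => h1 w
  rw [Finset.sum_const_zero] at h2
  refine h2.congr' ?_
  filter_upwards [Filter.eventually_ge_atTop n] with k hk
  rw [← map_sum, ← chaosProj_apply, chaosProj_chaosProj hk]

/-- There are no nonzero functions that are, for each `n`, sums of functions of the values below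
the single vertices of level `n`. -/
theorem tendsto_chaosProj (hm : 1 < m) (x : VotingL2 φ) :
    Filter.Tendsto (fun n => chaosProj φ n x) Filter.atTop (nhds 0) := by
  let K : Submodule ℂ (VotingL2 φ) :=
    { carrier := {x | Filter.Tendsto (fun n => chaosProj φ n x) Filter.atTop (nhds 0)}
      zero_mem' := by simp
      add_mem' := fun {x y} hx hy => by
        have hx' : Filter.Tendsto (fun n => chaosProj φ n x) Filter.atTop (nhds 0) := hx
        have := hx'.add hy
        simpa using this
      smul_mem' := fun c x hx => by
        have hx' : Filter.Tendsto (fun n => chaosProj φ n x) Filter.atTop (nhds 0) := hx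
        have := hx'.const_smul c
        simpa using this }
  have hK : K.topologicalClosure = ⊤ := by
    rw [Submodule.topologicalClosure_eq_top_iff, Submodule.eq_bot_iff]
    intro y hy
    refine eq_of_forall_levelSet fun n a => ?_
    rw [← inner_indL2 (measurableSet_levelSet n a), ← inner_indL2 (measurableSet_levelSet n a),
      inner_zero_right]
    exact hy _ (tendsto_chaosProj_levelSet hm n a)
  refine tendsto_chaosProj_of_small fun ε hε => ?_
  have hx : x ∈ closure (K : Set (VotingL2 φ)) := by
    rw [← Submodule.topologicalClosure_coe, hK]; trivial
  obtain ⟨y, hy, hxy⟩ := Metric.mem_closure_iff.1 hx (ε / 2) (half_pos hε)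
  have hy' : Filter.Tendsto (fun n => chaosProj φ n y) Filter.atTop (nhds 0) := hy
  obtain ⟨n, hn⟩ := (Metric.tendsto_atTop.1 hy') (ε / 2) (half_pos hε)
  refine ⟨n, ?_⟩
  have h1 := hn n le_rfl
  rw [dist_zero_right] at h1
  have h2 : chaosProj φ n x = chaosProj φ n y + chaosProj φ n (x - y) := by
    rw [← map_add, add_sub_cancel]
  rw [h2]
  have h3 := (norm_chaosProj_le n (x - y)).trans_lt (by rwa [← dist_eq_norm])
  linarith [norm_add_le (chaosProj φ n y) (chaosProj φ n (x - y))]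

end Decay

/-! ### Level averages and the rigidity of multiplicative functions -/

section LevelAverages

variable {m r : ℕ} [NeZero m] [NeZero r] {φ : VotingRule m r}

/-- The function of the values at level `n` with the same integrals over the level sets as `x`. -/
noncomputable def levelAvg (n : ℕ) (x : VotingL2 φ) : VotingL2 φ :=
  ∑ a : Level m n → Fin r, ((r : ℂ) ^ (m ^ n) * ∫ ω in levelSet φ n a, x ω ∂votingMeasure φ) •
    indL2 (votingMeasure φ) (measurableSet_levelSet n a)

theorem setIntegral_levelAvg_levelSet (n : ℕ) (x : VotingL2 φ) (a : Level m n → Fin r) :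
    ∫ ω in levelSet φ n a, levelAvg n x ω ∂votingMeasure φ =
      ∫ ω in levelSet φ n a, x ω ∂votingMeasure φ := by
  have hr' : (r : ℂ) ≠ 0 := by exact_mod_cast NeZero.ne r
  rw [← inner_indL2 (measurableSet_levelSet n a), levelAvg, inner_sum, Finset.sum_eq_single a]
  · rw [inner_smul_right, inner_indL2_indL2, Set.inter_self, measureReal_levelSet]
    push_cast
    rw [mul_right_comm, ← mul_pow, mul_inv_cancel₀ hr', one_pow, one_mul]
  · intro b _ hb
    rw [inner_smul_right, inner_indL2_indL2, (disjoint_levelSet hb.symm).inter_eq,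
      measureReal_empty]
    simp
  · simp

theorem inner_levelAvg (n : ℕ) (x y : VotingL2 φ) :
    ⟪levelAvg n x, y⟫_ℂ = ∑ a : Level m n → Fin r, (r : ℂ) ^ (m ^ n) *
      (starRingEnd ℂ (∫ ω in levelSet φ n a, x ω ∂votingMeasure φ) *
        ∫ ω in levelSet φ n a, y ω ∂votingMeasure φ) := by
  rw [levelAvg, sum_inner]
  refine Finset.sum_congr rfl fun a _ => ?_
  rw [inner_smul_left, inner_indL2, map_mul, map_pow, Complex.conj_natCast, mul_assoc]

theorem norm_sq_levelAvg (n : ℕ) (x : VotingL2 φ) : ‖levelAvg n x‖ ^ 2 =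
    ∑ a : Level m n → Fin r, (r : ℝ) ^ (m ^ n) *
      ‖∫ ω in levelSet φ n a, x ω ∂votingMeasure φ‖ ^ 2 := by
  have h := inner_self_eq_norm_sq_to_K (𝕜 := ℂ) (levelAvg n x)
  rw [inner_levelAvg] at h
  simp only [setIntegral_levelAvg_levelSet, Complex.conj_mul'] at h
  have h2 : ((‖levelAvg n x‖ ^ 2 : ℝ) : ℂ) = ((∑ a : Level m n → Fin r, (r : ℝ) ^ (m ^ n) *
      ‖∫ ω in levelSet φ n a, x ω ∂votingMeasure φ‖ ^ 2 : ℝ) : ℂ) := by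
    push_cast
    exact h.symm
  exact_mod_cast h2

theorem inner_indL2_levelAvg {n k : ℕ} (hnk : n ≤ k) (a : Level m n → Fin r) (x : VotingL2 φ) :
    ⟪indL2 (votingMeasure φ) (measurableSet_levelSet n a), levelAvg k x⟫_ℂ =
      ⟪indL2 (votingMeasure φ) (measurableSet_levelSet n a), x⟫_ℂ := by
  classical
  have hs : ∀ b, (∃ f ∈ levelSet φ n a, f ∈ levelSet φ k b) → levelSet φ k b ⊆ levelSet φ n a :=
    fun b ⟨f, hfa, hfb⟩ => levelSet_subset hnk hfa hfb
  rw [inner_indL2, inner_indL2, setIntegral_eq_sum_levelSet hs (integrable_L2 _),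
    setIntegral_eq_sum_levelSet hs (integrable_L2 _)]
  exact Finset.sum_congr rfl fun b _ => setIntegral_levelAvg_levelSet k x b

theorem inner_oneL2_levelAvg (n : ℕ) (x : VotingL2 φ) :
    ⟪oneL2 (votingMeasure φ), levelAvg n x⟫_ℂ = ∫ ω, x ω ∂votingMeasure φ := by
  classical
  rw [inner_oneL2, ← setIntegral_univ, ← setIntegral_univ (f := x),
    setIntegral_eq_sum_levelSet (n := n) (fun a _ => Set.subset_univ _) (integrable_L2 _),
    setIntegral_eq_sum_levelSet (n := n) (fun a _ => Set.subset_univ _) (integrable_L2 x)]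
  exact Finset.sum_congr rfl fun b _ => setIntegral_levelAvg_levelSet n x b

/-- Bessel's inequality for the functions of the value at the vertex `w`. -/
theorem mul_sum_norm_sq_le_vertexProj (w : List (Fin m)) (x : VotingL2 φ) :
    (r : ℝ) * ∑ c, ‖∫ ω in {f | f.1 w = c}, x ω ∂votingMeasure φ‖ ^ 2 ≤
      ‖vertexProj φ w x‖ ^ 2 := by
  have hr : (0 : ℝ) < r := by exact_mod_cast NeZero.pos r
  set ρ : Fin r → ℂ := fun c => ∫ ω in {f | f.1 w = c}, x ω ∂votingMeasure φ with hρ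
  set t := ∑ c, ‖ρ c‖ ^ 2 with ht
  -- Testing against the function with coefficients `ρ` itself makes Cauchy–Schwarz give the sharp
  -- constant.
  have h1 : ⟪vertexFun φ w ρ, vertexProj φ w x⟫_ℂ = (t : ℂ) := by
    rw [← inner_projL2_left, projL2_eq_self _ (vertexFun_mem w ρ), inner_vertexFun]
    simp only [ht]
    push_cast
    exact Finset.sum_congr rfl fun c _ => Complex.conj_mul' _
  have h2 := norm_sq_vertexFun (φ := φ) w ρ
  have h3 := norm_inner_le_norm (𝕜 := ℂ) (vertexFun φ w ρ) (vertexProj φ w x)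
  have ht0 : 0 ≤ t := Finset.sum_nonneg fun c _ => by positivity
  rw [h1, Complex.norm_real, Real.norm_of_nonneg ht0] at h3
  have h4 : t ^ 2 ≤ (r : ℝ)⁻¹ * t * ‖vertexProj φ w x‖ ^ 2 := by
    rw [← h2, ← mul_pow]
    exact pow_le_pow_left₀ ht0 h3 2
  rcases ht0.eq_or_lt with h0 | h0
  · rw [← h0, mul_zero]; positivity
  · have h5 : t * t ≤ t * ((r : ℝ)⁻¹ * ‖vertexProj φ w x‖ ^ 2) := by linarith [h4]
    have h6 := le_of_mul_le_mul_left h5 h0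
    rwa [inv_mul_eq_div, le_div_iff₀ hr, mul_comm] at h6

variable {ψ : VotingL2 φ}
  (hψ : ∀ w b s, MeasurableSet[votingSigma φ (clopenCylinder w)ᶜ] s →
    ∫ ω in {f | f.1 w = b} ∩ s, ψ ω ∂votingMeasure φ =
      (∫ ω in {f | f.1 w = b}, ψ ω ∂votingMeasure φ) * ∫ ω in s, ψ ω ∂votingMeasure φ)

include hψ

/-- The vertices are split off one at a time: the votes at the others depend only on the complement
of the cylinder of `w`. -/
theorem setIntegral_votes_eq_prod (h1 : ∫ ω, ψ ω ∂votingMeasure φ = 1) (n : ℕ)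
    (a : Level m n → Fin r) (W : Finset (Level m n)) :
    ∫ ω in {f | ∀ v ∈ W, f.1 v.1 = a v}, ψ ω ∂votingMeasure φ =
      ∏ v ∈ W, ∫ ω in {f | f.1 v.1 = a v}, ψ ω ∂votingMeasure φ := by
  classical
  induction W using Finset.induction_on with
  | empty => simpa using h1
  | insert w W hw ih =>
    rw [Finset.prod_insert hw, ← ih, ← hψ w.1 (a w) _ (measurableSet_votes n w W hw a)]
    congr 2
    ext f
    simp

/-- The sum over all assignments of a product over vertices is a product of sums. By Bessel each
factor is at most `1 + ‖centredProj φ w ψ‖²`, and `1 + t ≤ exp t` turns the product into the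
exponential of a sum. -/
theorem norm_sq_levelAvg_le (h1 : ∫ ω, ψ ω ∂votingMeasure φ = 1) (n : ℕ) :
    ‖levelAvg n ψ‖ ^ 2 ≤ Real.exp (‖chaosProj φ n ψ‖ ^ 2) := by
  classical
  have h2 : ∀ a : Level m n → Fin r, (r : ℝ) ^ (m ^ n) *
      ‖∫ ω in levelSet φ n a, ψ ω ∂votingMeasure φ‖ ^ 2 =
        ∏ v, (r : ℝ) * ‖∫ ω in {f | f.1 v.1 = a v}, ψ ω ∂votingMeasure φ‖ ^ 2 := by
    intro a
    have h3 := setIntegral_votes_eq_prod hψ h1 n a Finset.univ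
    have h4 : {f : VotingSpace φ | ∀ v ∈ Finset.univ, f.1 v.1 = a v} = levelSet φ n a := by
      ext f; simp [levelSet]
    rw [h4] at h3
    rw [h3, Finset.prod_mul_distrib, Finset.prod_const, Finset.card_univ, card_level, norm_prod,
      Finset.prod_pow]
  rw [norm_sq_levelAvg, Finset.sum_congr rfl fun a _ => h2 a]
  have h5 := (Finset.prod_univ_sum (fun _ : Level m n => (Finset.univ : Finset (Fin r)))
    fun v c => (r : ℝ) * ‖∫ ω in {f | f.1 v.1 = c}, ψ ω ∂votingMeasure φ‖ ^ 2).symm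
  rw [Fintype.piFinset_univ] at h5
  rw [h5, norm_sq_chaosProj, Real.exp_sum]
  refine Finset.prod_le_prod (fun v _ => Finset.sum_nonneg fun c _ => by positivity)
    fun v _ => ?_
  rw [← Finset.mul_sum]
  refine (mul_sum_norm_sq_le_vertexProj v.1 ψ).trans ?_
  rw [norm_sq_vertexProj _ (by rw [inner_oneL2, h1]), add_comm]
  exact Real.add_one_le_exp _

/-- A function of integral one whose integrals factorize over the vertices is constant. -/
theorem eq_oneL2_of_setIntegral_mul (hm : 1 < m) (h1 : ∫ ω, ψ ω ∂votingMeasure φ = 1) :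
    ψ = oneL2 (votingMeasure φ) := by
  refine eq_of_forall_levelSet fun n a => ?_
  set u := indL2 (votingMeasure φ) (measurableSet_levelSet n a)
  rw [← inner_indL2 (measurableSet_levelSet n a), ← inner_indL2 (measurableSet_levelSet n a)]
  refine eq_of_sub_eq_zero (norm_eq_zero.1 (le_antisymm ?_ (norm_nonneg _)))
  rw [← inner_sub_right]
  have h2 : ∀ k ≥ n, ‖⟪u, ψ - oneL2 (votingMeasure φ)⟫_ℂ‖ ≤
      ‖u‖ * Real.sqrt (Real.exp (‖chaosProj φ k ψ‖ ^ 2) - 1) := by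
    intro k hk
    rw [inner_sub_right, ← inner_indL2_levelAvg hk, ← inner_sub_right]
    refine (norm_inner_le_norm _ _).trans ?_
    gcongr
    refine Real.le_sqrt_of_sq_le ?_
    -- Pythagoras: the level average has mean 1.
    have h3 : ‖levelAvg k ψ - oneL2 (votingMeasure φ)‖ ^ 2 = ‖levelAvg k ψ‖ ^ 2 - 1 := by
      rw [@norm_sub_sq ℂ, norm_oneL2, ← inner_conj_symm, inner_oneL2_levelAvg, h1]
      simp
      ring
    rw [h3]
    linarith [norm_sq_levelAvg_le hψ h1 k]
  have h3 : Filter.Tendsto (fun k => ‖u‖ * Real.sqrt (Real.exp (‖chaosProj φ k ψ‖ ^ 2) - 1))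
      Filter.atTop (nhds (‖u‖ * Real.sqrt (Real.exp (‖(0 : VotingL2 φ)‖ ^ 2) - 1))) := by
    refine Filter.Tendsto.const_mul _ (Filter.Tendsto.sqrt (Filter.Tendsto.sub_const
      (Filter.Tendsto.rexp ((tendsto_chaosProj hm ψ).norm.pow 2)) 1))
  have h4 := ge_of_tendsto h3 (Filter.eventually_atTop.2 ⟨n, h2⟩)
  simpa using h4

end LevelAverages

/-! ### Exponential vectors in Fock space -/

section FockSpaces

variable {K : Type} [NormedAddCommGroup K] [InnerProductSpace ℂ K]

theorem algPower_smul (t : ℂ) (h : K) (n : ℕ) : algPower (t • h) n = t ^ n • algPower h n := by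
  induction n with
  | zero =>
    change (1 : ℂ) = t ^ 0 • (1 : ℂ)
    simp
  | succ n ih =>
    change (algPower (t • h) n) ⊗ₜ[ℂ] (t • h) = t ^ (n + 1) • ((algPower h n) ⊗ₜ[ℂ] h)
    rw [ih, TensorProduct.smul_tmul_smul, pow_succ]

theorem expComponent_smul (t : ℂ) (h : K) (n : ℕ) :
    expComponent (t • h) n = t ^ n • expComponent h n := by
  rw [expComponent, expComponent, smul_comm]
  congr 1
  refine Subtype.ext ?_
  change tensorPower (t • h) n = t ^ n • tensorPower h n
  rw [tensorPower, tensorPower, algPower_smul, UniformSpace.Completion.coe_smul]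

theorem inner_expComponent_smul {n : ℕ} (u : symPower K n) (t : ℂ) (h : K) :
    ⟪u, expComponent (t • h) n⟫_ℂ = t ^ n * ⟪u, expComponent h n⟫_ℂ := by
  rw [expComponent_smul]
  change ⟪(u : HilbertTensorPower K n), t ^ n • (expComponent h n : HilbertTensorPower K n)⟫_ℂ = _
  rw [inner_smul_right]
  rfl

theorem inner_expComponent_eq {n : ℕ} (u : symPower K n) (h : K) :
    ⟪u, expComponent h n⟫_ℂ = ((Real.sqrt (n.factorial : ℝ))⁻¹ : ℂ) *
      ⟪(u : HilbertTensorPower K n), tensorPower h n⟫_ℂ := by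
  change ⟪(u : HilbertTensorPower K n),
    ((Real.sqrt (n.factorial : ℝ))⁻¹ : ℂ) • tensorPower h n⟫_ℂ = _
  rw [inner_smul_right]

/-- The exponential vectors are total in the Fock space. -/
theorem topologicalClosure_span_expVector :
    (Submodule.span ℂ (Set.range (expVector : K → FockSpace K))).topologicalClosure = ⊤ := by
  rw [Submodule.topologicalClosure_eq_top_iff, Submodule.eq_bot_iff]
  intro v hv
  have hv' : ∀ h : K, ⟪v, expVector h⟫_ℂ = 0 := fun h =>
    inner_eq_zero_symm.1 (hv _ (Submodule.subset_span ⟨h, rfl⟩))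
  have h1 : ∀ (h : K) (n : ℕ), ⟪v n, expComponent h n⟫_ℂ = 0 := by
    intro h
    -- The function `z ↦ ⟪v, EXP (z h)⟫` is identically zero, and its Taylor coefficients are the
    -- pairings with the single components of `EXP h`.
    have h2 : HasFPowerSeriesAt (0 : ℂ → ℂ)
        (FormalMultilinearSeries.ofScalars ℂ fun n => ⟪v n, expComponent h n⟫_ℂ) 0 := by
      rw [hasFPowerSeriesAt_iff]
      refine Filter.Eventually.of_forall fun z => ?_
      have h3 := lp.hasSum_inner (𝕜 := ℂ) v (expVector (z • h))
      rw [hv'] at h3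
      simp only [Pi.zero_apply, FormalMultilinearSeries.coeff_ofScalars, smul_eq_mul]
      have h4 : (fun n => z ^ n * ⟪v n, expComponent h n⟫_ℂ) =
          fun n => ⟪v n, expVector (z • h) n⟫_ℂ := by
        funext n
        exact (inner_expComponent_smul (v n) z h).symm
      rwa [h4]
    have h4 := h2.eq_zero
    intro n
    have h5 : (FormalMultilinearSeries.ofScalars ℂ fun n => ⟪v n, expComponent h n⟫_ℂ).coeff n
      = 0 := by rw [h4]; rfl
    rwa [FormalMultilinearSeries.coeff_ofScalars] at h5
  have h2 : ∀ n, ((v n : symPower K n) : HilbertTensorPower K n) ∈ (symPower K n)ᗮ := by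
    intro n
    change _ ∈ (Submodule.span ℂ (Set.range fun h : K => tensorPower h n)).topologicalClosureᗮ
    rw [Submodule.orthogonal_closure, Submodule.mem_orthogonal']
    intro y hy
    refine Submodule.span_induction (p := fun y _ => ⟪((v n : symPower K n) :
      HilbertTensorPower K n), y⟫_ℂ = 0) ?_ (inner_zero_right _) (fun y z _ _ hy hz => by
        rw [inner_add_right, hy, hz, add_zero]) (fun c y _ hy => by
        rw [inner_smul_right, hy, mul_zero]) hy
    rintro _ ⟨h, rfl⟩
    have h3 := (inner_expComponent_eq (v n) h).symm.trans (h1 h n)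
    refine (mul_eq_zero.1 h3).resolve_left (inv_ne_zero ?_)
    have : Real.sqrt (n.factorial : ℝ) ≠ 0 := by positivity
    exact_mod_cast this
  refine lp.ext (funext fun n => Subtype.ext ?_)
  exact inner_self_eq_zero.1 (Submodule.inner_right_of_mem_orthogonal (v n).2 (h2 n))

theorem eq_of_forall_expVector {F : Type*} [NormedAddCommGroup F] [NormedSpace ℂ F]
    {f g : FockSpace K →L[ℂ] F} (h : ∀ k : K, f (expVector k) = g (expVector k)) : f = g := by
  refine ContinuousLinearMap.ext_on (s := Set.range (expVector : K → FockSpace K)) ?_ ?_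
  · rw [Submodule.dense_iff_topologicalClosure_eq_top]
    exact topologicalClosure_span_expVector
  · rintro _ ⟨k, rfl⟩
    exact h k

theorem norm_sq_expVector (h : K) : ‖expVector h‖ ^ 2 = Real.exp (‖h‖ ^ 2) := by
  have h1 := inner_self_eq_norm_sq_to_K (𝕜 := ℂ) (expVector h)
  rw [inner_expVector, inner_self_eq_norm_sq_to_K] at h1
  have h2 : ((‖expVector h‖ ^ 2 : ℝ) : ℂ) = ((Real.exp (‖h‖ ^ 2) : ℝ) : ℂ) := by
    push_cast; exact h1.symm
  exact_mod_cast h2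

theorem expVector_ne_zero (h : K) : expVector h ≠ 0 := by
  intro h0
  have h1 := norm_sq_expVector h
  rw [h0, norm_zero, zero_pow two_ne_zero] at h1
  exact (Real.exp_pos _).ne h1

theorem continuous_expVector : Continuous (expVector : K → FockSpace K) := by
  rw [continuous_iff_continuousAt]
  intro h
  rw [ContinuousAt, tendsto_iff_norm_sub_tendsto_zero]
  have h1 : ∀ k : K, ‖expVector k - expVector h‖ = Real.sqrt (Real.exp (‖k‖ ^ 2) -
      2 * (Complex.exp ⟪k, h⟫_ℂ).re + Real.exp (‖h‖ ^ 2)) := by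
    intro k
    rw [← norm_sq_expVector, ← norm_sq_expVector, ← inner_expVector]
    have h2 := @norm_sub_sq ℂ _ _ _ _ (expVector k) (expVector h)
    change _ = Real.sqrt (‖expVector k‖ ^ 2 - 2 * RCLike.re ⟪expVector k, expVector h⟫_ℂ +
      ‖expVector h‖ ^ 2)
    rw [← h2, Real.sqrt_sq (norm_nonneg _)]
  simp only [h1]
  have h3 : Continuous fun k : K => Real.sqrt (Real.exp (‖k‖ ^ 2) -
      2 * (Complex.exp ⟪k, h⟫_ℂ).re + Real.exp (‖h‖ ^ 2)) := by fun_prop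
  have h4 := h3.tendsto h
  rw [← h1, sub_self, norm_zero] at h4
  exact h4

/-- Exponential vectors of distinct vectors are not proportional. -/
theorem eq_of_expVector_eq_smul {h k : K} {c : ℂ} (hc : expVector h = c • expVector k) :
    h = k := by
  have h1 : ‖⟪expVector k, expVector h⟫_ℂ‖ = ‖expVector k‖ * ‖expVector h‖ := by
    rw [hc, inner_smul_right, norm_mul, norm_smul, inner_self_eq_norm_sq_to_K, norm_pow]
    simp
    ring
  -- Equality in Cauchy–Schwarz, squared; comparing exponents gives `‖k - h‖ = 0`.
  have h2 : Real.exp (2 * (⟪k, h⟫_ℂ).re) = Real.exp (‖k‖ ^ 2 + ‖h‖ ^ 2) := by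
    rw [Real.exp_add, ← norm_sq_expVector, ← norm_sq_expVector, ← mul_pow, ← h1, inner_expVector,
      Complex.norm_exp, ← Real.exp_nat_mul]
    norm_num
  have h3 := Real.exp_injective h2
  have h4 := @norm_sub_sq ℂ _ _ _ _ k h
  have h5 : ‖k - h‖ ^ 2 = 0 := by
    rw [h4]
    change ‖k‖ ^ 2 - 2 * (⟪k, h⟫_ℂ).re + ‖h‖ ^ 2 = 0
    linarith
  exact (sub_eq_zero.1 (norm_eq_zero.1 (pow_eq_zero_iff two_ne_zero |>.1 h5))).symm

/-- If each exponential vector is orthogonal or proportional to a nonzero vector `Ψ`, then the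
Fock space is one-dimensional. -/
theorem exists_smul_of_expVector {Ψ : FockSpace K} (h0 : Ψ ≠ 0)
    (hΨ : ∀ h : K, ⟪expVector h, Ψ⟫_ℂ = 0 ∨ ∃ c : ℂ, expVector h = c • Ψ) (x : FockSpace K) :
    ∃ c : ℂ, x = c • Ψ := by
  obtain ⟨h₀, hh₀⟩ : ∃ h : K, ⟪expVector h, Ψ⟫_ℂ ≠ 0 := by
    by_contra! hcon
    refine h0 (ext_inner_left ℂ fun y => ?_)
    rw [inner_zero_right]
    have h1 := eq_of_forall_expVector (f := (innerSL ℂ Ψ : FockSpace K →L[ℂ] ℂ)) (g := 0)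
      fun h => inner_eq_zero_symm.1 (hcon h)
    exact inner_eq_zero_symm.1 (DFunLike.congr_fun h1 y)
  obtain ⟨c₀, hc₀⟩ := (hΨ h₀).resolve_left hh₀
  have hc₀' : c₀ ≠ 0 := by
    rintro rfl
    exact expVector_ne_zero h₀ (by rw [hc₀, zero_smul])
  -- Near `h₀` exponential vectors stay non-orthogonal to `Ψ`, hence proportional to `Ψ` and to `EXP
  -- h₀`. A small multiple of `k` added to `h₀` then changes nothing.
  have h2 : ∀ k : K, k = 0 := by
    intro k
    have h3 : Continuous fun t : ℂ => ⟪expVector (h₀ + t • k), Ψ⟫_ℂ :=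
      (continuous_expVector.comp (by fun_prop)).inner continuous_const
    have h4 : ∀ᶠ t in nhds (0 : ℂ), ⟪expVector (h₀ + t • k), Ψ⟫_ℂ ≠ 0 :=
      (h3.tendsto 0).eventually_ne (by simpa using hh₀)
    obtain ⟨ε, hε, h5⟩ := Metric.eventually_nhds_iff.1 h4
    have h6 := h5 (y := ((ε / 2 : ℝ) : ℂ)) (by
      rw [dist_zero_right, Complex.norm_real, Real.norm_of_nonneg (by positivity)]; linarith)
    obtain ⟨c, hc⟩ := (hΨ _).resolve_left h6
    have h7 : expVector (h₀ + ((ε / 2 : ℝ) : ℂ) • k) = (c * c₀⁻¹) • expVector h₀ := by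
      rw [hc, hc₀, smul_smul, inv_mul_cancel_right₀ hc₀']
    have h8 := eq_of_expVector_eq_smul h7
    rw [add_eq_left, smul_eq_zero] at h8
    refine h8.resolve_left ?_
    have : (ε / 2 : ℝ) ≠ 0 := by positivity
    exact_mod_cast this
  have h3 : Submodule.span ℂ (Set.range (expVector : K → FockSpace K)) ≤
      Submodule.span ℂ {Ψ} := by
    rw [Submodule.span_le]
    rintro _ ⟨h, rfl⟩
    rw [h2 h, ← h2 h₀, hc₀]
    exact Submodule.smul_mem _ _ (Submodule.mem_span_singleton_self Ψ)
  have h4 := Submodule.topologicalClosure_minimal _ h3 (Submodule.closed_of_finiteDimensional _)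
  rw [topologicalClosure_span_expVector] at h4
  obtain ⟨c, hc⟩ := Submodule.mem_span_singleton.1 (h4 (Submodule.mem_top (x := x)))
  exact ⟨c, hc.symm⟩

end FockSpaces

/-! ### Projections that reduce a Fock algebra to the scalars -/

section FockProjections

variable {K : Type} [NormedAddCommGroup K] [InnerProductSpace ℂ K] {K₁ K₂ : Submodule ℂ K}

theorem apply_apply_apply_eq_smul {H : Type*} [NormedAddCommGroup H] [NormedSpace ℂ H]
    {E T : H →L[ℂ] H} {u v : H} {c d : ℂ} (hu : E u = d • v) (hv : E (T v) = c • v) :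
    E (T (E u)) = c • E u := by
  rw [hu, map_smul, map_smul, hv, smul_comm]

theorem inner_expVector_add (hO : ∀ a ∈ K₁, ∀ b ∈ K₂, ⟪a, b⟫_ℂ = 0) (h k : K₁) (h' k' : K₂) :
    ⟪expVector ((h : K) + h'), expVector ((k : K) + k')⟫_ℂ =
      Complex.exp ⟪h, k⟫_ℂ * Complex.exp ⟪h', k'⟫_ℂ := by
  rw [inner_expVector, ← Complex.exp_add, inner_add_left, inner_add_right, inner_add_right,
    hO _ h.2 _ k'.2, inner_eq_zero_symm.1 (hO _ k.2 _ h'.2), add_zero, zero_add]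
  rfl

/-- The closed span of the vectors `EXP h ⊗ EXP k'`, where `h` is fixed. -/
noncomputable def expSlice (K₂ : Submodule ℂ K) (h : K) : Submodule ℂ (FockSpace K) :=
  (Submodule.span ℂ (Set.range fun k' : K₂ => expVector (h + k'))).topologicalClosure

instance (h : K) : CompleteSpace (expSlice K₂ h) :=
  (Submodule.isClosed_topologicalClosure _).completeSpace_coe

theorem expVector_mem_expSlice (h : K) (k' : K₂) : expVector (h + k') ∈ expSlice K₂ h :=
  Submodule.le_topologicalClosure _ (Submodule.subset_span ⟨k', rfl⟩)

theorem mem_orthogonal_expSlice {h : K} {x : FockSpace K}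
    (hx : ∀ k' : K₂, ⟪expVector (h + k'), x⟫_ℂ = 0) : x ∈ (expSlice K₂ h)ᗮ := by
  rw [expSlice, Submodule.orthogonal_closure, Submodule.mem_orthogonal]
  intro y hy
  refine Submodule.span_induction (p := fun y _ => ⟪y, x⟫_ℂ = 0) ?_ (inner_zero_left _)
    (fun y z _ _ hy hz => by rw [inner_add_left, hy, hz, add_zero])
    (fun c y _ hy => by rw [inner_smul_left, hy, mul_zero]) hy
  rintro _ ⟨k', rfl⟩
  exact hx k'

theorem starProjection_expSlice (hO : ∀ a ∈ K₁, ∀ b ∈ K₂, ⟪a, b⟫_ℂ = 0) (h k : K₁) (k' : K₂) :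
    (expSlice K₂ (h : K)).starProjection (expVector ((k : K) + k')) =
      Complex.exp (⟪h, k⟫_ℂ - ⟪h, h⟫_ℂ) • expVector ((h : K) + k') := by
  refine Submodule.eq_starProjection_of_mem_orthogonal
    (Submodule.smul_mem _ _ (expVector_mem_expSlice _ _)) (mem_orthogonal_expSlice fun l' => ?_)
  rw [inner_sub_right, inner_smul_right, inner_expVector_add hO, inner_expVector_add hO,
    ← mul_assoc, ← Complex.exp_add (⟪h, k⟫_ℂ - _), sub_add_cancel, sub_self]

/-- The orthogonal projection onto a one-dimensional subspace of `EXP K₁`, tensored with the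
identity, reduces the algebra `B(EXP K₁) ⊗ 1` to the scalars. -/
theorem exists_projection_fockAlgebra (hO : ∀ a ∈ K₁, ∀ b ∈ K₂, ⟪a, b⟫_ℂ = 0)
    (hsum : ∀ h : K, ∃ (a : K₁) (b : K₂), h = a + b) (h : K) :
    ∃ E ∈ fockAlgebra K₁ K₂, (∀ x y, ⟪E x, y⟫_ℂ = ⟪x, E y⟫_ℂ) ∧ (∀ x, E (E x) = E x) ∧
      E (expVector h) = expVector h ∧
      ∀ T ∈ fockAlgebra K₁ K₂, ∃ c : ℂ, ∀ x, E (T (E x)) = c • E x := by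
  obtain ⟨a, b, rfl⟩ := hsum h
  set E := (expSlice K₂ (a : K)).starProjection with hE
  have hsa : ∀ x y, ⟪E x, y⟫_ℂ = ⟪x, E y⟫_ℂ := fun x y =>
    Submodule.inner_starProjection_left_eq_right _ x y
  have happ : ∀ (k : K₁) (k' : K₂), E (expVector ((k : K) + k')) =
      Complex.exp (⟪a, k⟫_ℂ - ⟪a, a⟫_ℂ) • expVector ((a : K) + k') :=
    starProjection_expSlice hO a
  have hfix : ∀ k' : K₂, E (expVector ((a : K) + k')) = expVector ((a : K) + k') := by
    intro k'
    rw [happ, sub_self, Complex.exp_zero, one_smul]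
  refine ⟨E, ?_, hsa, fun x => ?_, hfix b, ?_⟩
  -- On `EXP K₁` the operator is the projection onto the line of `EXP a`; the scalar divides by
  -- `‖EXP a‖²`.
  · refine ⟨Complex.exp (-⟪a, a⟫_ℂ) • (innerSL ℂ (expVector a)).smulRight (expVector a),
      fun h k h' k' => ?_⟩
    rw [happ, inner_smul_right, inner_expVector_add hO, _root_.smul_apply,
      inner_smul_right, ContinuousLinearMap.smulRight_apply, inner_smul_right,
      innerSL_apply_apply, inner_expVector, inner_expVector, inner_expVector, sub_eq_add_neg,
      Complex.exp_add]
    ring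
  · exact Submodule.starProjection_eq_self_iff.2 (Submodule.starProjection_apply_mem _ x)
  · rintro T ⟨S, hS⟩
    -- The expectation of `S` in the normalized vector `EXP a`.
    set c := ⟪expVector a, S (expVector a)⟫_ℂ * Complex.exp (-⟪a, a⟫_ℂ) with hc
    refine ⟨c, fun x => ?_⟩
    have h1 : ∀ k' : K₂, E (T (expVector ((a : K) + k'))) = c • expVector ((a : K) + k') := by
      intro k'
      refine Submodule.eq_starProjection_of_mem_orthogonal
        (Submodule.smul_mem _ _ (expVector_mem_expSlice _ _))
        (mem_orthogonal_expSlice fun l' => ?_)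
      rw [inner_sub_right, inner_smul_right, hS, inner_expVector_add hO, hc, inner_expVector,
        mul_assoc, ← mul_assoc (Complex.exp (-_)), ← Complex.exp_add, neg_add_cancel,
        Complex.exp_zero, one_mul, sub_self]
    have h2 : E ∘L T ∘L E = c • E := by
      refine eq_of_forall_expVector fun k => ?_
      obtain ⟨k, k', rfl⟩ := hsum k
      exact apply_apply_apply_eq_smul (happ k k') (h1 k')
    exact DFunLike.congr_fun h2 x

end FockProjections

/-! ### Orthogonal splitting of a direct integral -/

section DirectIntegrals

variable {X : Type} [MeasurableSpace X] {ν : Measure X} {s : ℕ → X → Ell2}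

theorem inner_directIntegralPart_compl (A : Set X) (F : directIntegral ν s)
    (hF : F ∈ directIntegralPart ν s A) (G : directIntegral ν s)
    (hG : G ∈ directIntegralPart ν s Aᶜ) : ⟪F, G⟫_ℂ = 0 := by
  rw [Submodule.coe_inner, L2.inner_def]
  refine integral_eq_zero_of_ae ?_
  filter_upwards [hF, hG] with x h1 h2
  by_cases hx : x ∈ A
  · rw [h2 (by simpa using hx)]; simp
  · rw [h1 hx]; simp

theorem exists_mem_directIntegralPart_add {A : Set X} (hA : MeasurableSet A)
    (F : directIntegral ν s) :
    ∃ (G : directIntegralPart ν s A) (G' : directIntegralPart ν s Aᶜ),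
      F = (G : directIntegral ν s) + G' := by
  have key : ∀ B : Set X, MeasurableSet B → ∃ G : directIntegralPart ν s B,
      ((G : directIntegral ν s) : Lp Ell2 2 ν) =ᵐ[ν] B.indicator (F : Lp Ell2 2 ν) := by
    intro B hB
    have h1 := (Lp.memLp (F : Lp Ell2 2 ν)).indicator hB
    have h2 := h1.coeFn_toLp
    refine ⟨⟨⟨h1.toLp _, ?_⟩, ?_⟩, h2⟩
    · have hF : ∀ᵐ x ∂ν, (F : Lp Ell2 2 ν) x ∈ fieldFibre s x := F.2
      change ∀ᵐ x ∂ν, h1.toLp _ x ∈ fieldFibre s x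
      filter_upwards [h2, hF] with x h3 h4
      rw [h3]
      by_cases hx : x ∈ B
      · rwa [Set.indicator_of_mem hx]
      · rw [Set.indicator_of_notMem hx]; exact Submodule.zero_mem _
    · change ∀ᵐ x ∂ν, x ∉ B → h1.toLp _ x = 0
      filter_upwards [h2] with x h3 hx
      rw [h3, Set.indicator_of_notMem hx]
  obtain ⟨G, hG⟩ := key A hA
  obtain ⟨G', hG'⟩ := key Aᶜ hA.compl
  refine ⟨G, G', Subtype.ext (Lp.ext ?_)⟩
  rw [Submodule.coe_add]
  filter_upwards [hG, hG', Lp.coeFn_add ((G : directIntegral ν s) : Lp Ell2 2 ν)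
    ((G' : directIntegral ν s) : Lp Ell2 2 ν)] with x h1 h2 h3
  rw [h3, Pi.add_apply, h1, h2, ← Pi.add_apply, Set.indicator_self_add_compl]

end DirectIntegrals

/-! ### Multiplication by indicators -/

section IndicatorOperators

variable {Ω : Type*} {m0 : MeasurableSpace Ω} {μ : Measure Ω}

/-- Multiplication by the indicator function of a measurable set. -/
noncomputable def mulIndL2 (μ : Measure Ω) {s : Set Ω} (hs : MeasurableSet s) :
    Lp ℂ 2 μ →L[ℂ] Lp ℂ 2 μ :=
  LinearMap.mkContinuous
    { toFun := fun x => ((Lp.memLp x).indicator hs).toLp _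
      map_add' := fun x y => by
        rw [← MemLp.toLp_add]
        refine MemLp.toLp_congr _ _ ?_
        filter_upwards [Lp.coeFn_add x y] with ω h
        rw [← Set.indicator_add']
        exact congrArg (fun z => s.indicator (fun _ => z) ω) h
      map_smul' := fun c x => by
        rw [RingHom.id_apply, ← MemLp.toLp_const_smul]
        refine MemLp.toLp_congr _ _ ?_
        filter_upwards [Lp.coeFn_smul c x] with ω h
        rw [Pi.smul_apply, ← Set.indicator_const_smul_apply]
        exact congrArg (fun z => s.indicator (fun _ => z) ω) h } 1 fun x => by
    rw [one_mul]
    refine Lp.norm_le_norm_of_ae_le ?_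
    filter_upwards [((Lp.memLp x).indicator hs).coeFn_toLp] with ω h
    exact (congrArg norm h).trans_le (norm_indicator_le_norm_self _ _)

theorem coeFn_mulIndL2 {s : Set Ω} (hs : MeasurableSet s) (x : Lp ℂ 2 μ) :
    mulIndL2 μ hs x =ᵐ[μ] s.indicator x :=
  ((Lp.memLp x).indicator hs).coeFn_toLp

variable [IsProbabilityMeasure μ]

theorem setIntegral_mulIndL2 {s t : Set Ω} (hs : MeasurableSet s) (x : Lp ℂ 2 μ) :
    ∫ ω in t, mulIndL2 μ hs x ω ∂μ = ∫ ω in s ∩ t, x ω ∂μ := by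
  rw [integral_congr_ae (ae_restrict_of_ae (coeFn_mulIndL2 hs x)), setIntegral_indicator hs,
    Set.inter_comm]

end IndicatorOperators

/-! ### Multiplicativity of product vectors; the factorization is not Fock -/

section Factorization

variable {m r : ℕ} [NeZero m] [NeZero r] {φ : VotingRule m r}

/-- On products this operator is `f ⊗ g ↦ ⟨1_u, f⟩ 1 ⊗ g`. Compressing it by a projection in `ξ(A)`
extracts integrals over `u`. -/
theorem projL2_mulIndL2_mem_votingFactorization (A : Clopens (ℕ → Fin m))
    {u : Set (VotingSpace φ)} (hu : MeasurableSet[votingSigma φ A] u) :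
    projL2 (votingMeasure φ) (votingSigma_le (φ := φ) Aᶜ) ∘L
      mulIndL2 (votingMeasure φ) (votingSigma_le _ u hu) ∈ votingFactorization φ A := by
  have hum := votingSigma_le _ u hu
  refine ⟨((innerSL ℂ (indL2 (votingMeasure φ) hum)) ∘L (votingSubspace φ A).subtypeL).smulRight
    ⟨oneL2 _, oneL2_mem (votingSigma_le _)⟩, fun f g p hp => ?_⟩
  set F := mulIndL2 (votingMeasure φ) hum f with hF
  have h1 : ∀ᵐ ω ∂votingMeasure φ, mulIndL2 (votingMeasure φ) hum p ω = F ω * (g : VotingL2 φ) ω := by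
    filter_upwards [hp, coeFn_mulIndL2 hum p, coeFn_mulIndL2 hum (f : VotingL2 φ)] with ω h h2 h3
    rw [h2, hF, h3]
    by_cases hω : ω ∈ u <;> simp [hω, h]
  have hFm : F ∈ votingSubspace φ A := by
    have hf : AEStronglyMeasurable[votingSigma φ A] (f : VotingL2 φ) (votingMeasure φ) := f.2
    have : AEStronglyMeasurable[votingSigma φ A] F (votingMeasure φ) := by
      refine AEStronglyMeasurable.congr
        (f := u.indicator (f : VotingL2 φ)) ?_ (coeFn_mulIndL2 hum _).symm
      exact ⟨u.indicator hf.mk, hf.stronglyMeasurable_mk.indicator hu, by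
        filter_upwards [hf.ae_eq_mk] with ω h
        simp only [Set.indicator, h]⟩
    exact this
  have h2 := projL2_mul (votingSigma_le Aᶜ) g.2 h1
  have h3 : projL2 (votingMeasure φ) (votingSigma_le Aᶜ) F =
      ⟪indL2 (votingMeasure φ) hum, (f : VotingL2 φ)⟫_ℂ • oneL2 _ := by
    rw [projL2_of_indep (votingSigma_le A) (votingSigma_le Aᶜ)
      (indep_votingSigma (A := A) (B := Aᶜ) disjoint_compl_right) hFm, inner_indL2]
    congr 1
    rw [← setIntegral_univ, setIntegral_mulIndL2, Set.inter_univ]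
  filter_upwards [h2] with ω h4
  rw [ContinuousLinearMap.comp_apply, h4, h3]
  rfl

/-- An operator in `ξ(A)` acts on the functions that are measurable with respect to the complement
of `A` as the multiplication by a function. -/
theorem projL2_apply_of_mem_votingFactorization {A : Clopens (ℕ → Fin m)}
    {R : VotingL2 φ →L[ℂ] VotingL2 φ} (hR : R ∈ votingFactorization φ A) :
    ∃ e : ℂ, ∀ y ∈ votingSubspace φ Aᶜ,
      projL2 (votingMeasure φ) (votingSigma_le (φ := φ) Aᶜ) (R y) = e • y := by
  obtain ⟨S, hS⟩ := hR
  let o : votingSubspace φ A := ⟨oneL2 _, oneL2_mem (votingSigma_le _)⟩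
  refine ⟨∫ ω, (S o : VotingL2 φ) ω ∂votingMeasure φ, fun y hy => ?_⟩
  have h1 := hS o ⟨y, hy⟩ y (by
    filter_upwards [coeFn_oneL2 (μ := votingMeasure φ)] with ω h
    change y ω = oneL2 (votingMeasure φ) ω * y ω
    rw [h, one_mul])
  have h2 := projL2_mul (votingSigma_le Aᶜ) hy h1
  rw [projL2_of_indep (votingSigma_le A) (votingSigma_le Aᶜ)
    (indep_votingSigma (A := A) (B := Aᶜ) disjoint_compl_right) (S o).2] at h2
  refine Lp.ext ?_
  filter_upwards [h2, Lp.coeFn_smul (∫ ω, (S o : VotingL2 φ) ω ∂votingMeasure φ) y,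
    Lp.coeFn_smul (∫ ω, (S o : VotingL2 φ) ω ∂votingMeasure φ) (oneL2 (votingMeasure φ)),
    coeFn_oneL2 (μ := votingMeasure φ)] with ω h3 h4 h5 h6
  rw [h3, h4, h5, Pi.smul_apply, Pi.smul_apply, h6, smul_eq_mul, smul_eq_mul, mul_one]

/-- A function that is fixed by a projection in `ξ(A)` that reduces `ξ(A)` to the scalars is the
product of a function on `A` and a function on the complement of `A`. -/
theorem setIntegral_mul_of_projection {A : Clopens (ℕ → Fin m)}
    {R : VotingL2 φ →L[ℂ] VotingL2 φ} (hR : R ∈ votingFactorization φ A)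
    (hsa : ∀ x y, ⟪R x, y⟫_ℂ = ⟪x, R y⟫_ℂ) (hid : ∀ x, R (R x) = R x)
    (hred : ∀ T ∈ votingFactorization φ A, ∃ c : ℂ, ∀ x, R (T (R x)) = c • R x)
    {ψ : VotingL2 φ} (hψ : R ψ = ψ) (h0 : ∫ ω, ψ ω ∂votingMeasure φ ≠ 0)
    {u s : Set (VotingSpace φ)}
    (hu : MeasurableSet[votingSigma φ A] u) (hs : MeasurableSet[votingSigma φ Aᶜ] s) :
    (∫ ω in u ∩ s, ψ ω ∂votingMeasure φ) * ∫ ω, ψ ω ∂votingMeasure φ =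
      (∫ ω in u, ψ ω ∂votingMeasure φ) * ∫ ω in s, ψ ω ∂votingMeasure φ := by
  obtain ⟨e, he⟩ := projL2_apply_of_mem_votingFactorization hR
  obtain ⟨c, hc⟩ := hred _ (projL2_mulIndL2_mem_votingFactorization A hu)
  -- Pair `R T ψ = c ψ` with `1_t`, where `T` restricts to `u` and averages over `A`. Moving `R` and
  -- the averaging to the other side turns `1_t` into `e 1_t`. The cases `t = s` and the whole space
  -- then eliminate `c`.
  have key : ∀ t, MeasurableSet[votingSigma φ Aᶜ] t →
      c * ∫ ω in t, ψ ω ∂votingMeasure φ =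
        starRingEnd ℂ e * ∫ ω in u ∩ t, ψ ω ∂votingMeasure φ := by
    intro t ht
    have htm := votingSigma_le _ t ht
    have h1 := congrArg (fun x => ⟪indL2 (votingMeasure φ) htm, x⟫_ℂ) (hc ψ)
    simp only [hψ, inner_smul_right] at h1
    rw [inner_indL2 htm ψ] at h1
    rw [← h1, ← hsa, ContinuousLinearMap.comp_apply, ← inner_projL2_left,
      he _ (indL2_mem (votingSigma_le _) ht), inner_smul_left, inner_indL2, setIntegral_mulIndL2]
  -- If `e = 0`, then `‖R 1‖² = ⟪1, R 1⟫ = 0`, so `ψ = R ψ` is orthogonal to 1, against `h0`.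
  have he0 : starRingEnd ℂ e ≠ 0 := by
    intro he0
    have h1 := he _ (oneL2_mem (votingSigma_le (φ := φ) Aᶜ))
    rw [(map_eq_zero _).1 he0, zero_smul] at h1
    have h2 : ⟪R (oneL2 (votingMeasure φ)), R (oneL2 (votingMeasure φ))⟫_ℂ = 0 := by
      rw [hsa, hid, ← projL2_eq_self (votingSigma_le Aᶜ) (oneL2_mem (votingSigma_le (φ := φ) Aᶜ)),
        inner_projL2_left, projL2_eq_self _ (oneL2_mem (votingSigma_le _)), h1, inner_zero_right]
    rw [← inner_oneL2, ← hψ, ← hsa, inner_self_eq_zero.1 h2, inner_zero_left] at h0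
    exact h0 rfl
  have h1 := key Set.univ MeasurableSet.univ
  rw [setIntegral_univ, Set.inter_univ] at h1
  have h2 := key s hs
  refine mul_left_cancel₀ he0 ?_
  linear_combination (∫ ω, ψ ω ∂votingMeasure φ) * (-h2) + (∫ ω in s, ψ ω ∂votingMeasure φ) * h1

/-- A vector of mean different from zero that is, for each vertex, fixed by a projection as above
is constant. -/
theorem exists_smul_oneL2_of_projections (hm : 1 < m) {ψ : VotingL2 φ}
    (h : ∀ A, ∃ R ∈ votingFactorization φ A, (∀ x y, ⟪R x, y⟫_ℂ = ⟪x, R y⟫_ℂ) ∧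
      (∀ x, R (R x) = R x) ∧ R ψ = ψ ∧
        ∀ T ∈ votingFactorization φ A, ∃ c : ℂ, ∀ x, R (T (R x)) = c • R x) :
    ⟪ψ, oneL2 (votingMeasure φ)⟫_ℂ = 0 ∨ ∃ c : ℂ, ψ = c • oneL2 (votingMeasure φ) := by
  by_cases h0 : ∫ ω, ψ ω ∂votingMeasure φ = 0
  · left
    rw [← inner_conj_symm, inner_oneL2, h0, map_zero]
  right
  set z := ∫ ω, ψ ω ∂votingMeasure φ with hz
  have hint : ∀ s, MeasurableSet s → ∫ ω in s, (z⁻¹ • ψ : VotingL2 φ) ω ∂votingMeasure φ =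
      z⁻¹ * ∫ ω in s, ψ ω ∂votingMeasure φ := fun s hs => by
    rw [← inner_indL2 hs, inner_smul_right, inner_indL2]
  have h1 : z⁻¹ • ψ = oneL2 (votingMeasure φ) := by
    refine eq_oneL2_of_setIntegral_mul (fun w b s hs => ?_) hm ?_
    · obtain ⟨R, hR, hsa, hid, hψ, hred⟩ := h (clopenCylinder w)
      have hu := measurableSet_vote_votingSigma (φ := φ) (A := clopenCylinder w) (v := w)
        (subset_refl _) b
      have h2 := setIntegral_mul_of_projection hR hsa hid hred hψ h0 hu hs
      have hum := votingSigma_le _ _ hu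
      have hsm := votingSigma_le _ _ hs
      rw [hint _ (hum.inter hsm), hint _ hum, hint _ hsm]
      rw [← hz] at h2
      field_simp
      linear_combination h2
    · rw [← setIntegral_univ, hint _ MeasurableSet.univ, setIntegral_univ, ← hz,
        inv_mul_cancel₀ h0]
  exact ⟨z, by rw [← h1, smul_inv_smul₀ h0]⟩

/-- If the indicator of a root value were a constant, its mean `1/r` would equal its own square. -/
theorem not_forall_exists_smul_oneL2 (hr : 1 < r) :
    ¬ ∀ x : VotingL2 φ, ∃ c : ℂ, x = c • oneL2 (votingMeasure φ) := by
  intro h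
  have hr0 : (r : ℂ) ≠ 0 := by exact_mod_cast NeZero.ne r
  have hu := measurableSet_vote (φ := φ) [] 0
  obtain ⟨c, hc⟩ := h (indL2 (votingMeasure φ) hu)
  have h1 : ⟪oneL2 (votingMeasure φ), indL2 (votingMeasure φ) hu⟫_ℂ = (r : ℂ)⁻¹ := by
    rw [oneL2, inner_indL2_indL2, Set.univ_inter, votingMeasure_vote]
    push_cast; rfl
  have h2 : ⟪indL2 (votingMeasure φ) hu, indL2 (votingMeasure φ) hu⟫_ℂ = (r : ℂ)⁻¹ := by
    rw [inner_indL2_indL2, Set.inter_self, votingMeasure_vote]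
    push_cast; rfl
  rw [hc, inner_smul_right, inner_oneL2_self, mul_one] at h1
  rw [hc, h1, inner_smul_left, inner_smul_right, inner_oneL2_self, map_inv₀,
    Complex.conj_natCast, mul_one] at h2
  have h3 : (r : ℂ) = 1 := by
    field_simp at h2
    exact h2.symm
  have h4 : r = 1 := by exact_mod_cast h3
  omega

theorem exists_projection_of_conj {H F : Type*} [NormedAddCommGroup H] [InnerProductSpace ℂ H]
    [NormedAddCommGroup F] [InnerProductSpace ℂ F] (U : H ≃ₗᵢ[ℂ] F) {𝒜 : Set (H →L[ℂ] H)}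
    {ℬ : Set (F →L[ℂ] F)} (hU : ∀ T : H →L[ℂ] H, T ∈ 𝒜 ↔
      (U.toContinuousLinearEquiv : H →L[ℂ] F).comp
        (T.comp (U.symm.toContinuousLinearEquiv : F →L[ℂ] H)) ∈ ℬ) {h : F}
    (hE : ∃ E ∈ ℬ, (∀ x y, ⟪E x, y⟫_ℂ = ⟪x, E y⟫_ℂ) ∧ (∀ x, E (E x) = E x) ∧ E h = h ∧
      ∀ T ∈ ℬ, ∃ c : ℂ, ∀ x, E (T (E x)) = c • E x) :
    ∃ R ∈ 𝒜, (∀ x y, ⟪R x, y⟫_ℂ = ⟪x, R y⟫_ℂ) ∧ (∀ x, R (R x) = R x) ∧ R (U.symm h) = U.symm h ∧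
      ∀ T ∈ 𝒜, ∃ c : ℂ, ∀ x, R (T (R x)) = c • R x := by
  obtain ⟨E, hE, hsa, hid, hfix, hred⟩ := hE
  set R : H →L[ℂ] H := (U.symm.toContinuousLinearEquiv : F →L[ℂ] H) ∘L E ∘L
    (U.toContinuousLinearEquiv : H →L[ℂ] F)
  have hR : ∀ x, R x = U.symm (E (U x)) := fun x => rfl
  refine ⟨R, (hU R).2 ?_, fun x y => ?_, fun x => ?_, ?_, fun T hT => ?_⟩
  · convert hE using 1
    refine ContinuousLinearMap.ext fun x => ?_
    change U (R (U.symm x)) = E x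
    rw [hR, U.apply_symm_apply, U.apply_symm_apply]
  · rw [hR, hR, ← U.inner_map_map, ← U.inner_map_map x, U.apply_symm_apply, U.apply_symm_apply,
      hsa]
  · rw [hR, hR, U.apply_symm_apply, hid]
  · rw [hR, U.apply_symm_apply, hfix]
  · obtain ⟨c, hc⟩ := hred _ ((hU T).1 hT)
    refine ⟨c, fun x => ?_⟩
    have h2 : E (U (T (U.symm (E (U x))))) = c • E (U x) := hc (U x)
    rw [hR, hR, h2, map_smul]

theorem inner_eq_zero_or_exists_smul_of_symm {H F : Type*} [NormedAddCommGroup H]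
    [InnerProductSpace ℂ H] [NormedAddCommGroup F] [InnerProductSpace ℂ F] (U : H ≃ₗᵢ[ℂ] F)
    {o : H} {h : F} (ho : ⟪U.symm h, o⟫_ℂ = 0 ∨ ∃ c : ℂ, U.symm h = c • o) :
    ⟪h, U o⟫_ℂ = 0 ∨ ∃ c : ℂ, h = c • U o := by
  rcases ho with ho | ⟨c, hc⟩
  · left
    rw [← ho, ← U.inner_map_map (U.symm h), U.apply_symm_apply]
  · right
    exact ⟨c, by rw [← map_smul, ← hc, U.apply_symm_apply]⟩

theorem exists_smul_of_map {H F : Type*} [NormedAddCommGroup H] [InnerProductSpace ℂ H]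
    [NormedAddCommGroup F] [InnerProductSpace ℂ F] (U : H ≃ₗᵢ[ℂ] F) {o x : H}
    (h : ∃ c : ℂ, U x = c • U o) : ∃ c : ℂ, x = c • o :=
  h.imp fun c hc => U.injective (by rw [hc, map_smul])

/-- For each `h`, the exponential vector provides one projection for every clopen `A`. Pulled back
by `U`, these make `U⁻¹ (EXP h)` orthogonal or proportional to 1, and this for all `h` forces
`L²(Ω)` to be one-dimensional. -/
theorem not_isFockFactorization (hm : 1 < m) (hr : 1 < r) :
    ¬ IsFockFactorization (votingFactorization φ) := by
  rintro ⟨X, _, _, ν, _, s, σ, U, -, hσ, -, -, hU⟩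
  refine not_forall_exists_smul_oneL2 (φ := φ) hr fun x => ?_
  have key : ∀ h : directIntegral ν s,
      ⟪expVector h, U (oneL2 (votingMeasure φ))⟫_ℂ = 0 ∨
        ∃ c : ℂ, expVector h = c • U (oneL2 (votingMeasure φ)) := by
    intro h
    refine inner_eq_zero_or_exists_smul_of_symm U (exists_smul_oneL2_of_projections hm fun A => ?_)
    exact exists_projection_of_conj U (hU A) (exists_projection_fockAlgebra
      (inner_directIntegralPart_compl (σ A)) (exists_mem_directIntegralPart_add (hσ A)) h)
  have h0 : oneL2 (votingMeasure φ) ≠ 0 := fun h0 => by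
    have := norm_oneL2 (μ := votingMeasure φ)
    rw [h0, norm_zero] at this
    exact zero_ne_one this
  exact exists_smul_of_map U
    (exists_smul_of_expVector (fun h => h0 (U.injective (h.trans U.map_zero.symm))) key (U x))

end Factorization

theorem theoremA1 (m r : ℕ) (hm : 1 < m) (hr : 1 < r) (φ : VotingRule m r) :
    (∀ x : ℕ → Fin m, ContinuousAtPoint (votingFactorization φ) x ↔ φ.Abundant) ∧
      (φ.Abundant → ¬ IsFockFactorization (votingFactorization φ)) := by
  have : NeZero m := ⟨by omega⟩
  have : NeZero r := ⟨by omega⟩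
  exact ⟨fun x => ⟨fun h => by_contra fun hφ => not_continuousAtPoint_of_not_abundant hr hφ x h,
    fun h => continuousAtPoint_of_abundant h x⟩, fun _ => not_isFockFactorization hm hr⟩
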